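/- Let $N\ge 3$, $0<\lambda\le\Lambda$ and $R>0$. For a symmetric $N\times N$ matrix $X$ let $$\mathcal M^+_{\lambda,\Lambda}(X)=\sup_{\lambda I\le A\le\Lambda I}\operatorname{tr}(AX),\qquad \mathcal M^-_{\lambda,\Lambda}(X)=\inf_{\lambda I\le A\le\Lambda I}\operatorname{tr}(AX)$$ (with $A$ symmetric) be Pucci's extremal operators, and let $B_R\subset\mathbb R^N$ be the open ball of radius $R$ centered at the origin. For each of the two operators $\mathcal M=\mathcal M^{+}_{\lambda,\Lambda}$ and $\mathcal M=\mathcal M^{-}_{\lambda,\Lambda}$, let $\mathcal C$ be the set of all $(p,q)\in\mathbb R^2$ with $p,q>0$ and $pq>1$ for which there exists a pair $u,v\in C^2(B_R)\cap C(\overline{B_R})$ with $$\mathcal M(D^2u)+v^p=0,\quad \mathcal M(D^2v)+u^q=0,\quad u,v>0\ \text{ in } B_R,\qquad u=v=0\ \text{ on }\partial B_R .$$ Then $\mathcal C$ is an open subset of $\mathbb R^2$. -/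

import Mathlib

/-- Pucci's maximal operator `𝓜⁺(X) = sup { tr (A X) : A symmetric, lam I ≤ A ≤ Lam I }`
on `N × N` real matrices `X`. -/
noncomputable def pucciSup {N : ℕ} (lam Lam : ℝ) (X : Matrix (Fin N) (Fin N) ℝ) : ℝ :=
  sSup {t : ℝ | ∃ A : Matrix (Fin N) (Fin N) ℝ,
    (A - lam • (1 : Matrix (Fin N) (Fin N) ℝ)).PosSemidef ∧
    (Lam • (1 : Matrix (Fin N) (Fin N) ℝ) - A).PosSemidef ∧ t = (A * X).trace}

/-- Pucci's minimal operator `𝓜⁻(X) = inf { tr (A X) : A symmetric, lam I ≤ A ≤ Lam I }`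
on `N × N` real matrices `X`. -/
noncomputable def pucciInf {N : ℕ} (lam Lam : ℝ) (X : Matrix (Fin N) (Fin N) ℝ) : ℝ :=
  sInf {t : ℝ | ∃ A : Matrix (Fin N) (Fin N) ℝ,
    (A - lam • (1 : Matrix (Fin N) (Fin N) ℝ)).PosSemidef ∧
    (Lam • (1 : Matrix (Fin N) (Fin N) ℝ) - A).PosSemidef ∧ t = (A * X).trace}

/-- The Hessian matrix `D²u(x)` of second partial derivatives. -/
noncomputable def hessianMatrix {N : ℕ} (u : EuclideanSpace ℝ (Fin N) → ℝ)
    (x : EuclideanSpace ℝ (Fin N)) : Matrix (Fin N) (Fin N) ℝ :=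
  Matrix.of fun i j =>
    fderiv ℝ (fderiv ℝ u) x (EuclideanSpace.single i 1) (EuclideanSpace.single j 1)

/-- `(u, v)` is a regular (classical) positive solution of the Lane-Emden type system
`F(D²u) + v^p = 0`, `F(D²v) + u^q = 0` in the open ball `B_R` centred at the origin,
with `u = v = 0` on `∂B_R`. No radial symmetry is imposed. -/
structure IsBallDirichletSolution {N : ℕ} (F : Matrix (Fin N) (Fin N) ℝ → ℝ) (p q R : ℝ)
    (u v : EuclideanSpace ℝ (Fin N) → ℝ) : Prop where
  contDiffOn_u : ContDiffOn ℝ 2 u (Metric.ball 0 R)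
  contDiffOn_v : ContDiffOn ℝ 2 v (Metric.ball 0 R)
  continuousOn_u : ContinuousOn u (Metric.closedBall 0 R)
  continuousOn_v : ContinuousOn v (Metric.closedBall 0 R)
  pos_u : ∀ x ∈ Metric.ball 0 R, 0 < u x
  pos_v : ∀ x ∈ Metric.ball 0 R, 0 < v x
  eq_u : ∀ x ∈ Metric.ball 0 R, F (hessianMatrix u x) + v x ^ p = 0
  eq_v : ∀ x ∈ Metric.ball 0 R, F (hessianMatrix v x) + u x ^ q = 0
  boundary_u : ∀ x ∈ Metric.sphere 0 R, u x = 0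
  boundary_v : ∀ x ∈ Metric.sphere 0 R, v x = 0

/-- The set `𝒞` of exponents `(p, q)` with `p, q > 0`, `pq > 1` for which the Dirichlet problem
in the ball `B_R` has a solution. -/
def ballSolvableExponents {N : ℕ} (F : Matrix (Fin N) (Fin N) ℝ → ℝ) (R : ℝ) : Set (ℝ × ℝ) :=
  {pq : ℝ × ℝ | 0 < pq.1 ∧ 0 < pq.2 ∧ 1 < pq.1 * pq.2 ∧
    ∃ u v : EuclideanSpace ℝ (Fin N) → ℝ, IsBallDirichletSolution F pq.1 pq.2 R u v}

open Matrix Filter Topology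

/-! Openness rests on two facts: every solution in the ball is radial and decreasing, and in the
radial shooting problem the simultaneous vanishing of `u` and `v` is a crossing that survives small
changes of `(p, q)`. Both Pucci operators are treated at once through `IsPucciType`: comparison by
traces against elliptic matrices, invariance under reflections, and a piecewise linear value on
matrices with one radial eigenvalue and N - 1 equal tangential ones.

Symmetry is proved by moving planes (`IsBallDirichletSolution.reflectedLE`). The system is
cooperative, so the pair in a cap is compared with its reflection. The difficulty is that t ^ p is
not Lipschitz at 0 when p < 1. The Hopf-type bound v ≥ κ (R² - |x|²) limits the effective Lipschitz
constant to C / (R² - |x|²), and a barrier built from square roots, whose second derivatives blow up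
like the power -3/2 of the distances to the sphere and to the plane, absorbs it in the narrow part
of the cap (`narrow`).

For a decreasing profile the tangential eigenvalue u' / r is nonpositive, so the equation can be
solved for u''. With y = -u' / r it reads r y' + y = τ (v ^ p - k y), with k = (N - 1) s₁. Its
integral form has a comparison principle and a contraction constant n / (n + 1). Replacing powers by
powers of positive parts makes the shooting problem with u(0) = a, v(0) = b globally solvable by
alternating monotone iteration. Solutions are unique: the powers are Lipschitz while both components
are positive, and the system decouples once one of them is not. By uniqueness the decreasing
iteration for one component and the increasing one obtained from the other have the same limit,
which is therefore both upper and lower semicontinuous in all parameters (`continuous_limU`).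

With a fixed, raising b lowers u and raises v by at least the same amount. If both vanish at the
same radius for b₀, then v crosses zero strictly first for a smaller b and u strictly first for a
larger one. These are finitely many strict inequalities, so they persist for nearby exponents, and
connectedness of the interval of values b gives a simultaneous zero again (`Hits.eventually`). Its
radius may have moved; since p q > 1, the scaling of the system brings it back to R. -/

/-- The symmetric matrices with `lam I ≤ A ≤ Lam I`. -/
def ellipticClass (N : ℕ) (lam Lam : ℝ) : Set (Matrix (Fin N) (Fin N) ℝ) :=
  {A | (A - lam • (1 : Matrix (Fin N) (Fin N) ℝ)).PosSemidef ∧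
    (Lam • (1 : Matrix (Fin N) (Fin N) ℝ) - A).PosSemidef}

/-- The piecewise linear function with slope `s₁` on the negative and `s₂` on the positive reals. -/
noncomputable def biSlope (s₁ s₂ t : ℝ) : ℝ := s₂ * max t 0 - s₁ * max (-t) 0

/-- The orthogonal reflection along a unit vector `e`, as a matrix. -/
def reflMatrix {N : ℕ} (e : Fin N → ℝ) : Matrix (Fin N) (Fin N) ℝ :=
  1 - (2 : ℝ) • vecMulVec e e

/-- The properties of Pucci's operators used for the Lane-Emden system. -/
structure IsPucciType {N : ℕ} (lam Lam s₁ s₂ : ℝ) (F : Matrix (Fin N) (Fin N) ℝ → ℝ) : Prop where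
  lam_pos : 0 < lam
  lam_le : lam ≤ Lam
  lam_le₁ : lam ≤ s₁
  lam_le₂ : lam ≤ s₂
  le_of_trace : ∀ X Y c, (∀ A ∈ ellipticClass N lam Lam, (A * Y).trace + c ≤ (A * X).trace) →
    F Y + c ≤ F X
  conj_refl : ∀ e X, e ⬝ᵥ e = 1 → F (reflMatrix e * X * reflMatrix e) = F X
  radial : ∀ e a m, e ⬝ᵥ e = 1 → F (m • 1 + (a - m) • vecMulVec e e) =
    biSlope s₁ s₂ a + (N - 1) * biSlope s₁ s₂ m

/-! ### Elliptic matrices and Pucci's operators -/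

open scoped MatrixOrder Matrix.Norms.L2Operator in
theorem Matrix.PosSemidef.trace_mul_nonneg' {N : ℕ} {A B : Matrix (Fin N) (Fin N) ℝ}
    (hA : A.PosSemidef) (hB : B.PosSemidef) : 0 ≤ (A * B).trace := by
  obtain ⟨C, rfl⟩ := CStarAlgebra.nonneg_iff_eq_star_mul_self.mp hB.nonneg
  have := (hA.mul_mul_conjTranspose_same C).trace_nonneg
  rw [Matrix.star_eq_conjTranspose]
  rwa [Matrix.trace_mul_cycle, Matrix.trace_mul_comm] at this

section
variable {N : ℕ} {lam Lam : ℝ} {A : Matrix (Fin N) (Fin N) ℝ}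

theorem trace_mul_vecMulVec (A : Matrix (Fin N) (Fin N) ℝ) (x y : Fin N → ℝ) :
    (A * vecMulVec x y).trace = y ⬝ᵥ (A *ᵥ x) := by
  rw [Matrix.mul_vecMulVec, Matrix.trace_vecMulVec, dotProduct_comm]

theorem ellipticClass.le_dotProduct (hA : A ∈ ellipticClass N lam Lam) (x : Fin N → ℝ) :
    lam * (x ⬝ᵥ x) ≤ x ⬝ᵥ (A *ᵥ x) := by
  have := hA.1.dotProduct_mulVec_nonneg x
  simp [Matrix.sub_mulVec, Matrix.smul_mulVec, dotProduct_sub] at this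
  simpa using this

theorem ellipticClass.dotProduct_le (hA : A ∈ ellipticClass N lam Lam) (x : Fin N → ℝ) :
    x ⬝ᵥ (A *ᵥ x) ≤ Lam * (x ⬝ᵥ x) := by
  have := hA.2.dotProduct_mulVec_nonneg x
  simp [Matrix.sub_mulVec, Matrix.smul_mulVec, dotProduct_sub] at this
  simpa using this

theorem ellipticClass.posSemidef (hlam : 0 ≤ lam) (hA : A ∈ ellipticClass N lam Lam) :
    A.PosSemidef := by
  have := hA.1.add (Matrix.PosSemidef.one.smul hlam)
  simpa using this

theorem ellipticClass.trace_le (hA : A ∈ ellipticClass N lam Lam) : A.trace ≤ N * Lam := by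
  have := hA.2.trace_nonneg
  simp [Matrix.trace_sub, Matrix.trace_smul] at this
  linarith

theorem posSemidef_one_sub_vecMulVec {e : Fin N → ℝ} (he : e ⬝ᵥ e = 1) :
    (1 - vecMulVec e e : Matrix (Fin N) (Fin N) ℝ).PosSemidef := by
  have h1 : (1 - vecMulVec e e : Matrix (Fin N) (Fin N) ℝ)ᴴ = 1 - vecMulVec e e := by
    simp
  have h2 : (1 - vecMulVec e e : Matrix (Fin N) (Fin N) ℝ)ᴴ * (1 - vecMulVec e e)
      = 1 - vecMulVec e e := by
    rw [h1, sub_mul, mul_sub, mul_sub, Matrix.vecMulVec_mul_vecMulVec, he]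
    simp
  rw [← h2]
  exact Matrix.posSemidef_conjTranspose_mul_self _

theorem reflMatrix_mul_self {e : Fin N → ℝ} (he : e ⬝ᵥ e = 1) :
    reflMatrix e * reflMatrix e = 1 := by
  rw [reflMatrix, sub_mul, mul_sub, Matrix.smul_mul, Matrix.mul_smul, mul_sub, Matrix.mul_smul,
    Matrix.vecMulVec_mul_vecMulVec, he]
  simp
  module

theorem reflMatrix_conjTranspose (e : Fin N → ℝ) : (reflMatrix e)ᴴ = reflMatrix e := by
  simp [reflMatrix]

theorem ellipticClass.conj {e : Fin N → ℝ} (he : e ⬝ᵥ e = 1) (hA : A ∈ ellipticClass N lam Lam) :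
    reflMatrix e * A * reflMatrix e ∈ ellipticClass N lam Lam := by
  have h1 := hA.1.mul_mul_conjTranspose_same (reflMatrix e)
  have h2 := hA.2.mul_mul_conjTranspose_same (reflMatrix e)
  rw [reflMatrix_conjTranspose, mul_sub, sub_mul] at h1 h2
  simp only [Matrix.mul_smul, Matrix.smul_mul, mul_one, reflMatrix_mul_self he] at h1 h2
  exact ⟨h1, h2⟩

theorem ellipticClass.abs_apply_le (hlam : 0 ≤ lam) (hA : A ∈ ellipticClass N lam Lam)
    (i j : Fin N) : |A i j| ≤ Lam := by
  have hp := ellipticClass.posSemidef hlam hA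
  have hd : ∀ i, A i i ≤ Lam := fun i => by
    have := hA.2.diag_nonneg (i := i)
    simp at this
    linarith
  have hs : A j i = A i j := by
    have := hp.1.apply i j
    simpa using this
  -- The quadratic form of A at e_i + c e_j; c = 1 and c = -1 bound the off-diagonal entry by the
  -- mean of two diagonal ones.
  have key : ∀ c : ℝ, 0 ≤ A i i + c * A i j + c * (A i j + c * A j j) := fun c => by
    have := hp.dotProduct_mulVec_nonneg (Pi.single i 1 + c • Pi.single j 1)
    simp [Matrix.mulVec_add, Matrix.mulVec_smul, hs] at this
    linarith
  have h1 := key 1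
  have h2 := key (-1)
  have := hd i
  have := hd j
  rw [abs_le]
  constructor <;> linarith

theorem one_mem_ellipticClass (h : lam ≤ Lam) :
    lam • (1 : Matrix (Fin N) (Fin N) ℝ) ∈ ellipticClass N lam Lam := by
  refine ⟨by simpa using Matrix.PosSemidef.zero, ?_⟩
  rw [← sub_smul]
  exact Matrix.PosSemidef.one.smul (by linarith)

theorem smul_add_smul_mem_ellipticClass {e : Fin N → ℝ} (he : e ⬝ᵥ e = 1) {α β : ℝ}
    (hα : lam ≤ α ∧ α ≤ Lam) (hβ : lam ≤ β ∧ β ≤ Lam) :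
    β • (1 : Matrix (Fin N) (Fin N) ℝ) + (α - β) • vecMulVec e e ∈ ellipticClass N lam Lam := by
  have h1 := posSemidef_one_sub_vecMulVec he
  have h2 : (vecMulVec e e : Matrix (Fin N) (Fin N) ℝ).PosSemidef := by
    simpa using Matrix.posSemidef_vecMulVec_self_star e
  constructor
  · have := (h1.smul (sub_nonneg.mpr hβ.1)).add (h2.smul (sub_nonneg.mpr hα.1))
    convert this using 1
    module
  · have := (h1.smul (sub_nonneg.mpr hβ.2)).add (h2.smul (sub_nonneg.mpr hα.2))
    convert this using 1
    module

theorem bddAbove_trace_mul (hlam : 0 ≤ lam) (X : Matrix (Fin N) (Fin N) ℝ) :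
    BddAbove {t : ℝ | ∃ A : Matrix (Fin N) (Fin N) ℝ,
    (A - lam • (1 : Matrix (Fin N) (Fin N) ℝ)).PosSemidef ∧
    (Lam • (1 : Matrix (Fin N) (Fin N) ℝ) - A).PosSemidef ∧ t = (A * X).trace} := by
  refine ⟨∑ i, ∑ j, Lam * |X j i|, ?_⟩
  rintro t ⟨A, h1, h2, rfl⟩
  simp only [Matrix.trace, Matrix.diag_apply, Matrix.mul_apply]
  refine Finset.sum_le_sum fun i _ => Finset.sum_le_sum fun j _ => ?_
  refine (le_abs_self _).trans ?_
  rw [abs_mul]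
  exact mul_le_mul_of_nonneg_right (ellipticClass.abs_apply_le hlam ⟨h1, h2⟩ i j) (abs_nonneg _)

theorem le_pucciSup (hlam : 0 ≤ lam) (hA : A ∈ ellipticClass N lam Lam)
    (X : Matrix (Fin N) (Fin N) ℝ) : (A * X).trace ≤ pucciSup lam Lam X :=
  le_csSup (bddAbove_trace_mul hlam X) ⟨A, hA.1, hA.2, rfl⟩

theorem pucciSup_le (h : lam ≤ Lam) {X : Matrix (Fin N) (Fin N) ℝ} {t : ℝ}
    (ht : ∀ A ∈ ellipticClass N lam Lam, (A * X).trace ≤ t) : pucciSup lam Lam X ≤ t := by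
  refine csSup_le ⟨_, lam • 1, (one_mem_ellipticClass h).1, (one_mem_ellipticClass h).2, rfl⟩ ?_
  rintro s ⟨A, h1, h2, rfl⟩
  exact ht A ⟨h1, h2⟩

theorem pucciInf_eq_neg (X : Matrix (Fin N) (Fin N) ℝ) :
    pucciInf lam Lam X = - pucciSup lam Lam (-X) := by
  rw [pucciInf, pucciSup, Real.sInf_def]
  congr 2
  ext t
  simp only [Set.mem_neg, Set.mem_ofPred_eq, Matrix.mul_neg, Matrix.trace_neg, neg_eq_iff_eq_neg]

theorem mul_le_biSlope {α t : ℝ} (h : lam ≤ α ∧ α ≤ Lam) : α * t ≤ biSlope lam Lam t := by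
  rw [biSlope]
  rcases le_total t 0 with ht | ht
  · rw [max_eq_right ht, max_eq_left (by linarith)]
    nlinarith
  · rw [max_eq_left ht, max_eq_right (by linarith)]
    nlinarith

theorem exists_mul_eq_biSlope (h : lam ≤ Lam) (t : ℝ) :
    ∃ α, (lam ≤ α ∧ α ≤ Lam) ∧ α * t = biSlope lam Lam t := by
  rw [biSlope]
  rcases le_total t 0 with ht | ht
  · refine ⟨lam, ⟨le_rfl, h⟩, ?_⟩
    rw [max_eq_right ht, max_eq_left (by linarith)]
    ring
  · refine ⟨Lam, ⟨h, le_rfl⟩, ?_⟩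
    rw [max_eq_left ht, max_eq_right (by linarith)]
    ring

theorem trace_mul_radial (A : Matrix (Fin N) (Fin N) ℝ) (e : Fin N → ℝ) (a m : ℝ) :
    (A * (m • 1 + (a - m) • vecMulVec e e)).trace =
      (e ⬝ᵥ (A *ᵥ e)) * a + (A.trace - e ⬝ᵥ (A *ᵥ e)) * m := by
  rw [mul_add, Matrix.trace_add, Matrix.mul_smul, Matrix.mul_smul, Matrix.trace_smul,
    Matrix.trace_smul, trace_mul_vecMulVec, mul_one]
  simp only [smul_eq_mul]
  ring

/-- An elliptic A enters only through α = e · A e and the average (tr A - α) / (N - 1) of its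
remaining diagonal part. Both lie in [lam, Lam], as pairing A - lam and Lam - A with the projection
1 - e eᵀ shows, and any two such values are attained by a matrix of the form β 1 + (α - β) e eᵀ.
Hence the supremum splits into two scalar ones. -/
theorem pucciSup_radial (hlam : 0 ≤ lam) (h : lam ≤ Lam) (hN : 2 ≤ N) {e : Fin N → ℝ}
    (he : e ⬝ᵥ e = 1) (a m : ℝ) : pucciSup lam Lam (m • 1 + (a - m) • vecMulVec e e) =
    biSlope lam Lam a + (N - 1) * biSlope lam Lam m := by
  have hN' : (2 : ℝ) ≤ N := by exact_mod_cast hN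
  apply le_antisymm
  · refine pucciSup_le h fun A hA => ?_
    rw [trace_mul_radial]
    have h1 := ellipticClass.le_dotProduct hA e
    have h2 := ellipticClass.dotProduct_le hA e
    have h3 := hA.1.trace_mul_nonneg' (posSemidef_one_sub_vecMulVec he)
    have h4 := hA.2.trace_mul_nonneg' (posSemidef_one_sub_vecMulVec he)
    rw [mul_sub, Matrix.trace_sub, trace_mul_vecMulVec] at h3 h4
    simp [Matrix.sub_mulVec, Matrix.smul_mulVec, Matrix.trace_smul, he, dotProduct_sub] at h1 h2 h3 h4
    refine add_le_add (mul_le_biSlope ⟨h1, h2⟩) ?_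
    have h5 : (A.trace - e ⬝ᵥ (A *ᵥ e)) * m =
      (N - 1) * (((A.trace - e ⬝ᵥ (A *ᵥ e)) / (N - 1)) * m) := by
      have : (N : ℝ) - 1 ≠ 0 := by linarith
      field_simp
    rw [h5]
    refine mul_le_mul_of_nonneg_left (mul_le_biSlope ⟨?_, ?_⟩) (by linarith)
    · rw [le_div_iff₀ (by linarith)]
      linarith
    · rw [div_le_iff₀ (by linarith)]
      linarith
  · obtain ⟨α, hα, hαe⟩ := exists_mul_eq_biSlope h a
    obtain ⟨β, hβ, hβe⟩ := exists_mul_eq_biSlope h m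
    have hA := smul_add_smul_mem_ellipticClass he hα hβ
    have := le_pucciSup hlam hA (m • 1 + (a - m) • vecMulVec e e)
    rw [trace_mul_radial] at this
    refine le_trans (le_of_eq ?_) this
    rw [← hαe, ← hβe]
    simp [Matrix.add_mulVec, Matrix.smul_mulVec, Matrix.vecMulVec_mulVec, he, Matrix.trace_add,
      Matrix.trace_smul, Matrix.trace_vecMulVec]
    ring

theorem pucciSup_conj (hlam : 0 ≤ lam) (h : lam ≤ Lam) {e : Fin N → ℝ} (he : e ⬝ᵥ e = 1)
    (X : Matrix (Fin N) (Fin N) ℝ) :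
    pucciSup lam Lam (reflMatrix e * X * reflMatrix e) = pucciSup lam Lam X := by
  have key : ∀ X : Matrix (Fin N) (Fin N) ℝ,
      pucciSup lam Lam (reflMatrix e * X * reflMatrix e) ≤ pucciSup lam Lam X := fun X => by
    refine pucciSup_le h fun A hA => ?_
    have := le_pucciSup hlam (ellipticClass.conj he hA) X
    rw [← Matrix.mul_assoc, Matrix.trace_mul_comm]
    convert this using 2
    simp only [Matrix.mul_assoc]
  refine le_antisymm (key X) ?_
  have := key (reflMatrix e * X * reflMatrix e)
  have h2 : reflMatrix e * (reflMatrix e * X * reflMatrix e) * reflMatrix e = X := by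
    rw [← Matrix.mul_assoc, ← Matrix.mul_assoc, reflMatrix_mul_self he, one_mul, Matrix.mul_assoc,
      reflMatrix_mul_self he, mul_one]
  rwa [h2] at this

theorem pucciSup_add_le (hlam : 0 ≤ lam) (h : lam ≤ Lam) {X Y : Matrix (Fin N) (Fin N) ℝ} {c : ℝ}
    (hXY : ∀ A ∈ ellipticClass N lam Lam, (A * Y).trace + c ≤ (A * X).trace) :
    pucciSup lam Lam Y + c ≤ pucciSup lam Lam X := by
  rw [← le_sub_iff_add_le]
  refine pucciSup_le h fun A hA => ?_
  have := hXY A hA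
  have := le_pucciSup hlam hA X
  linarith

theorem isPucciType_pucciSup (hlam : 0 < lam) (h : lam ≤ Lam) (hN : 2 ≤ N) :
    IsPucciType lam Lam lam Lam (pucciSup (N := N) lam Lam) where
  lam_pos := hlam
  lam_le := h
  lam_le₁ := le_rfl
  lam_le₂ := h
  le_of_trace _ _ _ := pucciSup_add_le hlam.le h
  conj_refl _ X he := pucciSup_conj hlam.le h he X
  radial _ a m he := pucciSup_radial hlam.le h hN he a m

theorem isPucciType_pucciInf (hlam : 0 < lam) (h : lam ≤ Lam) (hN : 2 ≤ N) :
    IsPucciType lam Lam Lam lam (pucciInf (N := N) lam Lam) where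
  lam_pos := hlam
  lam_le := h
  lam_le₁ := h
  lam_le₂ := le_rfl
  le_of_trace X Y c hXY := by
    rw [pucciInf_eq_neg, pucciInf_eq_neg]
    have := pucciSup_add_le hlam.le h (X := -Y) (Y := -X) (c := c) fun A hA => by
      have := hXY A hA
      rw [Matrix.mul_neg, Matrix.mul_neg, Matrix.trace_neg, Matrix.trace_neg]
      linarith
    linarith
  conj_refl e X he := by
    rw [pucciInf_eq_neg, pucciInf_eq_neg, ← pucciSup_conj hlam.le h he (-X)]
    simp
  radial e a m he := by
    have := pucciSup_radial hlam.le h hN he (-a) (-m)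
    rw [pucciInf_eq_neg]
    have h2 : -(m • (1 : Matrix (Fin N) (Fin N) ℝ) + (a - m) • vecMulVec e e) =
        (-m) • 1 + (-a - -m) • vecMulVec e e := by module
    rw [h2, this]
    simp only [biSlope, neg_neg]
    ring

end

/-! ### Hessians: linearity, minima, functions of quadratics, reflections -/

section
variable {N : ℕ}

theorem ContDiffAt.differentiableAt_fderiv {f : EuclideanSpace ℝ (Fin N) → ℝ}
    {x : EuclideanSpace ℝ (Fin N)} (hf : ContDiffAt ℝ 2 f x) :
    DifferentiableAt ℝ (fderiv ℝ f) x :=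
  (hf.fderiv_right (m := 1) (by norm_num)).differentiableAt (by norm_num)

theorem ContDiffAt.eventually_differentiableAt {f : EuclideanSpace ℝ (Fin N) → ℝ}
    {x : EuclideanSpace ℝ (Fin N)} (hf : ContDiffAt ℝ 2 f x) :
    ∀ᶠ y in 𝓝 x, DifferentiableAt ℝ f y := by
  filter_upwards [hf.eventually (by simp)] with y hy
  exact hy.differentiableAt (by norm_num)

theorem hessianMatrix_add_mul {f g : EuclideanSpace ℝ (Fin N) → ℝ} {x : EuclideanSpace ℝ (Fin N)}
    (hf : ContDiffAt ℝ 2 f x) (hg : ContDiffAt ℝ 2 g x) (c : ℝ) :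
    hessianMatrix (fun y => f y + c * g y) x = hessianMatrix f x + c • hessianMatrix g x := by
  have h1 : fderiv ℝ (fun y => f y + c * g y) =ᶠ[𝓝 x] fun y => fderiv ℝ f y + c • fderiv ℝ g y := by
    filter_upwards [hf.eventually_differentiableAt, hg.eventually_differentiableAt] with y h1 h2
    exact (h1.hasFDerivAt.add (h2.hasFDerivAt.const_mul c)).fderiv
  have h2 : fderiv ℝ (fderiv ℝ (fun y => f y + c * g y)) x =
      fderiv ℝ (fderiv ℝ f) x + c • fderiv ℝ (fderiv ℝ g) x := by
    rw [h1.fderiv_eq]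
    exact (hf.differentiableAt_fderiv.hasFDerivAt.add
      (hg.differentiableAt_fderiv.hasFDerivAt.const_smul c)).fderiv
  ext i j
  simp [hessianMatrix, h2]

theorem hessianMatrix_zero (x : EuclideanSpace ℝ (Fin N)) :
    hessianMatrix (fun _ => (0 : ℝ)) x = 0 := by
  ext i j
  simp [hessianMatrix]

theorem hessianMatrix_isHermitian {f : EuclideanSpace ℝ (Fin N) → ℝ}
    {x : EuclideanSpace ℝ (Fin N)} (hf : ContDiffAt ℝ 2 f x) : (hessianMatrix f x).IsHermitian := by
  ext i j
  simpa [hessianMatrix] using (hf.isSymmSndFDerivAt (by simp)) _ _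

theorem EuclideanSpace.eq_sum_single (x : EuclideanSpace ℝ (Fin N)) :
    x = ∑ i, x i • EuclideanSpace.single i (1 : ℝ) := by
  ext j
  simp [Finset.sum_apply, Pi.single_apply]

theorem dotProduct_hessianMatrix_mulVec (f : EuclideanSpace ℝ (Fin N) → ℝ)
    (x ξ η : EuclideanSpace ℝ (Fin N)) :
    ξ ⬝ᵥ (hessianMatrix f x *ᵥ η) = fderiv ℝ (fderiv ℝ f) x ξ η := by
  conv_rhs => rw [ξ.eq_sum_single, η.eq_sum_single]
  simp [dotProduct, Matrix.mulVec, hessianMatrix, Finset.mul_sum, mul_left_comm, mul_comm]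
  exact Finset.sum_comm

/-- If d were negative, χ - (d / 4) t² would still have second derivative d / 2 < 0 at 0, hence a
local maximum there. Since χ has a local minimum and -(d / 4) t² is positive off 0, both can hold
only at t = 0, yet they hold on a neighbourhood. -/
theorem nonneg_of_isLocalMin_of_hasDerivAt {χ χ' : ℝ → ℝ} {d : ℝ} (hmin : IsLocalMin χ 0)
    (h1 : ∀ᶠ t in 𝓝 (0 : ℝ), HasDerivAt χ (χ' t) t) (h2 : HasDerivAt χ' d 0) : 0 ≤ d := by
  by_contra! hd
  have h0 : χ' 0 = 0 := hmin.hasDerivAt_eq_zero h1.self_of_nhds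
  have hev : deriv (fun t => χ t - d / 4 * t ^ 2) =ᶠ[𝓝 0] fun t => χ' t - d / 2 * t := by
    filter_upwards [h1] with t ht
    have := (ht.sub (((hasDerivAt_id t).pow 2).const_mul (d / 4))).deriv
    rw [show (fun t => χ t - d / 4 * t ^ 2) = χ - (fun y => d / 4 * (id ^ 2) y) from by
      ext; simp, this]
    simp
    ring
  have hmax : IsLocalMax (fun t => χ t - d / 4 * t ^ 2) 0 := by
    apply isLocalMax_of_deriv_deriv_neg
    · rw [hev.deriv_eq]
      have := (h2.sub ((hasDerivAt_id (0 : ℝ)).const_mul (d / 2))).deriv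
      rw [show (fun t => χ' t - d / 2 * t) = χ' - (fun y => d / 2 * id y) from by
        ext; simp, this]
      simp
      linarith
    · rw [hev.self_of_nhds]
      simp [h0]
    · have := h1.self_of_nhds.continuousAt
      fun_prop
  have h3 : ∀ᶠ t in 𝓝 (0 : ℝ), t = 0 := by
    filter_upwards [hmin, hmax] with t h4 h5
    by_contra ht
    have : 0 < t ^ 2 := by positivity
    simp at h5
    nlinarith
  have h4 : ({0} : Set ℝ) ∈ 𝓝 (0 : ℝ) := h3
  exact not_isOpen_singleton (0 : ℝ) (isOpen_singleton_iff_nhds_eq_pure _ |>.mpr (by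
    exact le_antisymm (le_pure_iff.mpr h4) (pure_le_nhds _)))

theorem IsLocalMin.hessianMatrix_posSemidef {f : EuclideanSpace ℝ (Fin N) → ℝ}
    {x : EuclideanSpace ℝ (Fin N)} (hmin : IsLocalMin f x) (hf : ContDiffAt ℝ 2 f x) :
    (hessianMatrix f x).PosSemidef := by
  refine Matrix.PosSemidef.of_dotProduct_mulVec_nonneg (hessianMatrix_isHermitian hf) fun ξ => ?_
  have h0 := dotProduct_hessianMatrix_mulVec f x (WithLp.toLp 2 ξ) (WithLp.toLp 2 ξ)
  simp only [star_trivial]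
  rw [show ξ ⬝ᵥ (hessianMatrix f x *ᵥ ξ) = _ from h0]
  set η : EuclideanSpace ℝ (Fin N) := WithLp.toLp 2 ξ
  have hl : ∀ t : ℝ, HasDerivAt (fun t : ℝ => x + t • η) η t := fun t => by
    simpa using ((hasDerivAt_id t).smul_const η).const_add x
  have hl0 : Tendsto (fun t : ℝ => x + t • η) (𝓝 0) (𝓝 x) := by
    have := (hl 0).continuousAt.tendsto
    simpa using this
  refine nonneg_of_isLocalMin_of_hasDerivAt (χ := fun t => f (x + t • η))
    (χ' := fun t => fderiv ℝ f (x + t • η) η) ?_ ?_ ?_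
  · have := hl0.eventually hmin
    simpa [IsLocalMin, IsMinFilter] using this
  · filter_upwards [hl0.eventually hf.eventually_differentiableAt] with t ht
    exact ht.hasFDerivAt.comp_hasDerivAt t (hl t)
  · have h1 : HasFDerivAt (fderiv ℝ f) (fderiv ℝ (fderiv ℝ f) x) (x + (0 : ℝ) • η) := by
      simpa using hf.differentiableAt_fderiv.hasFDerivAt
    have := h1.comp_hasDerivAt 0 (hl 0)
    exact this.clm_apply (hasDerivAt_const 0 η) |>.congr_deriv (by simp)

theorem hessianMatrix_of_gradient {u : EuclideanSpace ℝ (Fin N) → ℝ}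
    {G : EuclideanSpace ℝ (Fin N) → EuclideanSpace ℝ (Fin N)}
    {G' : EuclideanSpace ℝ (Fin N) →L[ℝ] EuclideanSpace ℝ (Fin N)} {x : EuclideanSpace ℝ (Fin N)}
    (h1 : ∀ᶠ y in 𝓝 x, HasFDerivAt u (innerSL ℝ (G y)) y) (h2 : HasFDerivAt G G' x) :
    hessianMatrix u x = Matrix.of fun i j => G' (EuclideanSpace.single i 1) j := by
  have h3 : fderiv ℝ u =ᶠ[𝓝 x] fun y => innerSL ℝ (G y) := by
    filter_upwards [h1] with y hy using hy.fderiv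
  have h4 : fderiv ℝ (fderiv ℝ u) x = (innerSL ℝ).comp G' := by
    rw [h3.fderiv_eq]
    exact ((innerSL ℝ (E := EuclideanSpace ℝ (Fin N))).hasFDerivAt.comp x h2).fderiv
  ext i j
  simp only [hessianMatrix, h4, of_apply]
  simp [EuclideanSpace.inner_single_right]

/-- A quadratic polynomial with Hessian `2 b I`. -/
noncomputable def quadFun (k : ℝ) (c : EuclideanSpace ℝ (Fin N)) (b : ℝ)
    (y : EuclideanSpace ℝ (Fin N)) : ℝ := k + inner ℝ c y + b * ‖y‖ ^ 2

theorem hasFDerivAt_quadFun (k : ℝ) (c : EuclideanSpace ℝ (Fin N)) (b : ℝ)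
    (y : EuclideanSpace ℝ (Fin N)) :
    HasFDerivAt (quadFun k c b) (innerSL ℝ (c + (2 * b) • y)) y := by
  have h1 := (innerSL ℝ c).hasFDerivAt (x := y)
  have h2 := ((hasStrictFDerivAt_norm_sq y).hasFDerivAt).const_mul b
  refine ((h1.const_add k).add h2).congr_fderiv ?_
  ext z
  simp
  ring

theorem contDiff_quadFun (k : ℝ) (c : EuclideanSpace ℝ (Fin N)) (b : ℝ) :
    ContDiff ℝ 2 (quadFun k c b) := by
  unfold quadFun
  have : ContDiff ℝ 2 (fun y => inner ℝ c y) := (innerSL ℝ c).contDiff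
  have h2 := contDiff_norm_sq ℝ (E := EuclideanSpace ℝ (Fin N)) (n := 2)
  fun_prop

/-- One formula serves all barriers used below: the Gaussian of |y - c|² and the square roots of R²
- |y|² and of ⟪y, e⟫ - μ. -/
theorem hessianMatrix_comp_quadFun {g g₁ : ℝ → ℝ} {g₂ : ℝ} {k : ℝ}
    {c : EuclideanSpace ℝ (Fin N)} {b : ℝ} {x : EuclideanSpace ℝ (Fin N)}
    (h1 : ∀ᶠ t in 𝓝 (quadFun k c b x), HasDerivAt g (g₁ t) t)
    (h2 : HasDerivAt g₁ g₂ (quadFun k c b x)) :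
    hessianMatrix (fun y => g (quadFun k c b y)) x =
      g₂ • vecMulVec (c + (2 * b) • x) (c + (2 * b) • x) +
        (2 * b * g₁ (quadFun k c b x)) • (1 : Matrix (Fin N) (Fin N) ℝ) := by
  have hs := hasFDerivAt_quadFun k c b x
  have hc : HasFDerivAt (fun y : EuclideanSpace ℝ (Fin N) => c + (2 * b) • y)
      ((2 * b) • ContinuousLinearMap.id ℝ _) x :=
    ((hasFDerivAt_id x).const_smul (2 * b)).const_add c
  have hG := (h2.comp_hasFDerivAt x hs).smul hc
  rw [hessianMatrix_of_gradient (u := fun y => g (quadFun k c b y)) ?_ hG]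
  · ext i j
    simp [vecMulVec, EuclideanSpace.inner_single_right,
      Matrix.one_apply, eq_comm (a := i)]
    split_ifs <;> ring
  · filter_upwards [(contDiff_quadFun k c b).continuous.continuousAt.eventually h1] with y hy
    refine (hy.comp_hasFDerivAt y (hasFDerivAt_quadFun k c b y)).congr_fderiv ?_
    ext z
    simp

theorem trace_mul_quad (A : Matrix (Fin N) (Fin N) ℝ) (ζ : Fin N → ℝ) (α β : ℝ) :
    (A * (α • vecMulVec ζ ζ + β • (1 : Matrix (Fin N) (Fin N) ℝ))).trace =
      α * (ζ ⬝ᵥ (A *ᵥ ζ)) + β * A.trace := by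
  rw [mul_add, Matrix.trace_add, Matrix.mul_smul, Matrix.mul_smul, Matrix.trace_smul,
    Matrix.trace_smul, trace_mul_vecMulVec, mul_one]
  simp only [smul_eq_mul]

theorem EuclideanSpace.dotProduct_self (x : EuclideanSpace ℝ (Fin N)) :
    (x : Fin N → ℝ) ⬝ᵥ x = ‖x‖ ^ 2 := by
  rw [EuclideanSpace.norm_sq_eq]
  simp [dotProduct, sq]

/-- The reflection in the hyperplane `⟪x, e⟫ = μ`. -/
noncomputable def planeRefl (e : EuclideanSpace ℝ (Fin N)) (μ : ℝ) (x : EuclideanSpace ℝ (Fin N)) :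
    EuclideanSpace ℝ (Fin N) := x - (2 * (inner ℝ x e - μ)) • e

theorem single_dotProduct_mulVec_single (M : Matrix (Fin N) (Fin N) ℝ) (i j : Fin N) :
    Pi.single i 1 ⬝ᵥ (M *ᵥ Pi.single j 1) = M i j := by
  simp

theorem hessianMatrix_comp_planeRefl {f : EuclideanSpace ℝ (Fin N) → ℝ}
    {e x : EuclideanSpace ℝ (Fin N)} {μ : ℝ} (hf : ContDiffAt ℝ 2 f (planeRefl e μ x)) :
    hessianMatrix (fun y => f (planeRefl e μ y)) x =
      reflMatrix e * hessianMatrix f (planeRefl e μ x) * reflMatrix e := by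
  set Q : EuclideanSpace ℝ (Fin N) →L[ℝ] EuclideanSpace ℝ (Fin N) :=
    ContinuousLinearMap.id ℝ _ - (2 : ℝ) • (innerSL ℝ e).smulRight e with hQ
  have hρ : ∀ y, HasFDerivAt (planeRefl e μ) Q y := fun y => by
    have h1 := (innerSL ℝ e).hasFDerivAt (x := y)
    have h2 := (((h1.sub_const μ).const_mul 2).smul_const e)
    have h3 := (hasFDerivAt_id y).sub h2
    have h4 : planeRefl e μ = (id - fun y => (2 * ((innerSL ℝ e) y - μ)) • e) := by
      ext1 z
      simp [planeRefl, real_inner_comm]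
    rw [h4]
    refine h3.congr_fderiv ?_
    ext1 z
    simp [hQ, smul_smul]
  have h1 : fderiv ℝ (fun y => f (planeRefl e μ y)) =ᶠ[𝓝 x]
      fun y => (fderiv ℝ f (planeRefl e μ y)).comp Q := by
    filter_upwards [(hρ x).continuousAt.eventually hf.eventually_differentiableAt] with y hy
    exact (hy.hasFDerivAt.comp y (hρ y)).fderiv
  have h2 : ∀ ξ η, fderiv ℝ (fderiv ℝ (fun y => f (planeRefl e μ y))) x ξ η =
      fderiv ℝ (fderiv ℝ f) (planeRefl e μ x) (Q ξ) (Q η) := fun ξ η => by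
    rw [h1.fderiv_eq]
    have h3 := hf.differentiableAt_fderiv.hasFDerivAt.comp x (hρ x)
    have := (h3.clm_comp (hasFDerivAt_const Q x)).fderiv
    rw [show (fun y => (fderiv ℝ f (planeRefl e μ y)).comp Q) =
      fun y => ((fderiv ℝ f ∘ planeRefl e μ) y).comp Q from rfl, this]
    simp
  have hQm : ∀ i, ((Q (EuclideanSpace.single i 1) : EuclideanSpace ℝ (Fin N)) : Fin N → ℝ) =
      reflMatrix (e : Fin N → ℝ) *ᵥ Pi.single i 1 := fun i => by
    ext j
    simp [hQ, reflMatrix, EuclideanSpace.inner_single_right, vecMulVec, Matrix.one_apply]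
    ring
  have hsymm : (reflMatrix (e : Fin N → ℝ))ᵀ = reflMatrix e := by
    simpa using reflMatrix_conjTranspose (e : Fin N → ℝ)
  ext i j
  have h3 : hessianMatrix (fun y => f (planeRefl e μ y)) x i j = _ := h2 _ _
  rw [h3, ← dotProduct_hessianMatrix_mulVec, hQm, hQm, ← Matrix.vecMul_transpose, hsymm,
    ← Matrix.dotProduct_mulVec, Matrix.mulVec_mulVec, Matrix.mulVec_mulVec]
  exact single_dotProduct_mulVec_single _ i j

end

/-! ### Comparison, strong maximum principle and a Hopf-type lower bound -/

section
variable {N : ℕ} {lam Lam s₁ s₂ : ℝ} {F : Matrix (Fin N) (Fin N) ℝ → ℝ}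

theorem IsPucciType.map_zero (hF : IsPucciType lam Lam s₁ s₂ F) (hN : 1 ≤ N) : F 0 = 0 := by
  have := hF.radial (Pi.single ⟨0, hN⟩ 1) 0 0 (by simp)
  simpa [biSlope] using this

/-- At the minimum D²f - D²g + D²h is positive semidefinite, so its trace against every elliptic A
is nonnegative. The term with h costs at least κ uniformly in A, which is what `le_of_trace` needs.
-/
theorem IsPucciType.add_le_of_isLocalMin (hF : IsPucciType lam Lam s₁ s₂ F)
    {f g h : EuclideanSpace ℝ (Fin N) → ℝ} {x : EuclideanSpace ℝ (Fin N)} {κ : ℝ}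
    (hf : ContDiffAt ℝ 2 f x) (hg : ContDiffAt ℝ 2 g x) (hh : ContDiffAt ℝ 2 h x)
    (hmin : IsLocalMin (fun y => f y - g y + h y) x)
    (hκ : ∀ A ∈ ellipticClass N lam Lam, (A * hessianMatrix h x).trace ≤ -κ) :
    F (hessianMatrix g x) + κ ≤ F (hessianMatrix f x) := by
  refine hF.le_of_trace _ _ _ fun A hA => ?_
  have h1 : (fun y => f y - g y + h y) = fun y => (f y + (-1) * g y) + 1 * h y := by
    ext y
    ring
  rw [h1] at hmin
  have hfg : ContDiffAt ℝ 2 (fun y => f y + (-1) * g y) x := hf.add (contDiffAt_const.mul hg)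
  have h2 := hmin.hessianMatrix_posSemidef (hfg.add (contDiffAt_const.mul hh))
  rw [hessianMatrix_add_mul hfg hh, hessianMatrix_add_mul hf hg] at h2
  have h3 := (ellipticClass.posSemidef hF.lam_pos.le hA).trace_mul_nonneg' h2
  rw [mul_add, mul_add, Matrix.trace_add, Matrix.trace_add, Matrix.mul_smul, Matrix.mul_smul,
    Matrix.trace_smul, Matrix.trace_smul] at h3
  have := hκ A hA
  simp only [smul_eq_mul] at h3
  linarith

theorem trace_mul_gaussian_le {α m : ℝ} (hα : 0 ≤ α) (hm : 0 ≤ m)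
    (c x : EuclideanSpace ℝ (Fin N)) {A : Matrix (Fin N) (Fin N) ℝ}
    (hA : A ∈ ellipticClass N lam Lam) :
    (A * hessianMatrix (fun y => -m * Real.exp (-α * ‖y - c‖ ^ 2)) x).trace ≤
      -(m * α * Real.exp (-α * ‖x - c‖ ^ 2) * (4 * α * lam * ‖x - c‖ ^ 2 - 2 * (N * Lam))) := by
  have hq : ∀ y, ‖y - c‖ ^ 2 = quadFun (‖c‖ ^ 2) ((-2 : ℝ) • c) 1 y := fun y => by
    rw [quadFun, norm_sub_sq_real, inner_smul_left, real_inner_comm]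
    simp
    ring
  have hd : ∀ t, HasDerivAt (fun t => Real.exp (-α * t)) (Real.exp (-α * t) * -α) t := fun t => by
    simpa using ((hasDerivAt_id t).const_mul (-α)).exp
  have h1 := hessianMatrix_comp_quadFun (k := ‖c‖ ^ 2) (c := (-2 : ℝ) • c) (b := 1) (x := x)
    (g := fun t => -m * Real.exp (-α * t)) (g₁ := fun t => m * α * Real.exp (-α * t))
    (g₂ := m * α * (Real.exp (-α * (quadFun (‖c‖ ^ 2) ((-2 : ℝ) • c) 1 x)) * -α))
    (Eventually.of_forall fun t => ((hd t).const_mul (-m)).congr_deriv (by ring))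
    ((hd _).const_mul (m * α))
  have h2 : (fun y => -m * Real.exp (-α * ‖y - c‖ ^ 2)) =
      fun y => -m * Real.exp (-α * quadFun (‖c‖ ^ 2) ((-2 : ℝ) • c) 1 y) := by
    ext y
    rw [hq]
  rw [h2, h1, trace_mul_quad, ← hq]
  set E := Real.exp (-α * ‖x - c‖ ^ 2)
  have hE : 0 < E := Real.exp_pos _
  have hz : (-2 : ℝ) • c + (2 * 1 : ℝ) • x = (2 : ℝ) • (x - c) := by module
  have h3 := ellipticClass.le_dotProduct hA ((2 : ℝ) • (x - c) : EuclideanSpace ℝ (Fin N))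
  have h4 := ellipticClass.trace_le hA
  rw [EuclideanSpace.dotProduct_self, norm_smul] at h3
  rw [hz]
  simp only [Real.norm_ofNat] at h3
  have h5 : 0 ≤ m * α * E := by positivity
  have h6 := mul_le_mul_of_nonneg_left h3 (mul_nonneg h5 hα)
  have h7 := mul_le_mul_of_nonneg_left h4 h5
  nlinarith

/-- Hopf's barrier. Add h = -m exp(-α |y - c|²) to f - g and minimise over the annulus. For α this
large h is a strict supersolution where |y - c| ≥ r₁, so the minimum is not interior. On the inner
sphere f - g ≥ m compensates h ≥ -m; on the outer one h is the constant -m exp(-α r₂²). -/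
theorem IsPucciType.annulus_lower_bound (hF : IsPucciType lam Lam s₁ s₂ F)
    {f g : EuclideanSpace ℝ (Fin N) → ℝ} {c : EuclideanSpace ℝ (Fin N)} {r₁ r₂ m α : ℝ}
    (hr₁ : 0 < r₁) (hm : 0 < m) (hα : N * Lam < 2 * α * lam * r₁ ^ 2)
    (hf : ∀ x ∈ Metric.ball c r₂, ContDiffAt ℝ 2 f x)
    (hg : ∀ x ∈ Metric.ball c r₂, ContDiffAt ℝ 2 g x)
    (hcf : ContinuousOn f (Metric.closedBall c r₂)) (hcg : ContinuousOn g (Metric.closedBall c r₂))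
    (hle : ∀ x ∈ Metric.ball c r₂, F (hessianMatrix f x) ≤ F (hessianMatrix g x))
    (hbd : ∀ x ∈ Metric.sphere c r₂, g x ≤ f x)
    (hin : ∀ x ∈ Metric.sphere c r₁, g x + m ≤ f x) (x : EuclideanSpace ℝ (Fin N))
    (hx₁ : r₁ ≤ ‖x - c‖) (hx₂ : ‖x - c‖ ≤ r₂) :
    g x + m * (Real.exp (-α * ‖x - c‖ ^ 2) - Real.exp (-α * r₂ ^ 2)) ≤ f x := by
  have hlam := hF.lam_pos
  have hLam : 0 < Lam := hlam.trans_le hF.lam_le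
  have hα0 : 0 < α := by
    by_contra! h
    have h1 : 0 ≤ (N : ℝ) * Lam := by positivity
    have : α * (lam * r₁ ^ 2) ≤ 0 := mul_nonpos_of_nonpos_of_nonneg h (by positivity)
    linarith
  set h : EuclideanSpace ℝ (Fin N) → ℝ := fun y => -m * Real.exp (-α * ‖y - c‖ ^ 2) with hh
  have hhc : ContDiff ℝ 2 h := by
    have h2 : ContDiff ℝ 2 (fun y : EuclideanSpace ℝ (Fin N) => ‖y - c‖ ^ 2) :=
      (contDiff_norm_sq ℝ).comp (contDiff_id.sub contDiff_const)
    exact contDiff_const.mul (contDiff_const.mul h2).exp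
  have hK : IsCompact {y : EuclideanSpace ℝ (Fin N) | r₁ ≤ ‖y - c‖ ∧ ‖y - c‖ ≤ r₂} := by
    have : {y : EuclideanSpace ℝ (Fin N) | r₁ ≤ ‖y - c‖ ∧ ‖y - c‖ ≤ r₂} =
        {y | r₁ ≤ ‖y - c‖} ∩ Metric.closedBall c r₂ := by
      ext y
      simp [dist_eq_norm]
    rw [this]
    exact (isCompact_closedBall c r₂).inter_left
      (isClosed_le continuous_const (by fun_prop))
  have hsub : {y : EuclideanSpace ℝ (Fin N) | r₁ ≤ ‖y - c‖ ∧ ‖y - c‖ ≤ r₂} ⊆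
      Metric.closedBall c r₂ := fun y hy => mem_closedBall_iff_norm.mpr hy.2
  obtain ⟨x₀, ⟨h01, h02⟩, hx₀⟩ := hK.exists_isMinOn ⟨x, hx₁, hx₂⟩
    (f := fun y => f y - g y + h y) (((hcf.mono hsub).sub (hcg.mono hsub)).add
      hhc.continuous.continuousOn)
  suffices 0 ≤ f x₀ - g x₀ + h x₀ + m * Real.exp (-α * r₂ ^ 2) by
    have h3 : f x₀ - g x₀ + h x₀ ≤ f x - g x + h x := hx₀ ⟨hx₁, hx₂⟩
    simp only [hh] at h3 this
    linarith
  rcases eq_or_lt_of_le h01 with h1 | h1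
  · have h3 := hin x₀ (by rw [mem_sphere_iff_norm, ← h1])
    have h4 : Real.exp (-α * ‖x₀ - c‖ ^ 2) ≤ 1 := by
      rw [Real.exp_le_one_iff]
      have : 0 ≤ α * ‖x₀ - c‖ ^ 2 := by positivity
      linarith
    have h5 : 0 ≤ m * Real.exp (-α * r₂ ^ 2) := by positivity
    simp only [hh]
    nlinarith
  rcases eq_or_lt_of_le h02 with h2 | h2
  · have h3 := hbd x₀ (by rw [mem_sphere_iff_norm, h2])
    simp only [hh, h2]
    linarith
  exfalso
  have hb : x₀ ∈ Metric.ball c r₂ := mem_ball_iff_norm.mpr h2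
  have hloc : IsLocalMin (fun y => f y - g y + h y) x₀ := by
    refine hx₀.isLocalMin ?_
    have hc : Continuous fun y : EuclideanSpace ℝ (Fin N) => ‖y - c‖ := by fun_prop
    filter_upwards [hc.continuousAt.eventually (lt_mem_nhds h1),
      hc.continuousAt.eventually (gt_mem_nhds h2)] with y hy1 hy2
    exact ⟨hy1.le, hy2.le⟩
  have h3 := hF.add_le_of_isLocalMin (hf x₀ hb) (hg x₀ hb) hhc.contDiffAt hloc
    (fun A hA => trace_mul_gaussian_le hα0.le hm.le c x₀ hA)
  have h4 := hle x₀ hb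
  have h5 : 0 < m * α * Real.exp (-α * ‖x₀ - c‖ ^ 2) *
      (4 * α * lam * ‖x₀ - c‖ ^ 2 - 2 * (N * Lam)) := by
    have h6 : r₁ ^ 2 ≤ ‖x₀ - c‖ ^ 2 := by gcongr
    have h7 : α * lam * r₁ ^ 2 ≤ α * lam * ‖x₀ - c‖ ^ 2 := by gcongr
    have : 0 < 4 * α * lam * ‖x₀ - c‖ ^ 2 - 2 * (N * Lam) := by linarith
    positivity
  linarith

theorem IsPucciType.exists_steep (hF : IsPucciType lam Lam s₁ s₂ F) {r : ℝ} (hr : 0 < r) :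
    ∃ α > 0, N * Lam < 2 * α * lam * r ^ 2 := by
  have hlam := hF.lam_pos
  have hLam : 0 < Lam := hlam.trans_le hF.lam_le
  refine ⟨(N * Lam + 1) / (2 * lam * r ^ 2), by positivity, ?_⟩
  have : 2 * ((N * Lam + 1) / (2 * lam * r ^ 2)) * lam * r ^ 2 = N * Lam + 1 := by
    field_simp
  linarith

theorem IsPucciType.strong_maximum_principle (hF : IsPucciType lam Lam s₁ s₂ F)
    {f g : EuclideanSpace ℝ (Fin N) → ℝ} {Ω : Set (EuclideanSpace ℝ (Fin N))} (hΩ : IsOpen Ω)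
    (hΩc : IsPreconnected Ω) (hf : ∀ x ∈ Ω, ContDiffAt ℝ 2 f x) (hg : ∀ x ∈ Ω, ContDiffAt ℝ 2 g x)
    (hle : ∀ x ∈ Ω, F (hessianMatrix f x) ≤ F (hessianMatrix g x)) (hfg : ∀ x ∈ Ω, g x ≤ f x)
    (hpos : ∃ x ∈ Ω, g x < f x) : ∀ x ∈ Ω, g x < f x := by
  have hfc : ContinuousOn f Ω := fun x hx => (hf x hx).continuousAt.continuousWithinAt
  have hgc : ContinuousOn g Ω := fun x hx => (hg x hx).continuousAt.continuousWithinAt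
  set U : Set (EuclideanSpace ℝ (Fin N)) := {x ∈ Ω | g x < f x} with hU
  have hUo : IsOpen U := by
    rw [isOpen_iff_mem_nhds]
    rintro x ⟨hx, hlt⟩
    filter_upwards [hΩ.mem_nhds hx, (hg x hx).continuousAt.eventually_lt
      (hf x hx).continuousAt hlt] with y h1 h2 using ⟨h1, h2⟩
  have hsub : Ω ⊆ U := by
    obtain ⟨x₁, h1, h2⟩ := hpos
    refine hΩc.subset_of_closure_inter_subset hUo ⟨x₁, h1, h1, h2⟩ ?_
    -- The contact set is excluded by an annulus around a point z of U close to x: strict inequality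
    -- holds on a small closed ball about z, and `annulus_lower_bound` carries it out to radius ε /
    -- 2, past x.
    rintro x ⟨hxc, hxΩ⟩
    obtain ⟨ε, hε, hball⟩ := Metric.isOpen_iff.mp hΩ x hxΩ
    obtain ⟨z, hzU, hz⟩ := Metric.mem_closure_iff.mp hxc (ε / 4) (by positivity)
    obtain ⟨r, hr, hrU⟩ := Metric.nhds_basis_closedBall.mem_iff.mp (hUo.mem_nhds hzU)
    rcases le_or_gt ‖x - z‖ r with hxr | hxr
    · exact hrU (mem_closedBall_iff_norm.mpr hxr)
    have hsub2 : Metric.closedBall z (ε / 2) ⊆ Ω := fun y hy => hball (by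
      rw [Metric.mem_ball]
      rw [Metric.mem_closedBall] at hy
      have := dist_triangle y z x
      rw [dist_comm z x] at this
      linarith)
    have hsub3 := (Metric.ball_subset_closedBall).trans hsub2
    have hKU : Metric.closedBall z r ⊆ Ω := hrU.trans fun y hy => hy.1
    obtain ⟨y₀, hy₀, hmin⟩ := (isCompact_closedBall z r).exists_isMinOn
      ⟨z, Metric.mem_closedBall_self hr.le⟩ ((hfc.mono hKU).sub (hgc.mono hKU))
    have hm : 0 < f y₀ - g y₀ := sub_pos.mpr (hrU hy₀).2
    obtain ⟨α, hα0, hα⟩ := hF.exists_steep hr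
    have hxz : ‖x - z‖ < ε / 4 := by rwa [← dist_eq_norm]
    have key := hF.annulus_lower_bound (c := z) (r₂ := ε / 2) hr hm hα (fun y hy => hf y (hsub3 hy))
      (fun y hy => hg y (hsub3 hy)) (hfc.mono hsub2) (hgc.mono hsub2)
      (fun y hy => hle y (hsub3 hy))
      (fun y hy => hfg y (hsub2 (Metric.sphere_subset_closedBall hy)))
      (fun y hy => by
        have h3 : f y₀ - g y₀ ≤ f y - g y := hmin (Metric.sphere_subset_closedBall hy)
        linarith) x hxr.le (by linarith)
    refine ⟨hxΩ, lt_of_lt_of_le ?_ key⟩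
    have : Real.exp (-α * (ε / 2) ^ 2) < Real.exp (-α * ‖x - z‖ ^ 2) := by
      rw [Real.exp_lt_exp]
      have : ‖x - z‖ ^ 2 < (ε / 2) ^ 2 := by
        gcongr
        linarith
      nlinarith
    have := mul_pos hm (sub_pos.mpr this)
    linarith
  exact fun x hx => (hsub hx).2

/-- Linear growth away from the sphere. It keeps the arguments of t ^ p quantitatively away from 0
in the moving plane argument, where p < 1 is allowed. -/
theorem IsPucciType.exists_mul_le (hF : IsPucciType lam Lam s₁ s₂ F) (hN : 1 ≤ N) {R : ℝ}
    (hR : 0 < R) {v : EuclideanSpace ℝ (Fin N) → ℝ}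
    (hv : ∀ x ∈ Metric.ball 0 R, ContDiffAt ℝ 2 v x) (hvc : ContinuousOn v (Metric.closedBall 0 R))
    (hpos : ∀ x ∈ Metric.ball 0 R, 0 < v x) (hle : ∀ x ∈ Metric.ball 0 R, F (hessianMatrix v x) ≤ 0)
    (hbd : ∀ x ∈ Metric.sphere 0 R, v x = 0) :
    ∃ κ > 0, ∀ x ∈ Metric.ball (0 : EuclideanSpace ℝ (Fin N)) R, κ * (R ^ 2 - ‖x‖ ^ 2) ≤ v x := by
  have hsub : Metric.closedBall (0 : EuclideanSpace ℝ (Fin N)) (R / 2) ⊆ Metric.ball 0 R :=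
    Metric.closedBall_subset_ball (by linarith)
  obtain ⟨y₀, hy₀, hmin⟩ := (isCompact_closedBall 0 (R / 2)).exists_isMinOn
      ⟨0, Metric.mem_closedBall_self (by positivity)⟩
      (hvc.mono (hsub.trans Metric.ball_subset_closedBall))
  have hm := hpos y₀ (hsub hy₀)
  obtain ⟨α, hα0, hα⟩ := hF.exists_steep (r := R / 2) (by positivity)
  -- The first constant serves ‖x‖ ≤ R / 2, where v ≥ v y₀. The second serves the annulus, where exp
  -- t ≥ 1 + t turns the difference of exponentials into a multiple of R² - ‖x‖².
  refine ⟨min (v y₀ / R ^ 2) (v y₀ * (α * Real.exp (-α * R ^ 2))), by positivity, fun x hx => ?_⟩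
  have hxR : ‖x‖ < R := by simpa using hx
  have hD : 0 ≤ R ^ 2 - ‖x‖ ^ 2 := by nlinarith [norm_nonneg x]
  rcases le_or_gt ‖x‖ (R / 2) with h | h
  · refine (mul_le_mul_of_nonneg_right (min_le_left _ _) hD).trans ?_
    have h1 : v y₀ ≤ v x := hmin (by simpa using h)
    refine le_trans ?_ h1
    rw [div_mul_eq_mul_div, div_le_iff₀ (by positivity)]
    nlinarith [sq_nonneg ‖x‖]
  · refine (mul_le_mul_of_nonneg_right (min_le_right _ _) hD).trans ?_
    have key := hF.annulus_lower_bound (c := 0) (f := v) (g := fun _ => 0) (r₂ := R)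
      (by positivity) hm hα hv (fun _ _ => contDiffAt_const) hvc continuousOn_const
      (fun y hy => by rw [hessianMatrix_zero, hF.map_zero hN]; exact hle y hy)
      (fun y hy => (hbd y hy).ge)
      (fun y hy => by
        have h3 : v y₀ ≤ v y := hmin (Metric.sphere_subset_closedBall hy)
        linarith) x (by simpa using h.le) (by simpa using hxR.le)
    refine le_trans ?_ key
    simp only [sub_zero, zero_add]
    rw [mul_assoc]
    refine mul_le_mul_of_nonneg_left ?_ hm.le
    have h1 := Real.add_one_le_exp (α * (R ^ 2 - ‖x‖ ^ 2))
    have h2 : Real.exp (-α * ‖x‖ ^ 2) =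
        Real.exp (-α * R ^ 2) * Real.exp (α * (R ^ 2 - ‖x‖ ^ 2)) := by
      rw [← Real.exp_add]
      ring_nf
    rw [h2]
    have := mul_le_mul_of_nonneg_left h1 (Real.exp_pos (-α * R ^ 2)).le
    linarith

end

/-! ### Reflections and the square root barrier -/

section
variable {N : ℕ} {lam Lam s₁ s₂ : ℝ} {F : Matrix (Fin N) (Fin N) ℝ → ℝ}

theorem IsBallDirichletSolution.swap {p q R : ℝ} {u v : EuclideanSpace ℝ (Fin N) → ℝ}
    (h : IsBallDirichletSolution F p q R u v) : IsBallDirichletSolution F q p R v u :=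
  ⟨h.contDiffOn_v, h.contDiffOn_u, h.continuousOn_v, h.continuousOn_u, h.pos_v, h.pos_u, h.eq_v,
    h.eq_u, h.boundary_v, h.boundary_u⟩

theorem IsBallDirichletSolution.contDiffAt {p q R : ℝ} {u v : EuclideanSpace ℝ (Fin N) → ℝ}
    (h : IsBallDirichletSolution F p q R u v) {x : EuclideanSpace ℝ (Fin N)}
    (hx : x ∈ Metric.ball 0 R) : ContDiffAt ℝ 2 u x :=
  h.contDiffOn_u.contDiffAt (Metric.isOpen_ball.mem_nhds hx)

theorem IsBallDirichletSolution.nonneg {p q R : ℝ} {u v : EuclideanSpace ℝ (Fin N) → ℝ}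
    (h : IsBallDirichletSolution F p q R u v) {x : EuclideanSpace ℝ (Fin N)}
    (hx : x ∈ Metric.closedBall 0 R) : 0 ≤ u x := by
  rw [← Metric.ball_union_sphere] at hx
  rcases hx with hx | hx
  · exact (h.pos_u x hx).le
  · exact (h.boundary_u x hx).ge

theorem norm_sq_planeRefl {e x : EuclideanSpace ℝ (Fin N)} (he : ‖e‖ = 1) (μ : ℝ) :
    ‖planeRefl e μ x‖ ^ 2 = ‖x‖ ^ 2 - 4 * μ * (inner ℝ x e - μ) := by
  rw [planeRefl, norm_sub_sq_real, inner_smul_right, norm_smul, he]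
  simp only [Real.norm_eq_abs, mul_one, sq_abs]
  ring

theorem continuous_planeRefl (e : EuclideanSpace ℝ (Fin N)) :
    Continuous fun z : ℝ × EuclideanSpace ℝ (Fin N) => planeRefl e z.1 z.2 := by
  unfold planeRefl
  fun_prop

theorem contDiff_planeRefl (e : EuclideanSpace ℝ (Fin N)) (μ : ℝ) :
    ContDiff ℝ 2 (planeRefl e μ) := by
  unfold planeRefl
  have : ContDiff ℝ 2 (fun x => inner ℝ x e) := contDiff_id.inner ℝ contDiff_const
  fun_prop

theorem norm_planeRefl_le {e x : EuclideanSpace ℝ (Fin N)} (he : ‖e‖ = 1) {μ : ℝ} (hμ : 0 ≤ μ)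
    (hx : μ ≤ inner ℝ x e) : ‖planeRefl e μ x‖ ≤ ‖x‖ := by
  rw [← sq_le_sq₀ (norm_nonneg _) (norm_nonneg _), norm_sq_planeRefl he]
  have := mul_nonneg hμ (sub_nonneg.mpr hx)
  linarith

theorem norm_planeRefl_lt {e x : EuclideanSpace ℝ (Fin N)} (he : ‖e‖ = 1) {μ : ℝ} (hμ : 0 < μ)
    (hx : μ < inner ℝ x e) : ‖planeRefl e μ x‖ < ‖x‖ := by
  rw [← sq_lt_sq₀ (norm_nonneg _) (norm_nonneg _), norm_sq_planeRefl he]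
  have := mul_pos hμ (sub_pos.mpr hx)
  linarith

theorem hasDerivAt_sqrt_deriv {t : ℝ} (ht : 0 < t) :
    HasDerivAt (fun t => 1 / (2 * √t)) (-(1 / (4 * (t * √t)))) t := by
  have h := (Real.hasDerivAt_sqrt ht.ne').const_mul 2
  have h2 := h.inv (by positivity)
  have h3 : (fun t => 1 / (2 * √t)) = fun t => (2 * √t)⁻¹ := by
    ext
    rw [one_div]
  rw [h3]
  refine h2.congr_deriv ?_
  have := Real.sqrt_pos.mpr ht
  have h4 := Real.sq_sqrt ht.le
  field_simp
  rw [h4]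
  ring

theorem contDiffAt_sqrt_quadFun {k : ℝ} {c x : EuclideanSpace ℝ (Fin N)} {b : ℝ}
    (hs : 0 < quadFun k c b x) : ContDiffAt ℝ 2 (fun y => √(quadFun k c b y)) x :=
  (contDiff_quadFun k c b).contDiffAt.sqrt hs.ne'

theorem trace_mul_hessianMatrix_sqrt_le {k : ℝ} {c x : EuclideanSpace ℝ (Fin N)} {b : ℝ}
    (hlam : 0 ≤ lam) (hb : b ≤ 0) (hs : 0 < quadFun k c b x) {A : Matrix (Fin N) (Fin N) ℝ}
    (hA : A ∈ ellipticClass N lam Lam) :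
    (A * hessianMatrix (fun y => √(quadFun k c b y)) x).trace ≤
      -(lam * ‖c + (2 * b) • x‖ ^ 2 / (4 * (quadFun k c b x * √(quadFun k c b x)))) := by
  rw [hessianMatrix_comp_quadFun (g := Real.sqrt) (g₁ := fun t => 1 / (2 * √t))
    ((lt_mem_nhds hs).mono fun t ht => Real.hasDerivAt_sqrt ht.ne') (hasDerivAt_sqrt_deriv hs),
    trace_mul_quad]
  have h1 := ellipticClass.le_dotProduct hA (c + (2 * b) • x : EuclideanSpace ℝ (Fin N))
  rw [EuclideanSpace.dotProduct_self] at h1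
  have h2 := (ellipticClass.posSemidef hlam hA).trace_nonneg
  set s := quadFun k c b x
  have h3 : 0 < √s := Real.sqrt_pos.mpr hs
  have h4 : 2 * b * (1 / (2 * √s)) * A.trace ≤ 0 :=
    mul_nonpos_of_nonpos_of_nonneg (mul_nonpos_of_nonpos_of_nonneg (by linarith) (by positivity)) h2
  have h5 : 0 ≤ 1 / (4 * (s * √s)) := by positivity
  have h6 := mul_le_mul_of_nonneg_left h1 h5
  have h7 : lam * ‖c + (2 * b) • x‖ ^ 2 / (4 * (s * √s)) =
    1 / (4 * (s * √s)) * (lam * ‖c + (2 * b) • x‖ ^ 2) := by ring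
  rw [h7]
  linarith

/-- The two square roots have very negative Hessians along their gradients: against any elliptic
matrix they contribute at most -lam |x|² D^(-3/2) and -(lam / 4) s^(-3/2), where D = R² - |x|² and s
= ⟪x, e⟫ - μ. The constant 1 contributes nothing. Reflection invariance of F then replaces the
Hessian of the composite by that of u at the reflected point. -/
theorem IsPucciType.reflected_contact (hF : IsPucciType lam Lam s₁ s₂ F)
    {u : EuclideanSpace ℝ (Fin N) → ℝ} {e x : EuclideanSpace ℝ (Fin N)} {R μ t : ℝ}
    (hu : ∀ y ∈ Metric.ball 0 R, ContDiffAt ℝ 2 u y) (he : ‖e‖ = 1) (hμ : 0 < μ) (ht : 0 ≤ t)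
    (hx : x ∈ Metric.ball 0 R) (hs : μ < inner ℝ x e)
    (hmin : IsLocalMin (fun y => u (planeRefl e μ y) - u y +
      t * (1 + √(R ^ 2 - ‖y‖ ^ 2) + √(inner ℝ y e - μ))) x) :
    F (hessianMatrix u x) + t * (lam * ‖x‖ ^ 2 / ((R ^ 2 - ‖x‖ ^ 2) * √(R ^ 2 - ‖x‖ ^ 2)) +
      lam / (4 * ((inner ℝ x e - μ) * √(inner ℝ x e - μ)))) ≤
      F (hessianMatrix u (planeRefl e μ x)) := by
  have hlam := hF.lam_pos
  have hxR : ‖x‖ < R := by simpa using hx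
  have hρx : planeRefl e μ x ∈ Metric.ball 0 R := by
    simpa using (norm_planeRefl_lt he hμ hs).trans hxR
  have hq₁ : ∀ y : EuclideanSpace ℝ (Fin N), R ^ 2 - ‖y‖ ^ 2 = quadFun (R ^ 2) 0 (-1) y :=
    fun y => by simp [quadFun]; ring
  have hq₂ : ∀ y : EuclideanSpace ℝ (Fin N), inner ℝ y e - μ = quadFun (-μ) e 0 y :=
    fun y => by simp [quadFun, real_inner_comm]; ring
  simp only [hq₁, hq₂] at hmin ⊢
  have h1 : 0 < quadFun (R ^ 2) 0 (-1) x := by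
    rw [← hq₁]
    nlinarith [norm_nonneg x]
  have h2 : 0 < quadFun (-μ) e 0 x := by
    rw [← hq₂]
    linarith
  have hc₁ := contDiffAt_sqrt_quadFun h1
  have hc₂ := contDiffAt_sqrt_quadFun h2
  have hc : ContDiffAt ℝ 2 (fun y => √(quadFun (R ^ 2) 0 (-1) y) + 1 * √(quadFun (-μ) e 0 y)) x :=
    hc₁.add (contDiffAt_const.mul hc₂)
  have hw : hessianMatrix (fun y => t * (1 + √(quadFun (R ^ 2) 0 (-1) y) +
      √(quadFun (-μ) e 0 y))) x = t • (hessianMatrix (fun y => √(quadFun (R ^ 2) 0 (-1) y)) x +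
      (1 : ℝ) • hessianMatrix (fun y => √(quadFun (-μ) e 0 y)) x) := by
    have h4 := hessianMatrix_add_mul (contDiffAt_const (c := t) (x := x)) hc t
    rw [hessianMatrix_add_mul hc₁ hc₂] at h4
    have h5 : (fun y => t * (1 + √(quadFun (R ^ 2) 0 (-1) y) + √(quadFun (-μ) e 0 y))) =
        fun y => t + t * (√(quadFun (R ^ 2) 0 (-1) y) + 1 * √(quadFun (-μ) e 0 y)) := by
      ext y
      ring
    rw [h5, h4]
    have h6 : hessianMatrix (fun _ : EuclideanSpace ℝ (Fin N) => t) x = 0 := by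
      ext i j
      simp [hessianMatrix]
    rw [h6, zero_add]
  have hd : ContDiffAt ℝ 2 (fun y => t * (1 + √(quadFun (R ^ 2) 0 (-1) y) +
      √(quadFun (-μ) e 0 y))) x :=
    contDiffAt_const.mul ((contDiffAt_const.add hc₁).add hc₂)
  have key := hF.add_le_of_isLocalMin
    ((hu _ hρx).comp x (contDiff_planeRefl e μ).contDiffAt) (hu x hx) hd hmin
    (κ := t * (lam * ‖x‖ ^ 2 / (quadFun (R ^ 2) 0 (-1) x * √(quadFun (R ^ 2) 0 (-1) x)) +
      lam / (4 * (quadFun (-μ) e 0 x * √(quadFun (-μ) e 0 x))))) fun A hA => by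
    rw [hw, Matrix.mul_smul, Matrix.trace_smul, mul_add, Matrix.trace_add, one_smul, smul_eq_mul,
      ← mul_neg]
    refine mul_le_mul_of_nonneg_left ?_ ht
    have h5 := trace_mul_hessianMatrix_sqrt_le hlam.le (by norm_num) h1 hA
    have h6 := trace_mul_hessianMatrix_sqrt_le hlam.le le_rfl h2 hA
    have h7 : ‖(0 : EuclideanSpace ℝ (Fin N)) + (2 * (-1) : ℝ) • x‖ ^ 2 = 4 * ‖x‖ ^ 2 := by
      rw [zero_add, norm_smul]
      norm_num
      ring
    have h8 : ‖e + (2 * 0 : ℝ) • x‖ ^ 2 = 1 := by simp [he]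
    rw [h7] at h5
    rw [h8, mul_one] at h6
    have h9 : lam * (4 * ‖x‖ ^ 2) / (4 * (quadFun (R ^ 2) 0 (-1) x * √(quadFun (R ^ 2) 0 (-1) x))) =
      lam * ‖x‖ ^ 2 / (quadFun (R ^ 2) 0 (-1) x * √(quadFun (R ^ 2) 0 (-1) x)) := by
      rw [show lam * (4 * ‖x‖ ^ 2) = 4 * (lam * ‖x‖ ^ 2) by ring, mul_div_mul_left _ _ (by norm_num)]
    rw [h9] at h5
    linarith
  have hee : (e : Fin N → ℝ) ⬝ᵥ e = 1 := by
    rw [EuclideanSpace.dotProduct_self, he, one_pow]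
  have h10 : hessianMatrix (u ∘ planeRefl e μ) x = _ :=
    hessianMatrix_comp_planeRefl (f := u) (hu _ hρx)
  rwa [h10, hF.conj_refl _ _ hee] at key

/-- Mean value theorem, writing ξ ^ (p - 1) as ξ ^ p / ξ ≤ M ^ p / d; this treats p < 1 and p ≥ 1
together. -/
theorem rpow_sub_rpow_le {a b d M p : ℝ} (hd : 0 < d) (ha : d ≤ a) (hb : d ≤ b) (hM : b ≤ M)
    (hp : 0 < p) : b ^ p - a ^ p ≤ p * M ^ p / d * max 0 (b - a) := by
  have hM0 : 0 < M := hd.trans_le (hb.trans hM)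
  rcases le_or_gt b a with h | h
  · have := Real.rpow_le_rpow (hd.trans_le hb).le h hp.le
    have : 0 ≤ p * M ^ p / d * max 0 (b - a) := by positivity
    linarith
  · obtain ⟨ξ, hξ, hξe⟩ := exists_hasDerivAt_eq_slope (fun t : ℝ => t ^ p)
      (fun t => p * t ^ (p - 1)) h
      (continuousOn_id.rpow_const fun x hx => Or.inl (hd.trans_le (ha.trans hx.1)).ne')
      (fun x hx => Real.hasDerivAt_rpow_const (Or.inl (hd.trans_le (ha.trans hx.1.le)).ne'))
    have hξ0 : 0 < ξ := hd.trans_le (ha.trans hξ.1.le)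
    rw [eq_div_iff (by linarith)] at hξe
    rw [max_eq_right (by linarith)]
    rw [← hξe]
    refine mul_le_mul_of_nonneg_right ?_ (by linarith)
    rw [mul_div_assoc]
    refine mul_le_mul_of_nonneg_left ?_ hp.le
    rw [Real.rpow_sub_one hξ0.ne']
    exact div_le_div₀ (by positivity) (Real.rpow_le_rpow hξ0.le (hξ.2.le.trans hM) hp.le) hd
      (ha.trans hξ.1.le)

/-- Near the sphere D^(-3/2) dominates C / D, since X is then at least R² / 2. Away from it C / D is
at most C / δ₁, and s^(-3/2) exceeds that near the plane. This is why a point is in the narrow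
region if either D or s is small. -/
theorem exists_barrier_width {C R : ℝ} (hlam : 0 < lam) (hC : 0 < C) (hR : 0 < R) :
    ∃ δ > 0, ∀ D s X : ℝ, 0 < D → 0 < s → 0 ≤ X → X = R ^ 2 - D → (D < δ ∨ s < δ) →
      C / D < lam * X / (D * √D) + lam / (4 * (s * √s)) := by
  obtain ⟨δ₁, hδ₁, h1⟩ : ∃ δ > 0, δ ≤ R ^ 2 / 2 ∧ √δ ≤ lam * R ^ 2 / (2 * C) := by
    refine ⟨min (R ^ 2 / 2) ((lam * R ^ 2 / (2 * C)) ^ 2), by positivity, min_le_left _ _, ?_⟩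
    rw [Real.sqrt_le_left (by positivity)]
    exact min_le_right _ _
  obtain ⟨δ₂, hδ₂, h2, h2'⟩ : ∃ δ > 0, δ ≤ 1 ∧ δ * (4 * C) ≤ lam * δ₁ := by
    refine ⟨min 1 (lam * δ₁ / (4 * C)), by positivity, min_le_left _ _, ?_⟩
    rw [← le_div_iff₀ (by positivity)]
    exact min_le_right _ _
  refine ⟨min δ₁ δ₂, by positivity, fun D s X hD hs hX hXD h => ?_⟩
  have hD' := Real.sqrt_pos.mpr hD
  have hs' := Real.sqrt_pos.mpr hs
  rcases lt_or_ge D δ₁ with hDδ | hDδ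
  · have h3 : 0 < lam / (4 * (s * √s)) := by positivity
    have h4 : C / D ≤ lam * X / (D * √D) := by
      rw [div_le_div_iff₀ hD (by positivity)]
      have h5 : √D ≤ lam * R ^ 2 / (2 * C) := (Real.sqrt_le_sqrt hDδ.le).trans h1.2
      rw [le_div_iff₀ (by positivity)] at h5
      have h6 : R ^ 2 / 2 ≤ X := by linarith [h1.1]
      have h7 : C * √D ≤ lam * X := by nlinarith
      nlinarith
    linarith
  · have hsδ : s < δ₂ := by
      rcases h with h | h
      · exact absurd (h.trans_le (min_le_left _ _)) (not_lt.mpr hDδ)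
      · exact h.trans_le (min_le_right _ _)
    have h3 : 0 ≤ lam * X / (D * √D) := by positivity
    have h4 : C / D < lam / (4 * (s * √s)) := by
      rw [div_lt_div_iff₀ hD (by positivity)]
      have h5 : √s ≤ 1 := Real.sqrt_le_one.mpr (by linarith)
      have h6 : s * √s ≤ s := by nlinarith
      have h7 : C * (4 * (s * √s)) ≤ s * (4 * C) := by nlinarith
      have h8 : s * (4 * C) < δ₂ * (4 * C) := by gcongr
      have h9 : lam * δ₁ ≤ lam * D := by gcongr
      linarith
    linarith

end

/-! ### Moving planes and radial symmetry -/

section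
variable {N : ℕ} {lam Lam s₁ s₂ : ℝ} {F : Matrix (Fin N) (Fin N) ℝ → ℝ}

theorem IsBallDirichletSolution.exists_mul_le {p q R : ℝ} {u v : EuclideanSpace ℝ (Fin N) → ℝ}
    (h : IsBallDirichletSolution F p q R u v) (hF : IsPucciType lam Lam s₁ s₂ F) (hN : 1 ≤ N)
    (hR : 0 < R) :
    ∃ κ > 0, ∀ x ∈ Metric.ball (0 : EuclideanSpace ℝ (Fin N)) R, κ * (R ^ 2 - ‖x‖ ^ 2) ≤ u x := by
  refine hF.exists_mul_le hN hR (fun x hx => h.contDiffAt hx) h.continuousOn_u h.pos_u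
    (fun x hx => ?_) h.boundary_u
  have h1 := h.eq_u x hx
  have h2 := Real.rpow_nonneg (h.pos_v x hx).le p
  linarith

/-- At a contact point for u the equations bound t times the barrier term by v(x) ^ p - v(ρx) ^ p, ρ
being the reflection. Reflection decreases the norm, so both values of v are at least κ (R² - |x|²),
and the difference of powers is at most a constant times t / (R² - |x|²). The parameter t cancels,
so the bound is independent of how badly the ordering fails. -/
theorem IsBallDirichletSolution.exists_contact_bound {p q R : ℝ}
    {u v : EuclideanSpace ℝ (Fin N) → ℝ}
    (h : IsBallDirichletSolution F p q R u v) (hF : IsPucciType lam Lam s₁ s₂ F) (hN : 1 ≤ N)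
    (hR : 0 < R) (hp : 0 < p) :
    ∃ C > 0, ∀ e x : EuclideanSpace ℝ (Fin N), ∀ μ t : ℝ, ‖e‖ = 1 → 0 < μ → 0 < t →
      x ∈ Metric.ball 0 R → μ < inner ℝ x e →
      IsLocalMin (fun y => u (planeRefl e μ y) - u y +
        t * (1 + √(R ^ 2 - ‖y‖ ^ 2) + √(inner ℝ y e - μ))) x →
      v x - v (planeRefl e μ x) ≤ t * (1 + √(R ^ 2 - ‖x‖ ^ 2) + √(inner ℝ x e - μ)) →
      lam * ‖x‖ ^ 2 / ((R ^ 2 - ‖x‖ ^ 2) * √(R ^ 2 - ‖x‖ ^ 2)) +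
        lam / (4 * ((inner ℝ x e - μ) * √(inner ℝ x e - μ))) ≤ C / (R ^ 2 - ‖x‖ ^ 2) := by
  obtain ⟨κ, hκ, hκv⟩ := h.swap.exists_mul_le hF hN hR
  obtain ⟨x₁, hx₁, hmax⟩ := (isCompact_closedBall (0 : EuclideanSpace ℝ (Fin N)) R).exists_isMaxOn
      ⟨0, Metric.mem_closedBall_self hR.le⟩ h.continuousOn_v
  set M := v x₁
  have hM : 0 < M := (h.pos_v 0 (Metric.mem_ball_self hR)).trans_le
    (hmax (Metric.mem_closedBall_self hR.le))
  -- Here 2 + 2 R bounds the barrier 1 + √(R² - |x|²) + √(⟪x, e⟫ - μ) on the cap.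
  refine ⟨p * M ^ p / κ * (2 + 2 * R), by positivity, fun e x μ t he hμ ht hx hs hmin hv => ?_⟩
  have key := hF.reflected_contact (fun y hy => h.contDiffAt hy) he hμ ht.le hx hs hmin
  have hxR : ‖x‖ < R := by simpa using hx
  have hlt := norm_planeRefl_lt he hμ hs
  have hρx : planeRefl e μ x ∈ Metric.ball 0 R := by
    simpa using hlt.trans hxR
  have hD : 0 < R ^ 2 - ‖x‖ ^ 2 := by nlinarith [norm_nonneg x]
  have h1 := h.eq_u x hx
  have h2 := h.eq_u _ hρx
  have h3 : κ * (R ^ 2 - ‖x‖ ^ 2) ≤ v (planeRefl e μ x) := by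
    refine le_trans ?_ (hκv _ hρx)
    gcongr
  have h4 := rpow_sub_rpow_le (mul_pos hκ hD) h3 (hκv x hx)
    (hmax (Metric.ball_subset_closedBall hx)) hp
  have h5 : 1 + √(R ^ 2 - ‖x‖ ^ 2) + √(inner ℝ x e - μ) ≤ 2 + 2 * R := by
    have h6 : √(R ^ 2 - ‖x‖ ^ 2) ≤ R := by
      rw [Real.sqrt_le_left hR.le]
      nlinarith [sq_nonneg ‖x‖]
    have h7 : √(inner ℝ x e - μ) ≤ 1 + R := by
      rw [Real.sqrt_le_left (by positivity)]
      have := real_inner_le_norm x e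
      rw [he, mul_one] at this
      nlinarith
    linarith
  set Φ := 1 + √(R ^ 2 - ‖x‖ ^ 2) + √(inner ℝ x e - μ)
  have hΦ : 0 ≤ Φ := by positivity
  have h6 : max 0 (v x - v (planeRefl e μ x)) ≤ t * (2 + 2 * R) :=
    max_le (by positivity) (hv.trans (by gcongr))
  have h7 := h4.trans (mul_le_mul_of_nonneg_left h6 (by positivity))
  have h8 : p * M ^ p / (κ * (R ^ 2 - ‖x‖ ^ 2)) * (t * (2 + 2 * R)) =
      t * (p * M ^ p / κ * (2 + 2 * R) / (R ^ 2 - ‖x‖ ^ 2)) := by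
    field_simp
  rw [h8] at h7
  refine le_of_mul_le_mul_left ?_ ht
  linarith

/-- A maximum principle for the thin part of a cap, with δ independent of direction and position of
the plane. If the ordering failed, the worst quotient of either reflected difference by the barrier
would be attained at a point off the plane, off the sphere and outside the core. There
`exists_contact_bound` contradicts `exists_barrier_width`. -/
theorem IsBallDirichletSolution.narrow {p q R : ℝ} {u v : EuclideanSpace ℝ (Fin N) → ℝ}
    (h : IsBallDirichletSolution F p q R u v) (hF : IsPucciType lam Lam s₁ s₂ F) (hN : 1 ≤ N)
    (hR : 0 < R) (hp : 0 < p) (hq : 0 < q) :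
    ∃ δ > 0, ∀ e : EuclideanSpace ℝ (Fin N), ‖e‖ = 1 → ∀ μ : ℝ, 0 < μ →
      (∀ x ∈ Metric.ball 0 R, μ + δ ≤ inner ℝ x e → δ ≤ R ^ 2 - ‖x‖ ^ 2 →
        u x ≤ u (planeRefl e μ x) ∧ v x ≤ v (planeRefl e μ x)) →
      ∀ x ∈ Metric.ball 0 R, μ < inner ℝ x e →
        u x ≤ u (planeRefl e μ x) ∧ v x ≤ v (planeRefl e μ x) := by
  obtain ⟨C₁, hC₁, hu⟩ := h.exists_contact_bound hF hN hR hp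
  obtain ⟨C₂, hC₂, hv⟩ := h.swap.exists_contact_bound hF hN hR hq
  obtain ⟨δ, hδ, hδb⟩ := exists_barrier_width hF.lam_pos (C := max C₁ C₂) (by positivity) hR
  refine ⟨δ, hδ, fun e he μ hμ hcore x hx hxs => ?_⟩
  set φ : EuclideanSpace ℝ (Fin N) → ℝ :=
    fun y => 1 + √(R ^ 2 - ‖y‖ ^ 2) + √(inner ℝ y e - μ) with hφ
  have hφ1 : ∀ y, 0 < φ y := fun y => by positivity
  have hφc : Continuous φ := by fun_prop
  set K : Set (EuclideanSpace ℝ (Fin N)) := {y ∈ Metric.closedBall 0 R | μ ≤ inner ℝ y e} with hKdef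
  have hcl : IsClosed {y : EuclideanSpace ℝ (Fin N) | μ ≤ inner ℝ y e} :=
    isClosed_le continuous_const (by fun_prop)
  have hK : IsCompact K := (isCompact_closedBall 0 R).inter_right hcl
  have hKb : K ⊆ Metric.closedBall 0 R := fun y hy => hy.1
  have hρc : Continuous (planeRefl e μ) := (contDiff_planeRefl e μ).continuous
  have hρK : Set.MapsTo (planeRefl e μ) K (Metric.closedBall 0 R) := fun y hy => by
    have h1 : ‖y‖ ≤ R := by simpa using hy.1
    simpa using (norm_planeRefl_le he hμ.le hy.2).trans h1
  -- The summand 1 in φ keeps the quotients continuous up to the boundary of the cap, including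
  -- where the plane meets the sphere. Taking the minimum over both components makes t control the
  -- other component at the contact point.
  set m : EuclideanSpace ℝ (Fin N) → ℝ := fun y =>
    min ((u (planeRefl e μ y) - u y) / φ y) ((v (planeRefl e μ y) - v y) / φ y) with hm
  have hmc : ContinuousOn m K := by
    refine ContinuousOn.inf ?_ ?_
    · exact ((h.continuousOn_u.comp hρc.continuousOn hρK).sub (h.continuousOn_u.mono hKb)).div
        hφc.continuousOn fun y _ => (hφ1 y).ne'
    · exact ((h.continuousOn_v.comp hρc.continuousOn hρK).sub (h.continuousOn_v.mono hKb)).div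
        hφc.continuousOn fun y _ => (hφ1 y).ne'
  have hxK : x ∈ K := ⟨Metric.ball_subset_closedBall hx, hxs.le⟩
  obtain ⟨x₀, hx₀, hmin⟩ := hK.exists_isMinOn ⟨x, hxK⟩ hmc
  have hnonneg : ∀ y, 0 ≤ m y ↔ u y ≤ u (planeRefl e μ y) ∧ v y ≤ v (planeRefl e μ y) := fun y => by
    simp only [hm, le_min_iff, le_div_iff₀ (hφ1 y), zero_mul, sub_nonneg]
  rw [← hnonneg]
  refine le_trans ?_ (hmin hxK)
  by_contra! hneg
  have hx₀s : μ < inner ℝ x₀ e := by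
    refine lt_of_le_of_ne hx₀.2 fun heq => ?_
    have : planeRefl e μ x₀ = x₀ := by simp [planeRefl, heq]
    exact absurd ((hnonneg x₀).mpr (by simp [this])) (not_le.mpr hneg)
  have hx₀b : x₀ ∈ Metric.ball 0 R := by
    have h1 := hx₀.1
    rw [← Metric.ball_union_sphere] at h1
    rcases h1 with h1 | h1
    · exact h1
    · exfalso
      refine absurd ((hnonneg x₀).mpr ?_) (not_le.mpr hneg)
      rw [h.boundary_u x₀ h1, h.boundary_v x₀ h1]
      exact ⟨h.nonneg (hρK hx₀), h.swap.nonneg (hρK hx₀)⟩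
  have hx₀R : ‖x₀‖ < R := by simpa using hx₀b
  have hD : 0 < R ^ 2 - ‖x₀‖ ^ 2 := by nlinarith [norm_nonneg x₀]
  have hnarrow : R ^ 2 - ‖x₀‖ ^ 2 < δ ∨ inner ℝ x₀ e - μ < δ := by
    by_contra! hcon
    exact absurd ((hnonneg x₀).mpr (hcore x₀ hx₀b (by linarith [hcon.2]) hcon.1))
      (not_le.mpr hneg)
  have hbar := hδb _ _ (‖x₀‖ ^ 2) hD (sub_pos.mpr hx₀s) (by positivity) (by ring) hnarrow
  set t := - m x₀ with ht
  have ht0 : 0 < t := by linarith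
  have hKn : K ∈ 𝓝 x₀ := by
    filter_upwards [Metric.isOpen_ball.mem_nhds hx₀b,
      (isOpen_lt (continuous_const (y := μ))
        (by fun_prop : Continuous fun y : EuclideanSpace ℝ (Fin N) => inner ℝ y e)).mem_nhds hx₀s]
      with y h1 h2 using ⟨Metric.ball_subset_closedBall h1, le_of_lt h2⟩
  have hlow : ∀ y ∈ K, 0 ≤ u (planeRefl e μ y) - u y + t * φ y ∧
      0 ≤ v (planeRefl e μ y) - v y + t * φ y := fun y hy => by
    have h1 : m x₀ ≤ m y := hmin hy
    have h2 := h1.trans (min_le_left _ _)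
    have h3 := h1.trans (min_le_right _ _)
    rw [le_div_iff₀ (hφ1 y)] at h2 h3
    constructor <;> nlinarith
  have hCle : ∀ C, C ≤ max C₁ C₂ → C / (R ^ 2 - ‖x₀‖ ^ 2) ≤ max C₁ C₂ / (R ^ 2 - ‖x₀‖ ^ 2) :=
    fun C hC => div_le_div_of_nonneg_right hC hD.le
  rcases min_choice ((u (planeRefl e μ x₀) - u x₀) / φ x₀)
    ((v (planeRefl e μ x₀) - v x₀) / φ x₀) with hc | hc
  · have h1 : m x₀ = (u (planeRefl e μ x₀) - u x₀) / φ x₀ := hc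
    rw [eq_div_iff (hφ1 x₀).ne'] at h1
    have h2 := hu e x₀ μ t he hμ ht0 hx₀b hx₀s
      (by
        filter_upwards [hKn] with y hy
        have := (hlow y hy).1
        simp only [hφ] at this h1
        linarith)
      (by
        have := (hlow x₀ hx₀).2
        simp only [hφ] at this
        linarith)
    linarith [hCle C₁ (le_max_left _ _)]
  · have h1 : m x₀ = (v (planeRefl e μ x₀) - v x₀) / φ x₀ := hc
    rw [eq_div_iff (hφ1 x₀).ne'] at h1
    have h2 := hv e x₀ μ t he hμ ht0 hx₀b hx₀s
      (by
        filter_upwards [hKn] with y hy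
        have := (hlow y hy).2
        simp only [hφ] at this h1
        linarith)
      (by
        have := (hlow x₀ hx₀).1
        simp only [hφ] at this
        linarith)
    linarith [hCle C₂ (le_max_right _ _)]

/-- The solution does not decrease under reflection of the cap `⟪x, e⟫ > μ`. -/
def ReflectedLE (R : ℝ) (u : EuclideanSpace ℝ (Fin N) → ℝ) (e : EuclideanSpace ℝ (Fin N))
    (μ : ℝ) : Prop :=
  ∀ x ∈ Metric.ball 0 R, μ < inner ℝ x e → u x ≤ u (planeRefl e μ x)

theorem ContinuousOn.comp_planeRefl_continuousAt {R : ℝ} {u : EuclideanSpace ℝ (Fin N) → ℝ}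
    (hu : ContinuousOn u (Metric.ball 0 R)) {e x : EuclideanSpace ℝ (Fin N)} {μ : ℝ}
    (hx : planeRefl e μ x ∈ Metric.ball 0 R) :
    ContinuousAt (fun z : ℝ × EuclideanSpace ℝ (Fin N) => u (planeRefl e z.1 z.2)) (μ, x) :=
  ContinuousAt.comp (g := u) (f := fun z : ℝ × EuclideanSpace ℝ (Fin N) => planeRefl e z.1 z.2)
    (hu.continuousAt (Metric.isOpen_ball.mem_nhds hx)) (continuous_planeRefl e).continuousAt

theorem ReflectedLE.of_forall_gt {R : ℝ} {u : EuclideanSpace ℝ (Fin N) → ℝ}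
    (hu : ContinuousOn u (Metric.ball 0 R)) {e : EuclideanSpace ℝ (Fin N)} (he : ‖e‖ = 1) {μ : ℝ}
    (hμ : 0 ≤ μ) (h : ∀ ν, μ < ν → ν < R → ReflectedLE R u e ν) : ReflectedLE R u e μ := by
  intro x hx hxs
  have hxR : ‖x‖ < R := by simpa using hx
  have hρ : planeRefl e μ x ∈ Metric.ball 0 R := by
    simpa using (norm_planeRefl_le he hμ hxs.le).trans_lt hxR
  have h1 : Tendsto (fun ν => u (planeRefl e ν x)) (𝓝[>] μ) (𝓝 (u (planeRefl e μ x))) :=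
    (ContinuousAt.comp (f := fun ν : ℝ => (ν, x)) (hu.comp_planeRefl_continuousAt hρ)
      (by fun_prop)).tendsto.mono_left nhdsWithin_le_nhds
  refine ge_of_tendsto h1 ?_
  have hin : inner ℝ x e < R := by
    have := real_inner_le_norm x e
    rw [he, mul_one] at this
    linarith
  filter_upwards [Ioo_mem_nhdsGT hxs] with ν hν
  exact h ν hν.1 (hν.2.trans hin) x hx hν.2

theorem IsBallDirichletSolution.lt_planeRefl {p q R : ℝ} {u v : EuclideanSpace ℝ (Fin N) → ℝ}
    (h : IsBallDirichletSolution F p q R u v) (hF : IsPucciType lam Lam s₁ s₂ F)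
    (hp : 0 < p) {e : EuclideanSpace ℝ (Fin N)} (he : ‖e‖ = 1)
    {μ : ℝ} (hμ : 0 < μ) (hμR : μ < R) (hru : ReflectedLE R u e μ) (hrv : ReflectedLE R v e μ)
    {x : EuclideanSpace ℝ (Fin N)} (hx : x ∈ Metric.ball 0 R) (hxs : μ < inner ℝ x e) :
    u x < u (planeRefl e μ x) := by
  set Ω : Set (EuclideanSpace ℝ (Fin N)) := {y ∈ Metric.ball 0 R | μ < inner ℝ y e} with hΩ
  have hop : IsOpen {y : EuclideanSpace ℝ (Fin N) | μ < inner ℝ y e} :=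
    isOpen_lt continuous_const (by fun_prop)
  have hΩo : IsOpen Ω := Metric.isOpen_ball.inter hop
  have hΩc : Convex ℝ Ω := by
    refine (convex_ball _ _).inter ?_
    have := convex_halfSpace_gt (𝕜 := ℝ) (f := fun y : EuclideanSpace ℝ (Fin N) => inner ℝ y e)
      ⟨fun a b => inner_add_left a b e, fun c a => real_inner_smul_left a e c⟩ μ
    exact this
  have hρ : ∀ y ∈ Ω, planeRefl e μ y ∈ Metric.ball 0 R := fun y hy => by
    have h1 : ‖y‖ < R := by simpa using hy.1
    simpa using (norm_planeRefl_lt he hμ hy.2).trans h1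
  have hee : (e : Fin N → ℝ) ⬝ᵥ e = 1 := by
    rw [EuclideanSpace.dotProduct_self, he, one_pow]
  refine hF.strong_maximum_principle (f := fun y => u (planeRefl e μ y)) (g := u) hΩo
    hΩc.isPreconnected
    (fun y hy => (h.contDiffAt (hρ y hy)).comp y (contDiff_planeRefl e μ).contDiffAt)
    (fun y hy => h.contDiffAt hy.1) (fun y hy => ?_) (fun y hy => hru y hy.1 hy.2) ?_ x ⟨hx, hxs⟩
  · rw [hessianMatrix_comp_planeRefl (h.contDiffAt (hρ y hy)), hF.conj_refl _ _ hee]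
    have h1 := h.eq_u y hy.1
    have h2 := h.eq_u _ (hρ y hy)
    have h3 := Real.rpow_le_rpow (h.pos_v y hy.1).le (hrv y hy.1 hy.2) hp.le
    linarith
  -- The two functions differ somewhere: at R e the solution is zero while its reflected value is
  -- positive, and continuity moves this to an interior point τ e of the cap.
  · have hR : 0 < R := hμ.trans hμR
    have hline : ∀ τ : ℝ, inner ℝ (τ • e) e = τ := fun τ => by
      rw [real_inner_smul_left, real_inner_self_eq_norm_sq, he]
      ring
    have hnorm : ∀ τ : ℝ, ‖τ • e‖ = |τ| := fun τ => by
      rw [norm_smul, he, mul_one, Real.norm_eq_abs]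
    have hRe : R • e ∈ Metric.sphere (0 : EuclideanSpace ℝ (Fin N)) R := by
      simp [hnorm, abs_of_pos hR]
    have hρe : planeRefl e μ (R • e) ∈ Metric.ball 0 R := by
      have := norm_planeRefl_lt he hμ (x := R • e) (by rw [hline]; exact hμR)
      rw [hnorm, abs_of_pos hR] at this
      simpa using this
    have hc1 : ContinuousAt (fun τ : ℝ => u (planeRefl e μ (τ • e))) R :=
      ContinuousAt.comp (f := fun τ : ℝ => (μ, τ • e))
        (h.contDiffOn_u.continuousOn.comp_planeRefl_continuousAt hρe)
        (by fun_prop)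
    have hc2 : ContinuousWithinAt (fun τ : ℝ => u (τ • e)) (Set.Ioo μ R) R := by
      refine (h.continuousOn_u _ (Metric.sphere_subset_closedBall hRe)).comp
        (f := fun τ : ℝ => τ • e) (by fun_prop) fun τ hτ => ?_
      simp only [mem_closedBall_zero_iff, hnorm]
      rw [abs_of_pos (hμ.trans hτ.1)]
      exact hτ.2.le
    have hlt : u (R • e) < u (planeRefl e μ (R • e)) := by
      rw [h.boundary_u _ hRe]
      exact h.pos_u _ hρe
    have hne : (𝓝[Set.Ioo μ R] R).NeBot := by
      rw [nhdsWithin_Ioo_eq_nhdsLT hμR]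
      infer_instance
    obtain ⟨τ, hτ, hτ2⟩ := ((hc2.eventually_lt hc1.continuousWithinAt hlt).and
      self_mem_nhdsWithin).exists
    refine ⟨τ • e, ⟨?_, ?_⟩, hτ⟩
    · simp only [mem_ball_zero_iff, hnorm]
      rw [abs_of_pos (hμ.trans hτ2.1)]
      exact hτ2.2
    · rw [hline]
      exact hτ2.1

/-- Let m be the lowest position down to which the ordering holds. If m > 0, the ordering at m is
strict in the cap, hence stable under small motions of the plane on a compact core, while `narrow`
supplies the rest of the cap. So the plane can move below m. -/
theorem IsBallDirichletSolution.reflectedLE {p q R : ℝ} {u v : EuclideanSpace ℝ (Fin N) → ℝ}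
    (h : IsBallDirichletSolution F p q R u v) (hF : IsPucciType lam Lam s₁ s₂ F) (hN : 1 ≤ N)
    (hR : 0 < R) (hp : 0 < p) (hq : 0 < q) {e : EuclideanSpace ℝ (Fin N)} (he : ‖e‖ = 1) :
    ∀ μ, 0 < μ → μ < R → ReflectedLE R u e μ ∧ ReflectedLE R v e μ := by
  obtain ⟨δ, hδ, hnar⟩ := h.narrow hF hN hR hp hq
  have hin : ∀ x ∈ Metric.ball (0 : EuclideanSpace ℝ (Fin N)) R, inner ℝ x e < R := fun x hx => by
    have h1 := real_inner_le_norm x e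
    have h2 : ‖x‖ < R := by simpa using hx
    rw [he, mul_one] at h1
    linarith
  set P : ℝ → Prop := fun μ => ReflectedLE R u e μ ∧ ReflectedLE R v e μ with hP
  have hstart : ∀ μ, 0 < μ → R - δ < μ → P μ := fun μ hμ hμδ => by
    have := hnar e he μ hμ fun x hx hxs => absurd (hin x hx) (by linarith)
    exact ⟨fun x hx hxs => (this x hx hxs).1, fun x hx hxs => (this x hx hxs).2⟩
  set S : Set ℝ := {μ | 0 < μ ∧ μ ≤ R ∧ ∀ ν, μ ≤ ν → ν < R → P ν} with hS
  have hRS : R ∈ S := ⟨hR, le_rfl, fun ν h1 h2 => absurd h2 (not_lt.mpr h1)⟩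
  have hbdd : BddBelow S := ⟨0, fun μ hμ => hμ.1.le⟩
  set m := sInf S with hm
  have habove : ∀ ν, m < ν → ν < R → P ν := fun ν h1 h2 => by
    obtain ⟨μ, hμ, hμν⟩ := exists_lt_of_csInf_lt ⟨R, hRS⟩ h1
    exact hμ.2.2 ν hμν.le h2
  have hm0 : 0 ≤ m := le_csInf ⟨R, hRS⟩ fun μ hμ => hμ.1.le
  rcases eq_or_lt_of_le hm0 with h0 | h0
  · intro μ hμ hμR
    exact habove μ (by linarith) hμR
  exfalso
  have hmR : m < R := by
    have h1 : max (R - δ / 2) (R / 2) ∈ S := by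
      refine ⟨lt_max_of_lt_right (by linarith), max_le (by linarith) (by linarith), fun ν h1 h2 => ?_⟩
      have h3 := (le_max_left _ _).trans h1
      have h4 := (le_max_right _ _).trans h1
      exact hstart ν (by linarith) (by linarith)
    exact (csInf_le hbdd h1).trans_lt (max_lt (by linarith) (by linarith))
  have hmu : ReflectedLE R u e m := ReflectedLE.of_forall_gt h.contDiffOn_u.continuousOn he hm0
    fun ν h1 h2 => (habove ν h1 h2).1
  have hmv : ReflectedLE R v e m := ReflectedLE.of_forall_gt h.contDiffOn_v.continuousOn he hm0
    fun ν h1 h2 => (habove ν h1 h2).2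
  set K : Set (EuclideanSpace ℝ (Fin N)) :=
    {x ∈ Metric.closedBall 0 R | m + δ / 2 ≤ inner ℝ x e ∧ δ ≤ R ^ 2 - ‖x‖ ^ 2} with hKd
  have hcl₁ : IsClosed {y : EuclideanSpace ℝ (Fin N) | m + δ / 2 ≤ inner ℝ y e} :=
    isClosed_le continuous_const (by fun_prop)
  have hcl₂ : IsClosed {y : EuclideanSpace ℝ (Fin N) | δ ≤ R ^ 2 - ‖y‖ ^ 2} :=
    isClosed_le continuous_const (by fun_prop)
  have hK : IsCompact K := (isCompact_closedBall 0 R).inter_right (hcl₁.inter hcl₂)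
  have hKb : ∀ x ∈ K, x ∈ Metric.ball 0 R := fun x hx => by
    have h1 := hx.2.2
    have : ‖x‖ < R := by
      rw [← sq_lt_sq₀ (norm_nonneg _) hR.le]
      linarith
    simpa using this
  have hev : ∀ᶠ ν in 𝓝 m, ∀ x ∈ K, u x < u (planeRefl e ν x) ∧ v x < v (planeRefl e ν x) := by
    refine hK.eventually_forall_of_forall_eventually fun x hx => ?_
    have hxb := hKb x hx
    have hxs : m < inner ℝ x e := by linarith [hx.2.1]
    have hρ : planeRefl e m x ∈ Metric.ball 0 R := by
      have h1 : ‖x‖ < R := by simpa using hxb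
      simpa using (norm_planeRefl_lt he h0 hxs).trans h1
    have hc : ∀ w : EuclideanSpace ℝ (Fin N) → ℝ, ContinuousOn w (Metric.ball 0 R) →
        ContinuousAt (fun z : ℝ × EuclideanSpace ℝ (Fin N) => w z.2) (m, x) := fun w hw =>
      ContinuousAt.comp (g := w) (f := Prod.snd)
        (hw.continuousAt (Metric.isOpen_ball.mem_nhds hxb)) continuousAt_snd
    exact ((hc u h.contDiffOn_u.continuousOn).eventually_lt
      (h.contDiffOn_u.continuousOn.comp_planeRefl_continuousAt hρ)
      (h.lt_planeRefl hF hp he h0 hmR hmu hmv hxb hxs)).and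
      ((hc v h.contDiffOn_v.continuousOn).eventually_lt
      (h.contDiffOn_v.continuousOn.comp_planeRefl_continuousAt hρ)
      (h.swap.lt_planeRefl hF hq he h0 hmR hmv hmu hxb hxs))
  obtain ⟨ε, hε, hball⟩ := Metric.eventually_nhds_iff.mp hev
  -- The bounds on η keep ν within ε of m, place the core required at ν inside K (ν + δ ≥ m + δ /
  -- 2), and keep ν positive.
  set η := min (ε / 2) (min (δ / 2) (m / 2)) with hη
  have hη0 : 0 < η := by positivity
  have hη1 : η ≤ ε / 2 := min_le_left _ _
  have hη2 : η ≤ δ / 2 := (min_le_right _ _).trans (min_le_left _ _)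
  have hη3 : η ≤ m / 2 := (min_le_right _ _).trans (min_le_right _ _)
  have hmem : m - η ∈ S := by
    refine ⟨by linarith, by linarith, fun ν h1 h2 => ?_⟩
    rcases lt_or_ge m ν with h3 | h3
    · exact habove ν h3 h2
    · have h4 : dist ν m < ε := by
        rw [Real.dist_eq, abs_lt]
        constructor <;> linarith
      have := hnar e he ν (by linarith) fun x hx hxs hxD => by
        have := hball h4 x ⟨Metric.ball_subset_closedBall hx, by linarith, hxD⟩
        exact ⟨this.1.le, this.2.le⟩
      exact ⟨fun x hx hxs => (this x hx hxs).1, fun x hx hxs => (this x hx hxs).2⟩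
  have := csInf_le hbdd hmem
  linarith

/-- Classical solutions in a ball are radial. -/
theorem IsBallDirichletSolution.radial {p q R : ℝ} {u v : EuclideanSpace ℝ (Fin N) → ℝ}
    (h : IsBallDirichletSolution F p q R u v) (hF : IsPucciType lam Lam s₁ s₂ F) (hN : 1 ≤ N)
    (hR : 0 < R) (hp : 0 < p) (hq : 0 < q) {x y : EuclideanSpace ℝ (Fin N)}
    (hx : x ∈ Metric.ball 0 R) (hxy : ‖x‖ = ‖y‖) : u x = u y := by
  have key : ∀ x y : EuclideanSpace ℝ (Fin N), x ∈ Metric.ball 0 R → ‖x‖ = ‖y‖ → x ≠ y →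
      u x ≤ u y := fun x y hx hxy hne => by
    have hn : 0 < ‖x - y‖ := norm_pos_iff.mpr (sub_ne_zero.mpr hne)
    -- As ‖x‖ = ‖y‖, the hyperplane through the origin orthogonal to x - y exchanges x and y. The
    -- ordering there is the limit of the orderings for positive μ.
    set e := ‖x - y‖⁻¹ • (x - y) with hedef
    have he : ‖e‖ = 1 := by
      rw [hedef, norm_smul, norm_inv, norm_norm, inv_mul_cancel₀ hn.ne']
    have h1 : ‖x - y‖ ^ 2 = 2 * inner ℝ x (x - y) := by
      rw [norm_sub_sq_real, inner_sub_right, real_inner_self_eq_norm_sq, hxy]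
      ring
    have h2 : inner ℝ x e = ‖x - y‖ / 2 := by
      rw [hedef, real_inner_smul_right]
      field_simp
      linarith
    have h3 : planeRefl e 0 x = y := by
      rw [planeRefl, h2, hedef, smul_smul, sub_zero, mul_div_cancel₀ _ (by norm_num),
        mul_inv_cancel₀ hn.ne', one_smul, sub_sub_cancel]
    have h4 := ReflectedLE.of_forall_gt h.contDiffOn_u.continuousOn he le_rfl
      fun ν hν hνR => (h.reflectedLE hF hN hR hp hq he ν hν hνR).1
    have h5 := h4 x hx (by rw [h2]; positivity)
    rwa [h3] at h5
  rcases eq_or_ne x y with rfl | hne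
  · rfl
  · refine le_antisymm (key x y hx hxy hne) (key y x ?_ hxy.symm hne.symm)
    simpa [← hxy] using hx

end

/-! ### The radial equation in integral form: comparison and existence -/

theorem biSlope_mono {a b : ℝ} (ha : 0 ≤ a) (hb : 0 ≤ b) : Monotone (biSlope a b) := by
  intro s t h
  have h1 : max s 0 ≤ max t 0 := max_le_max_right _ h
  have h2 : max (-t) 0 ≤ max (-s) 0 := max_le_max_right _ (neg_le_neg h)
  unfold biSlope
  nlinarith

theorem biSlope_add_le {a b t ε : ℝ} (ha : 0 ≤ a) (hb : 0 ≤ b) (hε : 0 ≤ ε) :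
    biSlope a b (t + ε) ≤ biSlope a b t + (a + b) * ε := by
  have h1 : max (t + ε) 0 ≤ max t 0 + ε :=
    max_le (by linarith [le_max_left t 0]) (by linarith [le_max_right t 0])
  have h2 : max (-t) 0 ≤ max (-(t + ε)) 0 + ε :=
    max_le (by linarith [le_max_left (-(t + ε)) 0]) (by linarith [le_max_right (-(t + ε)) 0])
  have h3 := mul_le_mul_of_nonneg_left h1 hb
  have h4 := mul_le_mul_of_nonneg_left h2 ha
  unfold biSlope
  linarith

theorem continuous_biSlope (a b : ℝ) : Continuous (biSlope a b) := by
  unfold biSlope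
  fun_prop

theorem biSlope_smul (a b : ℝ) {c : ℝ} (hc : 0 ≤ c) (t : ℝ) :
    biSlope a b (c * t) = c * biSlope a b t := by
  unfold biSlope
  rw [← mul_neg, show max (c * t) 0 = c * max t 0 by rw [mul_max_of_nonneg _ _ hc, mul_zero],
    show max (c * -t) 0 = c * max (-t) 0 by rw [mul_max_of_nonneg _ _ hc, mul_zero]]
  ring

/-- The inverse of the slope function; it lets the radial equation be solved for the second
derivative. -/
theorem biSlope_neg_inv {a b : ℝ} (ha : 0 < a) (hb : 0 < b) (t : ℝ) :
    biSlope a b (-biSlope b⁻¹ a⁻¹ t) = -t := by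
  unfold biSlope
  rcases le_total t 0 with h | h
  · rw [max_eq_right h, max_eq_left (by linarith : (0 : ℝ) ≤ -t)]
    have : -(a⁻¹ * 0 - b⁻¹ * -t) = b⁻¹ * -t := by ring
    rw [this, max_eq_left (by have := inv_pos.mpr hb; nlinarith),
      max_eq_right (by have := inv_pos.mpr hb; nlinarith)]
    field_simp
    ring
  · rw [max_eq_left h, max_eq_right (by linarith : -t ≤ 0)]
    have : -(a⁻¹ * t - b⁻¹ * 0) = -(a⁻¹ * t) := by ring
    rw [this, max_eq_right (by have := inv_pos.mpr ha; nlinarith),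
      max_eq_left (by have := inv_pos.mpr ha; nlinarith)]
    field_simp
    ring

/-- The data of the radial equation `r y' + y = τ (f - k y)`, where `τ` has slope `1 / s₂` on the
negative and `1 / s₁` on the positive reals. The exponent `n` enters the equivalent integral
equation `y r = ∫₀¹ σⁿ (τ (f (r σ) - k y (r σ)) + n y (r σ)) dσ`. -/
structure RadialParams where
  /-- slope of the operator on the negative reals -/
  s₁ : ℝ
  /-- slope of the operator on the positive reals -/
  s₂ : ℝ
  /-- coefficient of the first order term -/
  k : ℝ
  /-- exponent of the weight -/
  n : ℕ
  s₁_pos : 0 < s₁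
  s₂_pos : 0 < s₂
  k_nonneg : 0 ≤ k
  le_n : k * (s₂⁻¹ + s₁⁻¹) + 1 ≤ n

namespace RadialParams
variable (P : RadialParams)

/-- A Lipschitz constant of the inverse slope function. -/
noncomputable def lip : ℝ := P.s₂⁻¹ + P.s₁⁻¹

/-- The inverse slope function. -/
noncomputable def τ (t : ℝ) : ℝ := biSlope P.s₂⁻¹ P.s₁⁻¹ t

/-- The source term of the integral equation. -/
noncomputable def source (f y : ℝ) : ℝ := P.τ (f - P.k * y) + P.n * y

theorem lip_nonneg : 0 ≤ P.lip :=
  add_nonneg (inv_nonneg.mpr P.s₂_pos.le) (inv_nonneg.mpr P.s₁_pos.le)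

theorem τ_mono : Monotone P.τ :=
  biSlope_mono (inv_nonneg.mpr P.s₂_pos.le) (inv_nonneg.mpr P.s₁_pos.le)

theorem τ_add_le {t ε : ℝ} (hε : 0 ≤ ε) : P.τ (t + ε) ≤ P.τ t + P.lip * ε :=
  biSlope_add_le (inv_nonneg.mpr P.s₂_pos.le) (inv_nonneg.mpr P.s₁_pos.le) hε

theorem τ_zero : P.τ 0 = 0 := by simp [τ, biSlope]

theorem continuous_τ : Continuous P.τ := continuous_biSlope _ _

theorem continuous_source : Continuous fun z : ℝ × ℝ => P.source z.1 z.2 := by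
  have := P.continuous_τ
  unfold source
  fun_prop

theorem source_zero : P.source 0 0 = 0 := by simp [source, τ_zero]

/-- The term -k y inside τ can decrease the source by at most k · lip per unit of y. Since n ≥ k ·
lip + 1, the added n y more than compensates, so the source is increasing in y. -/
theorem source_mono_add {f f' y y' : ℝ} (hf : f ≤ f') (hy : y ≤ y') :
    P.source f y + (y' - y) ≤ P.source f' y' := by
  have h1 : P.τ (f - P.k * y) ≤ P.τ (f' - P.k * y' + P.k * (y' - y)) :=
    P.τ_mono (by linarith)
  have h2 := P.τ_add_le (t := f' - P.k * y') (ε := P.k * (y' - y))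
    (mul_nonneg P.k_nonneg (by linarith))
  have h3 := P.le_n
  unfold source
  unfold lip at h2
  nlinarith

theorem source_mono {f f' y y' : ℝ} (hf : f ≤ f') (hy : y ≤ y') :
    P.source f y ≤ P.source f' y' := by
  have := P.source_mono_add hf hy
  linarith

theorem source_add_le {f y ε M : ℝ} (hε : 0 ≤ ε) (hM : 0 ≤ M) :
    P.source (f + ε) (y + M) ≤ P.source f y + P.lip * ε + P.n * M := by
  have h1 : P.τ (f + ε - P.k * (y + M)) ≤ P.τ (f - P.k * y + ε) := by
    refine P.τ_mono ?_
    have := mul_nonneg P.k_nonneg hM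
    linarith
  have h2 := P.τ_add_le (t := f - P.k * y) hε
  unfold source
  linarith

theorem source_smul {c : ℝ} (hc : 0 ≤ c) (f y : ℝ) :
    P.source (c * f) (c * y) = c * P.source f y := by
  unfold source τ
  rw [show c * f - P.k * (c * y) = c * (f - P.k * y) by ring, biSlope_smul _ _ hc]
  ring

/-- The right hand side of the integral equation. -/
noncomputable def mean (f y : ℝ → ℝ) (r : ℝ) : ℝ :=
  ∫ σ in (0 : ℝ)..1, σ ^ P.n * P.source (f (r * σ)) (y (r * σ))

theorem integral_weight (c : ℝ) : ∫ σ in (0 : ℝ)..1, σ ^ P.n * c = c / (P.n + 1) := by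
  rw [intervalIntegral.integral_mul_const, integral_pow]
  simp
  ring

theorem intervalIntegrable_mean {f y : ℝ → ℝ} {r : ℝ} (hr : 0 ≤ r)
    (hf : ContinuousOn f (Set.Icc 0 r)) (hy : ContinuousOn y (Set.Icc 0 r)) :
    IntervalIntegrable (fun σ => σ ^ P.n * P.source (f (r * σ)) (y (r * σ)))
      MeasureTheory.volume 0 1 := by
  refine ContinuousOn.intervalIntegrable ?_
  rw [Set.uIcc_of_le zero_le_one]
  have hmaps : Set.MapsTo (fun σ : ℝ => r * σ) (Set.Icc 0 1) (Set.Icc 0 r) := fun σ hσ =>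
    ⟨mul_nonneg hr hσ.1, mul_le_of_le_one_right hr hσ.2⟩
  have h1 : ContinuousOn (fun σ : ℝ => (f (r * σ), y (r * σ))) (Set.Icc 0 1) :=
    (hf.comp (by fun_prop) hmaps).prodMk (hy.comp (by fun_prop) hmaps)
  exact (continuousOn_pow _).mul (P.continuous_source.comp_continuousOn h1)

/-- `y` solves the integral equation with source `f` on `[0, T]`. -/
structure IsSol (T : ℝ) (f y : ℝ → ℝ) : Prop where
  cont : ContinuousOn y (Set.Icc 0 T)
  eq : ∀ r ∈ Set.Icc 0 T, y r = P.mean f y r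

variable {P}

theorem IsSol.mono {T T' : ℝ} {f y : ℝ → ℝ} (h : P.IsSol T f y) (hT : T' ≤ T) : P.IsSol T' f y :=
  ⟨h.cont.mono (Set.Icc_subset_Icc_right hT), fun r hr => h.eq r ⟨hr.1, hr.2.trans hT⟩⟩

theorem isSol_zero (T : ℝ) : P.IsSol T (fun _ => 0) (fun _ => 0) :=
  ⟨continuousOn_const, fun r _ => by simp [mean, source_zero]⟩

/-- At a maximum point of y₁ - y₂ with positive value M, averaging against σⁿ gives M ≤ (lip ε + n
M) / (n + 1), that is M ≤ lip ε. No smallness of T is needed. -/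
theorem IsSol.le_add {T ε : ℝ} {f₁ f₂ y₁ y₂ : ℝ → ℝ} (h₁ : P.IsSol T f₁ y₁) (h₂ : P.IsSol T f₂ y₂)
    (hf₁ : ContinuousOn f₁ (Set.Icc 0 T)) (hf₂ : ContinuousOn f₂ (Set.Icc 0 T)) (hε : 0 ≤ ε)
    (h : ∀ r ∈ Set.Icc 0 T, f₁ r ≤ f₂ r + ε) :
    ∀ r ∈ Set.Icc 0 T, y₁ r ≤ y₂ r + P.lip * ε := by
  intro r hr
  obtain ⟨r₀, hr₀, hmax⟩ := isCompact_Icc.exists_isMaxOn ⟨r, hr⟩ (h₁.cont.sub h₂.cont)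
  have hle : y₁ r - y₂ r ≤ y₁ r₀ - y₂ r₀ := hmax hr
  rcases le_or_gt (y₁ r₀ - y₂ r₀) 0 with h0 | h0
  · have := mul_nonneg P.lip_nonneg hε
    linarith
  set M := y₁ r₀ - y₂ r₀ with hM
  have hsub : Set.Icc 0 r₀ ⊆ Set.Icc 0 T := Set.Icc_subset_Icc_right hr₀.2
  have hi₁ := P.intervalIntegrable_mean hr₀.1 (hf₁.mono hsub) (h₁.cont.mono hsub)
  have hi₂ := P.intervalIntegrable_mean hr₀.1 (hf₂.mono hsub) (h₂.cont.mono hsub)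
  have hi₃ : IntervalIntegrable (fun σ : ℝ => σ ^ P.n * (P.lip * ε + P.n * M))
      MeasureTheory.volume 0 1 := by
    apply Continuous.intervalIntegrable
    fun_prop
  have key : P.mean f₁ y₁ r₀ ≤ P.mean f₂ y₂ r₀ + (P.lip * ε + P.n * M) / (P.n + 1) := by
    rw [← P.integral_weight, mean, mean, ← intervalIntegral.integral_add hi₂ hi₃]
    refine intervalIntegral.integral_mono_on zero_le_one hi₁ (hi₂.add hi₃) fun σ hσ => ?_
    have hrσ : r₀ * σ ∈ Set.Icc 0 T :=
      hsub ⟨mul_nonneg hr₀.1 hσ.1, mul_le_of_le_one_right hr₀.1 hσ.2⟩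
    have h4 : y₁ (r₀ * σ) - y₂ (r₀ * σ) ≤ M := hmax hrσ
    have h5 := P.source_mono (h _ hrσ) (show y₁ (r₀ * σ) ≤ y₂ (r₀ * σ) + M by linarith)
    have h6 := h5.trans (P.source_add_le hε h0.le)
    have h7 := mul_le_mul_of_nonneg_left h6 (pow_nonneg hσ.1 P.n)
    linarith
  rw [← h₁.eq r₀ hr₀, ← h₂.eq r₀ hr₀] at key
  have hn : (0 : ℝ) < P.n + 1 := by positivity
  have h6 : M ≤ (P.lip * ε + P.n * M) / (P.n + 1) := by linarith
  rw [le_div_iff₀ hn] at h6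
  linarith

theorem IsSol.nonneg {T : ℝ} {f y : ℝ → ℝ} (h : P.IsSol T f y) (hf : ContinuousOn f (Set.Icc 0 T))
    (hf0 : ∀ r ∈ Set.Icc 0 T, 0 ≤ f r) : ∀ r ∈ Set.Icc 0 T, 0 ≤ y r := fun r hr => by
  simpa using (isSol_zero T).le_add h continuousOn_const hf le_rfl (by simpa using hf0) r hr

theorem IsSol.le_of_le {T B : ℝ} {f y : ℝ → ℝ} (h : P.IsSol T f y)
    (hf : ContinuousOn f (Set.Icc 0 T)) (hB : 0 ≤ B)
    (hfB : ∀ r ∈ Set.Icc 0 T, f r ≤ B) : ∀ r ∈ Set.Icc 0 T, y r ≤ P.lip * B := fun r hr => by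
  simpa using h.le_add (isSol_zero T) hf continuousOn_const hB (by simpa using hfB) r hr

theorem continuous_mean {f y : ℝ → ℝ} (hf : Continuous f) (hy : Continuous y) :
    Continuous (P.mean f y) := by
  have := P.continuous_source
  refine intervalIntegral.continuous_parametric_intervalIntegral_of_continuous' ?_ 0 1
  have h1 : Continuous fun z : ℝ × ℝ => (f (z.1 * z.2), y (z.1 * z.2)) := by fun_prop
  exact (by fun_prop : Continuous fun z : ℝ × ℝ => z.2 ^ P.n).mul (this.comp h1)

theorem abs_source_le {f y B C : ℝ} (hf : |f| ≤ B) (hy : |y| ≤ C) :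
    |P.source f y| ≤ P.lip * B + P.n * C := by
  have hB : 0 ≤ B := (abs_nonneg _).trans hf
  have hC : 0 ≤ C := (abs_nonneg _).trans hy
  rw [abs_le] at hf hy ⊢
  constructor
  · have h1 := P.source_add_le (f := f) (y := y) (ε := B) (M := C) hB hC
    have h2 := P.source_mono (show 0 ≤ f + B by linarith) (show 0 ≤ y + C by linarith)
    rw [source_zero] at h2
    linarith
  · have h1 := P.source_add_le (f := 0) (y := 0) (ε := B) (M := C) hB hC
    have h2 := P.source_mono (show f ≤ 0 + B by linarith) (show y ≤ 0 + C by linarith)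
    rw [source_zero] at h1
    linarith

theorem abs_source_sub_le {f y y' : ℝ} : |P.source f y - P.source f y'| ≤ P.n * |y - y'| := by
  have key : ∀ y y' : ℝ, P.source f y ≤ P.source f y' + P.n * |y - y'| := fun y y' => by
    have h1 := P.source_mono (le_refl (f + 0))
      (show y ≤ y' + |y - y'| by linarith [le_abs_self (y - y')])
    have h2 := P.source_add_le (f := f) (y := y') le_rfl (abs_nonneg (y - y'))
    simp only [add_zero, mul_zero] at h1 h2
    linarith
  rw [abs_le]
  have h1 := key y y'
  have h2 := key y' y
  rw [abs_sub_comm] at h2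
  constructor <;> linarith

theorem abs_integral_weight_le {g : ℝ → ℝ} {C : ℝ} (hg : ∀ σ ∈ Set.Icc (0 : ℝ) 1, |g σ| ≤ C) :
    |∫ σ in (0 : ℝ)..1, σ ^ P.n * g σ| ≤ C / (P.n + 1) := by
  rw [← P.integral_weight, ← Real.norm_eq_abs]
  refine intervalIntegral.norm_integral_le_of_norm_le zero_le_one
    (Eventually.of_forall fun σ hσ => ?_) (Continuous.intervalIntegrable (by fun_prop) _ _)
  rw [norm_mul, Real.norm_eq_abs, Real.norm_eq_abs, abs_of_nonneg (pow_nonneg hσ.1.le _)]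
  exact mul_le_mul_of_nonneg_left (hg σ ⟨hσ.1.le, hσ.2⟩) (pow_nonneg hσ.1.le _)

/-- The averaging map contracts bounded continuous functions by n / (n + 1): the source is
n-Lipschitz in y and σⁿ has integral 1 / (n + 1). -/
theorem exists_continuous_eq_mean {f : ℝ → ℝ} {B : ℝ} (hf : Continuous f) (hB : ∀ r, |f r| ≤ B) :
    ∃ y : ℝ → ℝ, Continuous y ∧ ∀ r, y r = P.mean f y r := by
  have hn : (0 : ℝ) < P.n + 1 := by positivity
  let Φ : BoundedContinuousFunction ℝ ℝ → BoundedContinuousFunction ℝ ℝ := fun y =>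
    BoundedContinuousFunction.ofNormedAddCommGroup (P.mean f y) (continuous_mean hf y.continuous)
      ((P.lip * B + P.n * ‖y‖) / (P.n + 1)) fun r =>
        abs_integral_weight_le fun σ _ => abs_source_le (hB _) (y.norm_coe_le_norm _)
  have hΦ : ∀ y r, Φ y r = P.mean f y r := fun y r => rfl
  have hc : ContractingWith ((P.n : NNReal) / (P.n + 1)) Φ := by
    refine ⟨?_, LipschitzWith.of_dist_le_mul fun y y' => ?_⟩
    · rw [div_lt_one (by positivity)]
      exact lt_add_one _
    · have h0 : (0 : ℝ) ≤ ((P.n : NNReal) / (P.n + 1) : NNReal) := NNReal.coe_nonneg _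
      rw [BoundedContinuousFunction.dist_le (mul_nonneg h0 dist_nonneg)]
      intro r
      rw [Real.dist_eq, hΦ, hΦ, mean, mean]
      have hi : ∀ y : BoundedContinuousFunction ℝ ℝ, IntervalIntegrable
          (fun σ => σ ^ P.n * P.source (f (r * σ)) (y (r * σ))) MeasureTheory.volume 0 1 := fun y => by
        have := P.continuous_source
        have h1 : Continuous fun σ : ℝ => (f (r * σ), y (r * σ)) := by fun_prop
        exact Continuous.intervalIntegrable ((continuous_pow _).mul (this.comp h1)) _ _
      rw [← intervalIntegral.integral_sub (hi y) (hi y')]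
      simp only [← mul_sub]
      refine (abs_integral_weight_le (C := P.n * dist y y') fun σ _ =>
        abs_source_sub_le.trans ?_).trans (le_of_eq ?_)
      · rw [← Real.dist_eq]
        exact mul_le_mul_of_nonneg_left (BoundedContinuousFunction.dist_coe_le_dist _)
          (by positivity)
      · push_cast
        ring
  refine ⟨hc.fixedPoint, hc.fixedPoint.continuous, fun r => ?_⟩
  rw [← hΦ, hc.fixedPoint_isFixedPt]

end RadialParams

/-! ### Powers of positive parts -/

/-- The power `(max t 0) ^ p`. -/
noncomputable def posPow (p t : ℝ) : ℝ := (max t 0) ^ p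

theorem posPow_nonneg (p t : ℝ) : 0 ≤ posPow p t := Real.rpow_nonneg (le_max_right _ _) _

theorem posPow_mono {p : ℝ} (hp : 0 ≤ p) : Monotone (posPow p) := fun _ _ h =>
  Real.rpow_le_rpow (le_max_right _ _) (max_le_max_right _ h) hp

theorem posPow_of_nonpos {p t : ℝ} (hp : 0 < p) (ht : t ≤ 0) : posPow p t = 0 := by
  rw [posPow, max_eq_right ht, Real.zero_rpow hp.ne']

theorem posPow_of_nonneg {p t : ℝ} (ht : 0 ≤ t) : posPow p t = t ^ p := by
  rw [posPow, max_eq_left ht]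

theorem Continuous.posPow {X : Type*} [TopologicalSpace X] {p f : X → ℝ} (hp : Continuous p)
    (hf : Continuous f) (hp0 : ∀ x, 0 < p x) : Continuous fun x => posPow (p x) (f x) :=
  (hf.max continuous_const).rpow hp fun x => Or.inr (hp0 x)

theorem ContinuousOn.posPow {p : ℝ} (hp : 0 < p) {f : ℝ → ℝ} {s : Set ℝ} (hf : ContinuousOn f s) :
    ContinuousOn (fun x => _root_.posPow p (f x)) s :=
  ((continuous_const.posPow continuous_id fun _ => hp : Continuous fun t => _root_.posPow p t)
    ).comp_continuousOn hf

theorem abs_posPow_sub_le {p d M s t : ℝ} (hp : 0 < p) (hd : 0 < d) (hs : d ≤ s) (ht : d ≤ t)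
    (hsM : s ≤ M) (htM : t ≤ M) : |posPow p s - posPow p t| ≤ p * M ^ p / d * |s - t| := by
  have h0 : 0 ≤ p * M ^ p / d := by
    have : 0 ≤ M := by linarith
    positivity
  rw [posPow_of_nonneg (by linarith), posPow_of_nonneg (by linarith), abs_le]
  have h1 := rpow_sub_rpow_le hd hs ht htM hp
  have h2 := rpow_sub_rpow_le hd ht hs hsM hp
  have h3 : max 0 (t - s) ≤ |s - t| := max_le (abs_nonneg _) (by
    rw [abs_sub_comm]; exact le_abs_self _)
  have h4 : max 0 (s - t) ≤ |s - t| := max_le (abs_nonneg _) (le_abs_self _)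
  have h5 := mul_le_mul_of_nonneg_left h3 h0
  have h6 := mul_le_mul_of_nonneg_left h4 h0
  constructor <;> linarith

/-! ### Uniqueness for the radial system -/

namespace RadialParams
variable {P : RadialParams}

theorem IsSol.abs_sub_le {T ε : ℝ} {f₁ f₂ y₁ y₂ : ℝ → ℝ} (h₁ : P.IsSol T f₁ y₁)
    (h₂ : P.IsSol T f₂ y₂) (hf₁ : ContinuousOn f₁ (Set.Icc 0 T))
    (hf₂ : ContinuousOn f₂ (Set.Icc 0 T)) (hε : 0 ≤ ε)
    (h : ∀ r ∈ Set.Icc 0 T, |f₁ r - f₂ r| ≤ ε) :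
    ∀ r ∈ Set.Icc 0 T, |y₁ r - y₂ r| ≤ P.lip * ε := by
  intro r hr
  have h3 := h₁.le_add h₂ hf₁ hf₂ hε (fun r hr => by linarith [(abs_le.mp (h r hr)).2]) r hr
  have h4 := h₂.le_add h₁ hf₂ hf₁ hε (fun r hr => by linarith [(abs_le.mp (h r hr)).1]) r hr
  rw [abs_le]
  constructor <;> linarith

theorem intervalIntegrable_id_mul {T r s : ℝ} {y : ℝ → ℝ} (hy : ContinuousOn y (Set.Icc 0 T))
    (hr : r ∈ Set.Icc 0 T) (hs : s ∈ Set.Icc 0 T) :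
    IntervalIntegrable (fun t => t * y t) MeasureTheory.volume r s := by
  refine ContinuousOn.intervalIntegrable ?_
  exact (continuousOn_id.mul hy).mono (Set.uIcc_subset_Icc hr hs)

variable (P) in
/-- `u, v` with radial slopes `-r yᵤ, -r yᵥ` solve the radial system on `[0, T]`. -/
structure IsSystemSol (T a b p q : ℝ) (u v yu yv : ℝ → ℝ) : Prop where
  sol_u : P.IsSol T (fun r => posPow p (v r)) yu
  sol_v : P.IsSol T (fun r => posPow q (u r)) yv
  eq_u : ∀ r ∈ Set.Icc 0 T, u r = a - ∫ s in (0 : ℝ)..r, s * yu s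
  eq_v : ∀ r ∈ Set.Icc 0 T, v r = b - ∫ s in (0 : ℝ)..r, s * yv s

theorem IsSystemSol.swap {T a b p q : ℝ} {u v yu yv : ℝ → ℝ}
    (h : P.IsSystemSol T a b p q u v yu yv) : P.IsSystemSol T b a q p v u yv yu :=
  ⟨h.sol_v, h.sol_u, h.eq_v, h.eq_u⟩

theorem IsSystemSol.mono {T T' a b p q : ℝ} {u v yu yv : ℝ → ℝ}
    (h : P.IsSystemSol T a b p q u v yu yv) (hT : T' ≤ T) : P.IsSystemSol T' a b p q u v yu yv :=
  ⟨h.sol_u.mono hT, h.sol_v.mono hT, fun r hr => h.eq_u r ⟨hr.1, hr.2.trans hT⟩,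
    fun r hr => h.eq_v r ⟨hr.1, hr.2.trans hT⟩⟩

theorem IsSystemSol.continuousOn_u {T a b p q : ℝ} {u v yu yv : ℝ → ℝ}
    (h : P.IsSystemSol T a b p q u v yu yv) : ContinuousOn u (Set.Icc 0 T) := by
  rcases le_or_gt 0 T with hT | hT
  · have h1 : ContinuousOn (fun r => ∫ s in (0 : ℝ)..r, s * yu s) (Set.Icc 0 T) := by
      have := intervalIntegral.continuousOn_primitive_interval
        (f := fun s => s * yu s) (μ := MeasureTheory.volume) (a := 0) (b := T) (by
          rw [Set.uIcc_of_le hT]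
          exact (continuousOn_id.mul h.sol_u.cont).integrableOn_Icc)
      rwa [Set.uIcc_of_le hT] at this
    exact (continuousOn_const.sub h1).congr h.eq_u
  · rw [Set.Icc_eq_empty (not_le.mpr hT)]
    exact continuousOn_empty _

theorem IsSystemSol.yu_nonneg {T a b p q : ℝ} {u v yu yv : ℝ → ℝ}
    (h : P.IsSystemSol T a b p q u v yu yv) (hp : 0 < p) : ∀ r ∈ Set.Icc 0 T, 0 ≤ yu r :=
  h.sol_u.nonneg (h.swap.continuousOn_u.posPow hp) fun _ _ => posPow_nonneg p _

theorem IsSystemSol.u_sub {T a b p q r s : ℝ} {u v yu yv : ℝ → ℝ}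
    (h : P.IsSystemSol T a b p q u v yu yv) (hr : r ∈ Set.Icc 0 T) (hs : s ∈ Set.Icc 0 T) :
    u r - u s = ∫ t in r..s, t * yu t := by
  have h0 : (0 : ℝ) ∈ Set.Icc 0 T := ⟨le_rfl, hr.1.trans hr.2⟩
  rw [h.eq_u r hr, h.eq_u s hs, ← intervalIntegral.integral_add_adjacent_intervals
    (intervalIntegrable_id_mul h.sol_u.cont h0 hr) (intervalIntegrable_id_mul h.sol_u.cont hr hs)]
  ring

theorem IsSystemSol.antitoneOn_u {T a b p q : ℝ} {u v yu yv : ℝ → ℝ}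
    (h : P.IsSystemSol T a b p q u v yu yv) (hp : 0 < p) : AntitoneOn u (Set.Icc 0 T) := by
  intro r hr s hs hrs
  rw [← sub_nonneg, h.u_sub hr hs]
  exact intervalIntegral.integral_nonneg hrs fun t ht => mul_nonneg (hr.1.trans ht.1)
    (h.yu_nonneg hp t ⟨hr.1.trans ht.1, ht.2.trans hs.2⟩)

/-- If the v components agree up to x, so do the slopes of u, and the difference of the u components
is an integral over [x, T] only. The resulting factor T - x supplies the contraction in
`exists_extension`. -/
theorem IsSystemSol.abs_sub_le {T x ε a b b' p q : ℝ} {u₁ v₁ yu₁ yv₁ u₂ v₂ yu₂ yv₂ : ℝ → ℝ}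
    (h₁ : P.IsSystemSol T a b p q u₁ v₁ yu₁ yv₁) (h₂ : P.IsSystemSol T a b' p q u₂ v₂ yu₂ yv₂)
    (hp : 0 < p) (hx : x ∈ Set.Icc 0 T) (hε : 0 ≤ ε)
    (hv : ∀ r ∈ Set.Icc 0 x, v₁ r = v₂ r)
    (hd : ∀ r ∈ Set.Icc 0 T, |posPow p (v₁ r) - posPow p (v₂ r)| ≤ ε) :
    ∀ r ∈ Set.Icc 0 T, |u₁ r - u₂ r| ≤ T * (P.lip * ε) * (T - x) := by
  intro r hr
  have hT : 0 ≤ T := hx.1.trans hx.2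
  have h0 : (0 : ℝ) ∈ Set.Icc 0 T := ⟨le_rfl, hT⟩
  have hc₁ := h₁.swap.continuousOn_u.posPow hp
  have hc₂ := h₂.swap.continuousOn_u.posPow hp
  have hsub : Set.Icc 0 x ⊆ Set.Icc 0 T := Set.Icc_subset_Icc_right hx.2
  have hy0 : ∀ t ∈ Set.Icc 0 x, yu₁ t = yu₂ t := fun t ht => by
    have := (h₁.sol_u.mono hx.2).abs_sub_le (h₂.sol_u.mono hx.2) (hc₁.mono hsub) (hc₂.mono hsub)
      le_rfl (fun r hr => by rw [hv r hr]; simp) t ht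
    rw [mul_zero] at this
    exact sub_eq_zero.mp (abs_nonpos_iff.mp this)
  have hy := h₁.sol_u.abs_sub_le h₂.sol_u hc₁ hc₂ hε hd
  have hnn : 0 ≤ T * (P.lip * ε) * (T - x) :=
    mul_nonneg (mul_nonneg hT (mul_nonneg P.lip_nonneg hε)) (by linarith [hx.2])
  have key : ∀ t ∈ Set.Icc 0 T, u₁ t - u₂ t = -∫ s in (0 : ℝ)..t, (s * yu₁ s - s * yu₂ s) :=
    fun t ht => by
      rw [intervalIntegral.integral_sub (intervalIntegrable_id_mul h₁.sol_u.cont h0 ht)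
        (intervalIntegrable_id_mul h₂.sol_u.cont h0 ht), h₁.eq_u t ht, h₂.eq_u t ht]
      ring
  have hint : ∀ t ∈ Set.Icc 0 T, ∀ t' ∈ Set.Icc 0 T,
      IntervalIntegrable (fun s => s * yu₁ s - s * yu₂ s) MeasureTheory.volume t t' :=
    fun t ht t' ht' => (intervalIntegrable_id_mul h₁.sol_u.cont ht ht').sub
      (intervalIntegrable_id_mul h₂.sol_u.cont ht ht')
  have hzero : ∀ t ∈ Set.Icc 0 x, ∫ s in (0 : ℝ)..t, (s * yu₁ s - s * yu₂ s) = 0 := fun t ht => by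
    rw [intervalIntegral.integral_congr (g := fun _ => (0 : ℝ))]
    · simp
    · intro s hs
      rw [Set.uIcc_of_le ht.1] at hs
      simp [hy0 s ⟨hs.1, hs.2.trans ht.2⟩]
  rw [key r hr, abs_neg]
  rcases le_total r x with hrx | hrx
  · rw [hzero r ⟨hr.1, hrx⟩, abs_zero]
    exact hnn
  · rw [← intervalIntegral.integral_add_adjacent_intervals (hint 0 h0 x hx) (hint x hx r hr),
      hzero x ⟨hx.1, le_rfl⟩, zero_add, ← Real.norm_eq_abs]
    refine (intervalIntegral.norm_integral_le_of_norm_le_const (C := T * (P.lip * ε))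
      fun s hs => ?_).trans ?_
    · rw [Set.uIoc_of_le hrx] at hs
      have hs' : s ∈ Set.Icc 0 T := ⟨hx.1.trans hs.1.le, hs.2.trans hr.2⟩
      rw [← mul_sub, norm_mul, Real.norm_eq_abs, Real.norm_eq_abs, abs_of_nonneg hs'.1]
      exact mul_le_mul hs'.2 (hy s hs') (abs_nonneg _) hT
    · rw [abs_of_nonneg (by linarith)]
      exact mul_le_mul_of_nonneg_left (by linarith [hr.2])
        (mul_nonneg hT (mul_nonneg P.lip_nonneg hε))

theorem IsSystemSol.eq_of_eq {T a b b' p q : ℝ} {u₁ v₁ yu₁ yv₁ u₂ v₂ yu₂ yv₂ : ℝ → ℝ}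
    (h₁ : P.IsSystemSol T a b p q u₁ v₁ yu₁ yv₁) (h₂ : P.IsSystemSol T a b' p q u₂ v₂ yu₂ yv₂)
    (hp : 0 < p) (hv : ∀ r ∈ Set.Icc 0 T, posPow p (v₁ r) = posPow p (v₂ r)) :
    ∀ r ∈ Set.Icc 0 T, u₁ r = u₂ r := fun r hr => by
  have h0 : (0 : ℝ) ∈ Set.Icc 0 T := ⟨le_rfl, hr.1.trans hr.2⟩
  have hy := h₁.sol_u.abs_sub_le h₂.sol_u (h₁.swap.continuousOn_u.posPow hp)
    (h₂.swap.continuousOn_u.posPow hp) le_rfl (fun r hr => by rw [hv r hr]; simp)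
  rw [h₁.eq_u r hr, h₂.eq_u r hr]
  congr 1
  refine intervalIntegral.integral_congr fun s hs => ?_
  rw [Set.uIcc_of_le hr.1] at hs
  have := hy s ⟨hs.1, hs.2.trans hr.2⟩
  rw [mul_zero] at this
  rw [sub_eq_zero.mp (abs_nonpos_iff.mp this)]

/-- Components are nonincreasing, so v stays nonpositive after x and its positive part no longer
forces u. Thus u is determined, and through it v. -/
theorem IsSystemSol.eq_of_nonpos {T x a b p q : ℝ} {u₁ v₁ yu₁ yv₁ u₂ v₂ yu₂ yv₂ : ℝ → ℝ}
    (h₁ : P.IsSystemSol T a b p q u₁ v₁ yu₁ yv₁) (h₂ : P.IsSystemSol T a b p q u₂ v₂ yu₂ yv₂)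
    (hp : 0 < p) (hq : 0 < q) (hx : x ∈ Set.Icc 0 T)
    (hv : ∀ r ∈ Set.Icc 0 x, v₁ r = v₂ r) (h0 : v₁ x ≤ 0) :
    ∀ r ∈ Set.Icc 0 T, u₁ r = u₂ r ∧ v₁ r = v₂ r := by
  have hf : ∀ r ∈ Set.Icc 0 T, posPow p (v₁ r) = posPow p (v₂ r) := fun r hr => by
    rcases le_total r x with hrx | hrx
    · rw [hv r ⟨hr.1, hrx⟩]
    · have h3 : v₁ r ≤ 0 := (h₁.swap.antitoneOn_u hq hx hr hrx).trans h0
      have h4 : v₂ r ≤ 0 := (h₂.swap.antitoneOn_u hq hx hr hrx).trans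
        ((hv x ⟨hx.1, le_rfl⟩).ge.trans h0)
      rw [posPow_of_nonpos hp h3, posPow_of_nonpos hp h4]
  have hu := h₁.eq_of_eq h₂ hp hf
  have hv := h₁.swap.eq_of_eq h₂.swap hq fun r hr => by rw [hu r hr]
  exact fun r hr => ⟨hu r hr, hv r hr⟩

/-- If a component is nonpositive at x, agreement extends to all of [0, T] by decoupling. Otherwise
both stay above some d > 0 slightly beyond x, where the powers are Lipschitz even for exponents
below 1. -/
theorem IsSystemSol.exists_extension {T x a b p q : ℝ} {u₁ v₁ yu₁ yv₁ u₂ v₂ yu₂ yv₂ : ℝ → ℝ}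
    (h₁ : P.IsSystemSol T a b p q u₁ v₁ yu₁ yv₁) (h₂ : P.IsSystemSol T a b p q u₂ v₂ yu₂ yv₂)
    (hp : 0 < p) (hq : 0 < q) (hx : x ∈ Set.Ico 0 T)
    (heq : ∀ r ∈ Set.Icc 0 x, u₁ r = u₂ r ∧ v₁ r = v₂ r) :
    ∃ x' ∈ Set.Ioc x T, ∀ r ∈ Set.Icc 0 x', u₁ r = u₂ r ∧ v₁ r = v₂ r := by
  have hxT : x ∈ Set.Icc 0 T := ⟨hx.1, hx.2.le⟩
  have hxx : x ∈ Set.Icc 0 x := ⟨hx.1, le_rfl⟩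
  rcases le_or_gt (v₁ x) 0 with hv0 | hv0
  · exact ⟨T, ⟨hx.2, le_rfl⟩, h₁.eq_of_nonpos h₂ hp hq hxT (fun r hr => (heq r hr).2) hv0⟩
  rcases le_or_gt (u₁ x) 0 with hu0 | hu0
  · exact ⟨T, ⟨hx.2, le_rfl⟩, fun r hr =>
      (h₁.swap.eq_of_nonpos h₂.swap hq hp hxT (fun r hr => (heq r hr).1) hu0 r hr).symm⟩
  obtain ⟨hux, hvx⟩ := heq x hxx
  set d := min (u₁ x) (v₁ x) / 2 with hd
  have hd0 : 0 < d := by positivity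
  have hdu : d < u₁ x := by linarith [min_le_left (u₁ x) (v₁ x)]
  have hdv : d < v₁ x := by linarith [min_le_right (u₁ x) (v₁ x)]
  have h0T : (0 : ℝ) ∈ Set.Icc 0 T := ⟨le_rfl, hx.1.trans hx.2.le⟩
  have hnear : ∀ w : ℝ → ℝ, ContinuousOn w (Set.Icc 0 T) → d < w x →
      ∀ᶠ r in 𝓝[>] x, d < w r := fun w hw hdw => by
    have h3 := (hw x hxT).eventually (lt_mem_nhds hdw)
    refine h3.filter_mono ?_
    rw [← nhdsWithin_Ioc_eq_nhdsGT hx.2]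
    exact nhdsWithin_mono _ fun r hr => ⟨hx.1.trans hr.1.le, hr.2⟩
  set M := max a b with hM
  have hM0 : 0 < M := by
    have h3 := h₁.antitoneOn_u hp h0T hxT hx.1
    rw [h₁.eq_u 0 h0T] at h3
    simp at h3
    exact (hu0.trans_le h3).trans_le (le_max_left _ _)
  set K := max (p * M ^ p / d) (q * M ^ q / d) with hK
  have hK0 : 0 ≤ K := le_max_of_le_left (by positivity)
  have hT0 : 0 < T := hx.1.trans_lt hx.2
  -- A step of length h makes the largest difference of each component at most half that of the
  -- other, so both vanish.
  obtain ⟨h, hh0, hh⟩ : ∃ h > 0, T * (P.lip * K) * h ≤ 1 / 2 := by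
    have h3 : 0 ≤ T * (P.lip * K) := mul_nonneg hT0.le (mul_nonneg P.lip_nonneg hK0)
    refine ⟨1 / (2 * (T * (P.lip * K) + 1)), by positivity, ?_⟩
    rw [mul_one_div, div_le_div_iff₀ (by positivity) (by norm_num)]
    linarith
  obtain ⟨x', ⟨⟨⟨hu₁, hu₂⟩, ⟨hv₁, hv₂⟩⟩, hx'⟩⟩ :=
    (((((hnear u₁ h₁.continuousOn_u hdu).and (hnear u₂ h₂.continuousOn_u (hux ▸ hdu))).and
    ((hnear v₁ h₁.swap.continuousOn_u hdv).and (hnear v₂ h₂.swap.continuousOn_u (hvx ▸ hdv))))).and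
    (Ioc_mem_nhdsGT (show x < min (x + h) T from lt_min (by linarith) hx.2))).exists
  have hx'T : x' ≤ T := hx'.2.trans (min_le_right _ _)
  have hx'h : x' - x ≤ h := by linarith [hx'.2.trans (min_le_left _ _)]
  have hx'0 : 0 ≤ x' := hx.1.trans hx'.1.le
  refine ⟨x', ⟨hx'.1, hx'T⟩, ?_⟩
  have hx'm : x' ∈ Set.Icc 0 T := ⟨hx'0, hx'T⟩
  have hsub : Set.Icc 0 x' ⊆ Set.Icc 0 T := Set.Icc_subset_Icc_right hx'T
  have bu : ∀ {u v yu yv : ℝ → ℝ}, P.IsSystemSol T a b p q u v yu yv → d < u x' → d < v x' →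
      ∀ r ∈ Set.Icc 0 x', (d ≤ u r ∧ u r ≤ M) ∧ (d ≤ v r ∧ v r ≤ M) :=
    fun {u v yu yv} hs h3 h4 r hr => by
      have hrT := hsub hr
      have h5 := hs.antitoneOn_u hp h0T hrT hr.1
      have h6 := hs.swap.antitoneOn_u hq h0T hrT hr.1
      rw [hs.eq_u 0 h0T] at h5
      rw [hs.eq_v 0 h0T] at h6
      simp at h5 h6
      exact ⟨⟨h3.le.trans (hs.antitoneOn_u hp hrT hx'm hr.2), h5.trans (le_max_left _ _)⟩,
        ⟨h4.le.trans (hs.swap.antitoneOn_u hq hrT hx'm hr.2), h6.trans (le_max_right _ _)⟩⟩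
  have b₁ := bu h₁ hu₁ hv₁
  have b₂ := bu h₂ hu₂ hv₂
  have hmax : ∀ w₁ w₂ : ℝ → ℝ, ContinuousOn w₁ (Set.Icc 0 T) → ContinuousOn w₂ (Set.Icc 0 T) →
      ∃ r ∈ Set.Icc 0 x', ∀ s ∈ Set.Icc 0 x', |w₁ s - w₂ s| ≤ |w₁ r - w₂ r| := fun w₁ w₂ hw₁ hw₂ => by
    obtain ⟨r, hr, hrm⟩ := isCompact_Icc.exists_isMaxOn ⟨0, ⟨le_rfl, hx'0⟩⟩
      ((hw₁.sub hw₂).abs.mono hsub)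
    exact ⟨r, hr, fun s hs => hrm hs⟩
  obtain ⟨ru, hru, hrum⟩ := hmax u₁ u₂ h₁.continuousOn_u h₂.continuousOn_u
  obtain ⟨rv, hrv, hrvm⟩ := hmax v₁ v₂ h₁.swap.continuousOn_u h₂.swap.continuousOn_u
  have hxx' : x ∈ Set.Icc 0 x' := ⟨hx.1, hx'.1.le⟩
  have est : ∀ D : ℝ, 0 ≤ D → x' * (P.lip * (K * D)) * (x' - x) ≤ D / 2 := fun D hD => by
    have h3 : x' * (P.lip * (K * D)) * (x' - x) ≤ T * (P.lip * (K * D)) * h :=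
      mul_le_mul (mul_le_mul_of_nonneg_right hx'T (mul_nonneg P.lip_nonneg (mul_nonneg hK0 hD)))
        hx'h (by linarith [hx'.1])
        (mul_nonneg hT0.le (mul_nonneg P.lip_nonneg (mul_nonneg hK0 hD)))
    have h4 := mul_le_mul_of_nonneg_right hh hD
    linarith
  have eu := (h₁.mono hx'T).abs_sub_le (h₂.mono hx'T) hp hxx'
    (mul_nonneg hK0 (abs_nonneg (v₁ rv - v₂ rv))) (fun r hr => (heq r hr).2)
    (fun r hr => (abs_posPow_sub_le hp hd0 (b₁ r hr).2.1 (b₂ r hr).2.1 (b₁ r hr).2.2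
      (b₂ r hr).2.2).trans (mul_le_mul (le_max_left _ _) (hrvm r hr) (abs_nonneg _) hK0)) ru hru
  have ev := (h₁.mono hx'T).swap.abs_sub_le (h₂.mono hx'T).swap hq hxx'
    (mul_nonneg hK0 (abs_nonneg (u₁ ru - u₂ ru))) (fun r hr => (heq r hr).1)
    (fun r hr => (abs_posPow_sub_le hq hd0 (b₁ r hr).1.1 (b₂ r hr).1.1 (b₁ r hr).1.2
      (b₂ r hr).1.2).trans (mul_le_mul (le_max_right _ _) (hrum r hr) (abs_nonneg _) hK0)) rv hrv
  have eu' := eu.trans (est _ (abs_nonneg _))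
  have ev' := ev.trans (est _ (abs_nonneg _))
  have z₁ : |u₁ ru - u₂ ru| ≤ 0 := by
    linarith [abs_nonneg (u₁ ru - u₂ ru), abs_nonneg (v₁ rv - v₂ rv)]
  have z₂ : |v₁ rv - v₂ rv| ≤ 0 := by
    linarith [abs_nonneg (u₁ ru - u₂ ru), abs_nonneg (v₁ rv - v₂ rv)]
  exact fun r hr => ⟨sub_eq_zero.mp (abs_nonpos_iff.mp ((hrum r hr).trans z₁)),
    sub_eq_zero.mp (abs_nonpos_iff.mp ((hrvm r hr).trans z₂))⟩

theorem IsSystemSol.unique {T a b p q : ℝ} {u₁ v₁ yu₁ yv₁ u₂ v₂ yu₂ yv₂ : ℝ → ℝ}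
    (h₁ : P.IsSystemSol T a b p q u₁ v₁ yu₁ yv₁) (h₂ : P.IsSystemSol T a b p q u₂ v₂ yu₂ yv₂)
    (hp : 0 < p) (hq : 0 < q) : ∀ r ∈ Set.Icc 0 T, u₁ r = u₂ r ∧ v₁ r = v₂ r := by
  intro r₀ hr₀
  have hT : 0 ≤ T := hr₀.1.trans hr₀.2
  have h0T : (0 : ℝ) ∈ Set.Icc 0 T := ⟨le_rfl, hT⟩
  set S : Set ℝ := {x | x ∈ Set.Icc 0 T ∧ ∀ r ∈ Set.Icc 0 x, u₁ r = u₂ r ∧ v₁ r = v₂ r} with hS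
  have h0S : (0 : ℝ) ∈ S := ⟨h0T, fun r hr => by
    have : r = 0 := le_antisymm hr.2 hr.1
    rw [this, h₁.eq_u 0 h0T, h₂.eq_u 0 h0T, h₁.eq_v 0 h0T, h₂.eq_v 0 h0T]
    simp⟩
  have hbdd : BddAbove S := ⟨T, fun x hx => hx.1.2⟩
  set ρ := sSup S with hρ
  have hρT : ρ ∈ Set.Icc 0 T := ⟨le_csSup hbdd h0S, csSup_le ⟨0, h0S⟩ fun x hx => hx.1.2⟩
  have hbelow : ∀ r, 0 ≤ r → r < ρ → u₁ r = u₂ r ∧ v₁ r = v₂ r := fun r hr0 hr => by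
    obtain ⟨x, hx, hrx⟩ := exists_lt_of_lt_csSup ⟨0, h0S⟩ hr
    exact hx.2 r ⟨hr0, hrx.le⟩
  have hlim : ∀ w₁ w₂ : ℝ → ℝ, ContinuousOn w₁ (Set.Icc 0 T) → ContinuousOn w₂ (Set.Icc 0 T) →
      0 < ρ → (∀ r, 0 ≤ r → r < ρ → w₁ r = w₂ r) → w₁ ρ = w₂ ρ := fun w₁ w₂ hw₁ hw₂ h0 hw => by
    have hsub : Set.Ico 0 ρ ⊆ Set.Icc 0 T := fun r hr => ⟨hr.1, hr.2.le.trans hρT.2⟩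
    have hne : (𝓝[Set.Ico 0 ρ] ρ).NeBot := by
      rw [nhdsWithin_Ico_eq_nhdsLT h0]
      infer_instance
    refine tendsto_nhds_unique_of_eventuallyEq ((hw₁ ρ hρT).mono hsub) ((hw₂ ρ hρT).mono hsub) ?_
    filter_upwards [self_mem_nhdsWithin] with r hr using hw r hr.1 hr.2
  have hρS : ρ ∈ S := by
    refine ⟨hρT, fun r hr => ?_⟩
    rcases eq_or_lt_of_le hr.2 with heq | hlt
    · rcases eq_or_lt_of_le hρT.1 with h0 | h0
      · exact h0S.2 r ⟨hr.1, heq.le.trans h0.ge⟩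
      · rw [heq]
        exact ⟨hlim _ _ h₁.continuousOn_u h₂.continuousOn_u h0 fun r h3 h4 => (hbelow r h3 h4).1,
          hlim _ _ h₁.swap.continuousOn_u h₂.swap.continuousOn_u h0
            fun r h3 h4 => (hbelow r h3 h4).2⟩
    · exact hbelow r hr.1 hlt
  rcases eq_or_lt_of_le hρT.2 with heq | hlt
  · exact hρS.2 r₀ (by rw [heq]; exact hr₀)
  · obtain ⟨x', hx', hx'e⟩ := h₁.exists_extension h₂ hp hq ⟨hρT.1, hlt⟩ hρS.2
    have : x' ≤ ρ := le_csSup hbdd ⟨⟨hρT.1.trans hx'.1.le, hx'.2⟩, hx'e⟩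
    exact absurd hx'.1 (not_lt.mpr this)

end RadialParams

/-! ### Global solutions by alternating monotone iteration -/

namespace RadialParams
variable (P : RadialParams)

open Classical in
/-- The solution of the integral equation with source `f` on the half line, extended by a
constant. -/
noncomputable def ysol (f : ℝ → ℝ) (r : ℝ) : ℝ :=
  if h : ∃ y : ℝ → ℝ, Continuous y ∧ ∀ r, y r = P.mean (fun r => f (max r 0)) y r then
    h.choose (max r 0) else 0

variable {P}

theorem ysol_max (f : ℝ → ℝ) (r : ℝ) : P.ysol f (max r 0) = P.ysol f r := by
  simp [ysol]

theorem ysol_spec {f : ℝ → ℝ} {B : ℝ} (hf : Continuous f) (hB : ∀ r, |f r| ≤ B) :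
    Continuous (P.ysol f) ∧ ∀ T, P.IsSol T f (P.ysol f) := by
  have h : ∃ y : ℝ → ℝ, Continuous y ∧ ∀ r, y r = P.mean (fun r => f (max r 0)) y r :=
    exists_continuous_eq_mean (by fun_prop) fun r => hB _
  have h1 : P.ysol f = fun r => h.choose (max r 0) := by
    ext r
    rw [ysol, dif_pos h]
  have hc : Continuous (P.ysol f) := by
    rw [h1]
    have := h.choose_spec.1
    fun_prop
  refine ⟨hc, fun T => ⟨hc.continuousOn, fun r hr => ?_⟩⟩
  rw [h1]
  simp only
  rw [h.choose_spec.2, max_eq_left hr.1]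
  refine intervalIntegral.integral_congr fun σ hσ => ?_
  rw [Set.uIcc_of_le zero_le_one] at hσ
  simp only [max_eq_left (mul_nonneg hr.1 hσ.1)]

/-- Continuous profiles bounded above by `b`. -/
structure Adm (b : ℝ) (v : ℝ → ℝ) : Prop where
  cont : Continuous v
  le : ∀ r, v r ≤ b

variable (P) in
/-- The solution `y` of the integral equation with source `v₊ ^ p`. -/
noncomputable def slope (p : ℝ) (v : ℝ → ℝ) : ℝ → ℝ := P.ysol fun r => posPow p (v r)

variable (P) in
/-- The profile with value `a` at the origin and radial slope `-r y`, where `y` solves the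
integral equation with source `v₊ ^ p`. -/
noncomputable def step (a p : ℝ) (v : ℝ → ℝ) (r : ℝ) : ℝ :=
  a - ∫ s in (0 : ℝ)..max r 0, s * P.slope p v s

section
variable {a b p : ℝ} {v : ℝ → ℝ}

theorem Adm.continuous_posPow (hv : Adm b v) (hp : 0 < p) : Continuous fun r => posPow p (v r) :=
  continuous_const.posPow hv.cont fun _ => hp

theorem Adm.posPow_le (hv : Adm b v) (hp : 0 < p) (r : ℝ) : posPow p (v r) ≤ posPow p b :=
  posPow_mono hp.le (hv.le r)

theorem Adm.slope_spec (hv : Adm b v) (hp : 0 < p) :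
    Continuous (P.slope p v) ∧ ∀ T, P.IsSol T (fun r => posPow p (v r)) (P.slope p v) :=
  ysol_spec (B := posPow p b) (hv.continuous_posPow hp) fun r => by
    rw [abs_of_nonneg (posPow_nonneg _ _)]
    exact hv.posPow_le hp r

theorem slope_max (p : ℝ) (v : ℝ → ℝ) (r : ℝ) : P.slope p v (max r 0) = P.slope p v r :=
  ysol_max _ _

theorem max_mem_Icc (r : ℝ) : max r 0 ∈ Set.Icc 0 (max r 0) := ⟨le_max_right _ _, le_rfl⟩

theorem Adm.slope_nonneg (hv : Adm b v) (hp : 0 < p) (r : ℝ) : 0 ≤ P.slope p v r := by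
  rw [← slope_max]
  exact ((hv.slope_spec hp).2 (max r 0)).nonneg (hv.continuous_posPow hp).continuousOn
    (fun r _ => posPow_nonneg _ _) _ (max_mem_Icc r)

theorem Adm.slope_le (hv : Adm b v) (hp : 0 < p) (r : ℝ) :
    P.slope p v r ≤ P.lip * posPow p b := by
  rw [← slope_max]
  exact ((hv.slope_spec hp).2 (max r 0)).le_of_le (hv.continuous_posPow hp).continuousOn
    (posPow_nonneg _ _) (fun r _ => hv.posPow_le hp r) _ (max_mem_Icc r)

theorem Adm.slope_mono {b' : ℝ} {v' : ℝ → ℝ} (hv : Adm b v) (hv' : Adm b' v') (hp : 0 < p)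
    (h : ∀ r, v r ≤ v' r) (r : ℝ) : P.slope p v r ≤ P.slope p v' r := by
  rw [← slope_max p v, ← slope_max p v']
  simpa using ((hv.slope_spec hp).2 (max r 0)).le_add ((hv'.slope_spec hp).2 (max r 0))
    (hv.continuous_posPow hp).continuousOn (hv'.continuous_posPow hp).continuousOn le_rfl
    (fun r _ => by simpa using posPow_mono hp.le (h r)) _ (max_mem_Icc r)

theorem Adm.intervalIntegrable (hv : Adm b v) (hp : 0 < p) (r s : ℝ) :
    IntervalIntegrable (fun t => t * P.slope p v t) MeasureTheory.volume r s := by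
  have := (hv.slope_spec (P := P) hp).1
  exact Continuous.intervalIntegrable (by fun_prop) _ _

theorem Adm.step_sub (hv : Adm b v) (hp : 0 < p) (r s : ℝ) :
    P.step a p v r - P.step a p v s = ∫ t in max r 0..max s 0, t * P.slope p v t := by
  rw [step, step, ← intervalIntegral.integral_add_adjacent_intervals
    (hv.intervalIntegrable hp 0 (max r 0)) (hv.intervalIntegrable hp (max r 0) (max s 0))]
  ring

theorem Adm.step_antitone (hv : Adm b v) (hp : 0 < p) : Antitone (P.step a p v) := by
  intro r s hrs
  rw [← sub_nonneg, hv.step_sub hp]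
  exact intervalIntegral.integral_nonneg (max_le_max_right _ hrs) fun t ht =>
    mul_nonneg ((le_max_right r 0).trans ht.1) (hv.slope_nonneg hp t)

theorem step_of_nonpos (a p : ℝ) (v : ℝ → ℝ) {r : ℝ} (hr : r ≤ 0) : P.step a p v r = a := by
  rw [step, max_eq_right hr]
  simp

theorem Adm.step_adm (hv : Adm b v) (hp : 0 < p) : Adm a (P.step a p v) := by
  refine ⟨?_, fun r => ?_⟩
  · have h1 := (hv.slope_spec (P := P) hp).1
    have h2 : Continuous fun r => ∫ s in (0 : ℝ)..r, s * P.slope p v s :=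
      intervalIntegral.continuous_primitive (fun r s => hv.intervalIntegrable hp r s) 0
    have : Continuous fun r : ℝ => max r 0 := by fun_prop
    exact continuous_const.sub (h2.comp this)
  · rcases le_total r 0 with h | h
    · rw [step_of_nonpos a p v h]
    · exact (hv.step_antitone hp h).trans (step_of_nonpos a p v le_rfl).le

theorem Adm.step_sub_le (hv : Adm b v) (hp : 0 < p) {r s T : ℝ} (hrs : r ≤ s) (hs : s ≤ T)
    (hT : 0 ≤ T) :
    P.step a p v r - P.step a p v s ≤ T * (P.lip * posPow p b) * (s - r) := by
  have h0 : 0 ≤ P.lip * posPow p b := mul_nonneg P.lip_nonneg (posPow_nonneg _ _)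
  have hm : max r 0 ≤ max s 0 := max_le_max_right _ hrs
  rw [hv.step_sub hp]
  refine (le_abs_self _).trans ?_
  rw [← Real.norm_eq_abs]
  refine (intervalIntegral.norm_integral_le_of_norm_le_const (C := T * (P.lip * posPow p b))
    fun t ht => ?_).trans ?_
  · rw [Set.uIoc_of_le hm] at ht
    have ht0 : 0 ≤ t := (le_max_right r 0).trans ht.1.le
    rw [Real.norm_eq_abs, abs_of_nonneg (mul_nonneg ht0 (hv.slope_nonneg hp t))]
    exact mul_le_mul (ht.2.trans (max_le hs hT)) (hv.slope_le hp t) (hv.slope_nonneg hp t) hT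
  · rw [abs_of_nonneg (by linarith)]
    refine mul_le_mul_of_nonneg_left ?_ (mul_nonneg hT h0)
    have : max s 0 ≤ max r 0 + (s - r) := max_le (by linarith [le_max_left r 0])
      (by linarith [le_max_right r 0])
    linarith

/-- A larger source makes the profile fall faster: the step is order reversing, so a double step is
order preserving. -/
theorem Adm.step_le_step {b' : ℝ} {v' : ℝ → ℝ} (hv : Adm b v) (hv' : Adm b' v') (hp : 0 < p)
    (h : ∀ r, v r ≤ v' r) (r : ℝ) : P.step a p v' r ≤ P.step a p v r := by
  unfold step
  have := intervalIntegral.integral_mono_on (le_max_right r 0) (hv.intervalIntegrable (P := P) hp _ _)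
    (hv'.intervalIntegrable (P := P) hp _ _) fun s hs =>
      mul_le_mul_of_nonneg_left (hv.slope_mono hv' hp h s) hs.1
  linarith

theorem step_eq_add (a b p : ℝ) (v : ℝ → ℝ) (r : ℝ) :
    P.step a p v r = P.step b p v r + (a - b) := by
  unfold step
  ring

/-- Comparison turns uniform convergence of the sources into convergence of the slopes; dominated
convergence handles the integral. -/
theorem Adm.step_tendsto {w : ℕ → ℝ → ℝ} (hw : ∀ n, Adm b (w n)) (hv : Adm b v) (hp : 0 < p)
    (h : ∀ T, TendstoUniformlyOn (fun n r => posPow p (w n r)) (fun r => posPow p (v r)) atTop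
      (Set.Icc 0 T)) (r : ℝ) :
    Tendsto (fun n => P.step a p (w n) r) atTop (𝓝 (P.step a p v r)) := by
  unfold step
  refine Tendsto.const_sub _ ?_
  refine intervalIntegral.tendsto_integral_filter_of_dominated_convergence
    (fun s => |s| * (P.lip * posPow p b)) (Eventually.of_forall fun n => ?_)
    (Eventually.of_forall fun n => Eventually.of_forall fun s _ => ?_)
    (Continuous.intervalIntegrable (by fun_prop) _ _) (Eventually.of_forall fun s hs => ?_)
  · have := ((hw n).slope_spec (P := P) hp).1
    exact Continuous.aestronglyMeasurable (by fun_prop)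
  · rw [norm_mul, Real.norm_eq_abs, Real.norm_eq_abs, abs_of_nonneg ((hw n).slope_nonneg hp s)]
    exact mul_le_mul_of_nonneg_left ((hw n).slope_le hp s) (abs_nonneg _)
  · refine Tendsto.const_mul _ ?_
    rw [Set.uIoc_of_le (le_max_right _ _)] at hs
    rw [Metric.tendsto_nhds]
    intro ε hε
    have hε' : 0 < ε / (P.lip + 1) := div_pos hε (by linarith [P.lip_nonneg])
    filter_upwards [Metric.tendstoUniformlyOn_iff.mp (h s) _ hε'] with n hn
    have h3 := ((hw n).slope_spec (P := P) hp).2 s |>.abs_sub_le ((hv.slope_spec hp).2 s)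
      ((hw n).continuous_posPow hp).continuousOn (hv.continuous_posPow hp).continuousOn hε'.le
      (fun t ht => by
        have := (hn t ht).le
        rwa [dist_comm, Real.dist_eq] at this) s ⟨hs.1.le, le_rfl⟩
    rw [Real.dist_eq]
    refine h3.trans_lt ?_
    rw [mul_div_assoc', div_lt_iff₀ (by linarith [P.lip_nonneg])]
    nlinarith [P.lip_nonneg]

end

section
variable (P)

/-- The alternating iteration for the first component, starting from the constant `a`. -/
noncomputable def iter (a b p q : ℝ) : ℕ → ℝ → ℝ
  | 0 => fun _ => a
  | n + 1 => P.step a p (P.step b q (iter a b p q n))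

variable {P} {a b p q : ℝ}

theorem iter_adm (hp : 0 < p) (hq : 0 < q) (n : ℕ) : Adm a (P.iter a b p q n) := by
  induction n with
  | zero => exact ⟨continuous_const, fun _ => le_rfl⟩
  | succ n ih => exact (ih.step_adm (a := b) hq).step_adm hp

theorem iter_antitone (hp : 0 < p) (hq : 0 < q) (r : ℝ) : Antitone fun n => P.iter a b p q n r := by
  refine antitone_nat_of_succ_le fun n => ?_
  induction n generalizing r with
  | zero => exact (iter_adm (P := P) (a := a) (b := b) hp hq 1).le r
  | succ n ih =>
    have h1 := iter_adm (P := P) (a := a) (b := b) hp hq n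
    have h2 := iter_adm (P := P) (a := a) (b := b) hp hq (n + 1)
    exact (h1.step_adm hq).step_le_step (h2.step_adm hq) hp
      (fun r => h2.step_le_step h1 hq (fun r => ih r) r) r

/-- The profile driven by the largest admissible v bounds every iterate from below, so the
decreasing iteration has a finite limit. -/
theorem le_iter (hp : 0 < p) (hq : 0 < q) (n : ℕ) (r : ℝ) :
    P.step a p (fun _ => b) r ≤ P.iter a b p q n r := by
  have hb : Adm b fun _ : ℝ => b := ⟨continuous_const, fun _ => le_rfl⟩
  cases n with
  | zero => exact (hb.step_adm hp).le r
  | succ n =>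
    have h1 := (iter_adm (P := P) (a := a) (b := b) hp hq n).step_adm (P := P) (a := b) hq
    exact h1.step_le_step hb hp h1.le r

variable (P) in
/-- The limit of the iteration. -/
noncomputable def limU (a b p q r : ℝ) : ℝ := ⨅ n, P.iter a b p q n r

theorem tendsto_iter (hp : 0 < p) (hq : 0 < q) (r : ℝ) :
    Tendsto (fun n => P.iter a b p q n r) atTop (𝓝 (P.limU a b p q r)) :=
  tendsto_atTop_ciInf (iter_antitone hp hq r) ⟨P.step a p (fun _ => b) r, by
    rintro _ ⟨n, rfl⟩
    exact le_iter hp hq n r⟩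

theorem limU_adm (hp : 0 < p) (hq : 0 < q) : Adm a (P.limU a b p q) := by
  refine ⟨?_, fun r => le_of_tendsto (tendsto_iter hp hq r)
    (Eventually.of_forall fun n => (iter_adm hp hq n).le r)⟩
  -- The iterates are Lipschitz on bounded ranges with a constant independent of n, so the pointwise
  -- limit is continuous.
  have hlip : ∀ T ≥ 0, ∀ r s, r ≤ s → s ≤ T → |P.limU a b p q r - P.limU a b p q s| ≤
      T * (P.lip * posPow p b) * (s - r) := fun T hT r s hrs hs => by
    refine le_of_tendsto ((tendsto_iter hp hq r).sub (tendsto_iter hp hq s)).abs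
      (Eventually.of_forall fun n => ?_)
    have h0 : 0 ≤ T * (P.lip * posPow p b) * (s - r) :=
      mul_nonneg (mul_nonneg hT (mul_nonneg P.lip_nonneg (posPow_nonneg _ _))) (by linarith)
    cases n with
    | zero => simpa [iter] using h0
    | succ n =>
      have h1 := (iter_adm (P := P) (a := a) (b := b) hp hq n).step_adm (P := P) (a := b) hq
      have h2 := h1.step_antitone (P := P) (a := a) hp hrs
      rw [iter, abs_of_nonneg (by linarith)]
      exact h1.step_sub_le hp hrs hs hT
  rw [continuous_iff_continuousAt]
  intro r₀
  set T := |r₀| + 1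
  have hT : 0 ≤ T := by positivity
  have hC : 0 ≤ T * (P.lip * posPow p b) :=
    mul_nonneg hT (mul_nonneg P.lip_nonneg (posPow_nonneg _ _))
  have hr₀T : r₀ < T := by linarith [le_abs_self r₀]
  have h1 : LipschitzOnWith ⟨_, hC⟩ (P.limU a b p q) (Set.Iic T) := by
    refine LipschitzOnWith.of_dist_le_mul fun r hr s hs => ?_
    rw [Real.dist_eq, Real.dist_eq]
    rcases le_total r s with h | h
    · rw [abs_sub_comm r s, abs_of_nonneg (by linarith : 0 ≤ s - r)]
      exact hlip T hT r s h hs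
    · rw [abs_sub_comm, abs_of_nonneg (by linarith : 0 ≤ r - s)]
      exact hlip T hT s r h hr
  exact h1.continuousOn.continuousAt (Iic_mem_nhds hr₀T)

/-- Dini's theorem upgrades the monotone convergence of the sources to uniform convergence on
compact intervals. -/
theorem step_limU_tendsto (hp : 0 < p) (hq : 0 < q) (r : ℝ) :
    Tendsto (fun n => P.step b q (P.iter a b p q n) r) atTop
      (𝓝 (P.step b q (P.limU a b p q) r)) := by
  have hlim := limU_adm (P := P) (a := a) (b := b) hp hq
  refine Adm.step_tendsto (fun n => iter_adm hp hq n) hlim hq (fun T => ?_) r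
  refine Antitone.tendstoUniformlyOn_of_forall_tendsto isCompact_Icc
    (fun n => ((iter_adm hp hq n).continuous_posPow hq).continuousOn)
    (fun r _ m n hmn => posPow_mono hq.le (iter_antitone hp hq r hmn))
    (hlim.continuous_posPow hq).continuousOn fun r _ => ?_
  exact ((continuous_const.posPow continuous_id fun _ => hq : Continuous fun t => posPow q t).tendsto
    _).comp (tendsto_iter hp hq r)

theorem step_step_limU (hp : 0 < p) (hq : 0 < q) (r : ℝ) :
    P.step a p (P.step b q (P.limU a b p q)) r = P.limU a b p q r := by
  have hlim := limU_adm (P := P) (a := a) (b := b) hp hq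
  have hadm : ∀ n, Adm b (P.step b q (P.iter a b p q n)) := fun n => (iter_adm hp hq n).step_adm hq
  have hlim' : Adm b (P.step b q (P.limU a b p q)) := hlim.step_adm hq
  refine tendsto_nhds_unique (f := fun n => P.step a p (P.step b q (P.iter a b p q n)) r)
    (l := atTop) ?_ ((tendsto_iter hp hq r).comp (tendsto_add_atTop_nat 1))
  refine Adm.step_tendsto hadm hlim' hp (fun T => ?_) r
  refine Monotone.tendstoUniformlyOn_of_forall_tendsto isCompact_Icc
    (fun n => ((hadm n).continuous_posPow hp).continuousOn)
    (fun r _ m n hmn => posPow_mono hp.le ?_)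
    (hlim'.continuous_posPow hp).continuousOn fun r _ => ?_
  · exact (iter_adm hp hq n).step_le_step (iter_adm hp hq m) hq
      (fun r => iter_antitone hp hq r hmn) r
  · exact ((continuous_const.posPow continuous_id fun _ => hp : Continuous fun t =>
      posPow p t).tendsto _).comp (step_limU_tendsto hp hq r)

theorem isSystemSol_limU (hp : 0 < p) (hq : 0 < q) (T : ℝ) :
    P.IsSystemSol T a b p q (P.limU a b p q) (P.step b q (P.limU a b p q))
      (P.slope p (P.step b q (P.limU a b p q))) (P.slope q (P.limU a b p q)) := by
  have hlim := limU_adm (P := P) (a := a) (b := b) hp hq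
  have hlim' : Adm b (P.step b q (P.limU a b p q)) := hlim.step_adm hq
  refine ⟨(hlim'.slope_spec hp).2 T, (hlim.slope_spec hq).2 T, fun r hr => ?_, fun r hr => ?_⟩
  · rw [← step_step_limU hp hq, step, max_eq_left hr.1]
  · rw [step, max_eq_left hr.1]

/-- By uniqueness, iterating from v yields the same solution as iterating from u. Hence each
component is both a decreasing limit of iterates and an increasing limit of steps of the other
component's iterates. -/
theorem step_limU_eq (hp : 0 < p) (hq : 0 < q) (r : ℝ) :
    P.step b q (P.limU a b p q) r = P.limU b a q p r := by
  have h1 := (isSystemSol_limU (P := P) (a := a) (b := b) hp hq (max r 0)).unique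
    (isSystemSol_limU (P := P) (a := b) (b := a) hq hp (max r 0)).swap hp hq _ (max_mem_Icc r)
  have h2 : P.limU b a q p (max r 0) = P.limU b a q p r := by
    rw [← step_step_limU hq hp, ← step_step_limU hq hp]
    simp [step]
  rw [← h2, ← h1.2]
  simp [step]

theorem isSystemSol_limU_limU (hp : 0 < p) (hq : 0 < q) (T : ℝ) :
    P.IsSystemSol T a b p q (P.limU a b p q) (P.limU b a q p)
      (P.slope p (P.limU b a q p)) (P.slope q (P.limU a b p q)) := by
  have := isSystemSol_limU (P := P) (a := a) (b := b) hp hq T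
  rwa [show P.step b q (P.limU a b p q) = P.limU b a q p from funext (step_limU_eq hp hq)] at this

theorem limU_antitone (hp : 0 < p) (hq : 0 < q) : Antitone (P.limU a b p q) := fun r s h => by
  rw [← step_step_limU hp hq, ← step_step_limU hp hq]
  exact ((limU_adm hp hq).step_adm hq).step_antitone hp h

theorem iter_le_iter {b' : ℝ} (hp : 0 < p) (hq : 0 < q) (hb : b ≤ b') (n : ℕ) (r : ℝ) :
    P.iter a b' p q n r ≤ P.iter a b p q n r := by
  induction n generalizing r with
  | zero => exact le_rfl
  | succ n ih =>
    have h1 := iter_adm (P := P) (a := a) (b := b) hp hq n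
    have h2 := iter_adm (P := P) (a := a) (b := b') hp hq n
    refine (h1.step_adm (a := b) hq).step_le_step (h2.step_adm (a := b') hq) hp (fun s => ?_) r
    rw [step_eq_add b b']
    have := h2.step_le_step (P := P) (a := b') h1 hq ih s
    linarith

theorem limU_le_limU {b' : ℝ} (hp : 0 < p) (hq : 0 < q) (hb : b ≤ b') (r : ℝ) :
    P.limU a b' p q r ≤ P.limU a b p q r :=
  le_of_tendsto_of_tendsto' (tendsto_iter hp hq r) (tendsto_iter hp hq r)
    fun n => iter_le_iter hp hq hb n r

/-- Raising b lowers u, hence weakens the source of v, so v gains at least the increase of its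
initial value at every radius. -/
theorem limU_add_le {b' : ℝ} (hp : 0 < p) (hq : 0 < q) (hb : b ≤ b') (r : ℝ) :
    P.limU b a q p r + (b' - b) ≤ P.limU b' a q p r := by
  rw [← step_limU_eq hp hq, ← step_limU_eq hp hq, step_eq_add b b']
  have := (limU_adm (P := P) (a := a) (b := b') hp hq).step_le_step (P := P) (a := b')
    (limU_adm (P := P) (a := a) (b := b) hp hq) hq (limU_le_limU hp hq hb) r
  linarith

end

/-! ### Continuous dependence on exponents and initial values -/

section
variable {X : Type*} [TopologicalSpace X] {a b p q : X → ℝ}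

theorem continuous_slope {v : X → ℝ → ℝ} (hp : Continuous p) (hp0 : ∀ x, 0 < p x)
    (hv : Continuous fun z : X × ℝ => v z.1 z.2) (hadm : ∀ x, Adm (b x) (v x)) :
    Continuous fun z : X × ℝ => P.slope (p z.1) (v z.1) z.2 := by
  have hf : Continuous fun z : X × ℝ => posPow (p z.1) (v z.1 z.2) :=
    (hp.comp continuous_fst).posPow hv fun z => hp0 z.1
  rw [continuous_iff_continuousAt]
  rintro ⟨x₀, r₀⟩
  rw [ContinuousAt, Metric.tendsto_nhds]
  intro ε hε
  have hL : 0 < P.lip + 1 := by linarith [P.lip_nonneg]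
  have hε' : 0 < ε / 2 / (P.lip + 1) := by positivity
  have h1 : ∀ᶠ x in 𝓝 x₀, ∀ r ∈ Set.Icc 0 (|r₀| + 1),
      |posPow (p x) (v x r) - posPow (p x₀) (v x₀ r)| < ε / 2 / (P.lip + 1) := by
    refine isCompact_Icc.eventually_forall_of_forall_eventually fun r _ => ?_
    have h2 : Continuous fun z : X × ℝ =>
        |posPow (p z.1) (v z.1 z.2) - posPow (p x₀) (v x₀ z.2)| :=
      (hf.sub (hf.comp (continuous_const.prodMk continuous_snd))).abs
    refine h2.continuousAt.eventually (gt_mem_nhds ?_)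
    simpa using hε'
  have h2 : ∀ᶠ r in 𝓝 r₀, dist (P.slope (p x₀) (v x₀) r) (P.slope (p x₀) (v x₀) r₀) < ε / 2 :=
    Metric.tendsto_nhds.mp ((hadm x₀).slope_spec (hp0 x₀)).1.continuousAt _ (by positivity)
  have h3 : ∀ᶠ r in 𝓝 r₀, r < |r₀| + 1 := gt_mem_nhds (by linarith [le_abs_self r₀])
  filter_upwards [h1.prod_nhds (h2.and h3)] with z hz
  obtain ⟨hz1, hz2, hz3⟩ := hz
  have hm : max z.2 0 ∈ Set.Icc 0 (|r₀| + 1) := ⟨le_max_right _ _, max_le hz3.le (by positivity)⟩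
  have h4 := ((hadm z.1).slope_spec (P := P) (hp0 z.1)).2 (|r₀| + 1) |>.abs_sub_le
    (((hadm x₀).slope_spec (hp0 x₀)).2 (|r₀| + 1))
    ((hadm z.1).continuous_posPow (hp0 z.1)).continuousOn
    ((hadm x₀).continuous_posPow (hp0 x₀)).continuousOn hε'.le (fun r hr => (hz1 r hr).le) _ hm
  rw [slope_max, slope_max] at h4
  have h5 : P.lip * (ε / 2 / (P.lip + 1)) ≤ ε / 2 := by
    rw [mul_div_assoc', div_le_iff₀ hL]
    nlinarith
  calc dist (P.slope (p z.1) (v z.1) z.2) (P.slope (p x₀) (v x₀) r₀)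
      ≤ dist (P.slope (p z.1) (v z.1) z.2) (P.slope (p x₀) (v x₀) z.2) +
        dist (P.slope (p x₀) (v x₀) z.2) (P.slope (p x₀) (v x₀) r₀) := dist_triangle _ _ _
    _ < ε := by
      rw [Real.dist_eq]
      linarith

theorem continuous_step {v : X → ℝ → ℝ} (ha : Continuous a) (hp : Continuous p)
    (hp0 : ∀ x, 0 < p x) (hv : Continuous fun z : X × ℝ => v z.1 z.2)
    (hadm : ∀ x, Adm (b x) (v x)) :
    Continuous fun z : X × ℝ => P.step (a z.1) (p z.1) (v z.1) z.2 := by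
  have h1 := continuous_slope (P := P) hp hp0 hv hadm
  unfold step
  refine (ha.comp continuous_fst).sub ?_
  refine intervalIntegral.continuous_parametric_intervalIntegral_of_continuous
    (f := fun (z : X × ℝ) s => s * P.slope (p z.1) (v z.1) s) ?_ (by fun_prop)
  exact continuous_snd.mul (h1.comp (by fun_prop : Continuous fun w : (X × ℝ) × ℝ => (w.1.1, w.2)))

theorem continuous_iter (ha : Continuous a) (hb : Continuous b) (hp : Continuous p)
    (hq : Continuous q) (hp0 : ∀ x, 0 < p x) (hq0 : ∀ x, 0 < q x) (n : ℕ) :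
    Continuous fun z : X × ℝ => P.iter (a z.1) (b z.1) (p z.1) (q z.1) n z.2 := by
  induction n with
  | zero => exact ha.comp continuous_fst
  | succ n ih =>
    have hadm : ∀ x, Adm (a x) (P.iter (a x) (b x) (p x) (q x) n) :=
      fun x => iter_adm (hp0 x) (hq0 x) n
    have h1 : Continuous fun z : X × ℝ =>
        P.step (b z.1) (q z.1) (P.iter (a z.1) (b z.1) (p z.1) (q z.1) n) z.2 :=
      continuous_step (v := fun x => P.iter (a x) (b x) (p x) (q x) n) hb hq hq0 ih hadm
    exact continuous_step (b := b)
      (v := fun x => P.step (b x) (q x) (P.iter (a x) (b x) (p x) (q x) n)) ha hp hp0 h1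
      fun x => (hadm x).step_adm (hq0 x)

/-- Upper semicontinuity holds because the limit is an infimum of continuous iterates. By
`step_limU_eq` it is also a supremum of continuous functions, which gives lower semicontinuity; no
Lipschitz bound on the powers enters. -/
theorem continuous_limU (ha : Continuous a) (hb : Continuous b) (hp : Continuous p)
    (hq : Continuous q) (hp0 : ∀ x, 0 < p x) (hq0 : ∀ x, 0 < q x) (r : ℝ) :
    Continuous fun x => P.limU (a x) (b x) (p x) (q x) r := by
  have hpair : Continuous fun x : X => (x, r) := by fun_prop
  rw [continuous_iff_lower_upperSemicontinuous]
  constructor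
  · intro x c hc
    change c < P.limU (a x) (b x) (p x) (q x) r at hc
    rw [← step_limU_eq (hq0 x) (hp0 x)] at hc
    obtain ⟨n, hn⟩ := ((step_limU_tendsto (hq0 x) (hp0 x) r).eventually (lt_mem_nhds hc)).exists
    have h1 : Continuous fun x => P.step (a x) (p x) (P.iter (b x) (a x) (q x) (p x) n) r :=
      (continuous_step (P := P) (v := fun x => P.iter (b x) (a x) (q x) (p x) n) ha hp hp0
        (continuous_iter hb ha hq hp hq0 hp0 n)
        fun x => iter_adm (hq0 x) (hp0 x) n).comp hpair
    filter_upwards [h1.continuousAt.eventually (lt_mem_nhds hn)] with x' hx'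
    refine lt_of_lt_of_le hx' ?_
    change _ ≤ P.limU (a x') (b x') (p x') (q x') r
    rw [← step_limU_eq (hq0 x') (hp0 x')]
    refine (limU_adm (hq0 x') (hp0 x')).step_le_step (iter_adm (hq0 x') (hp0 x') n) (hp0 x')
      (fun s => ?_) r
    exact (iter_antitone (hq0 x') (hp0 x') s).le_of_tendsto (tendsto_iter (hq0 x') (hp0 x') s) n
  · intro x c hc
    obtain ⟨n, hn⟩ := ((tendsto_iter (hp0 x) (hq0 x) r).eventually (gt_mem_nhds hc)).exists
    have h1 : Continuous fun x => P.iter (a x) (b x) (p x) (q x) n r :=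
      (continuous_iter ha hb hp hq hp0 hq0 n).comp hpair
    filter_upwards [h1.continuousAt.eventually (gt_mem_nhds hn)] with x' hx'
    exact ((iter_antitone (hp0 x') (hq0 x') r).le_of_tendsto
      (tendsto_iter (hp0 x') (hq0 x') r) n).trans_lt hx'

end

end RadialParams

/-! ### Shooting and stability of simultaneous zeros -/

namespace RadialParams
variable {P : RadialParams}

theorem pow_mul_mean (f y : ℝ → ℝ) (r : ℝ) :
    r ^ (P.n + 1) * P.mean f y r = ∫ s in (0 : ℝ)..r, s ^ P.n * P.source (f s) (y s) := by
  have h := intervalIntegral.mul_integral_comp_mul_left (a := 0) (b := 1) (c := r)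
    (f := fun s => s ^ P.n * P.source (f s) (y s))
  rw [mul_zero, mul_one] at h
  rw [← h, mean, pow_succ, mul_comm (r ^ P.n), mul_assoc, ← intervalIntegral.integral_const_mul]
  congr 1
  refine intervalIntegral.integral_congr fun σ _ => ?_
  simp only [mul_pow]
  ring

theorem IsSol.eq_tau {T : ℝ} {f y : ℝ → ℝ} (h : P.IsSol T f y) (hT : 0 ≤ T) :
    y 0 = P.τ (f 0 - P.k * y 0) := by
  have h1 := h.eq 0 ⟨le_rfl, hT⟩
  simp only [mean, zero_mul, integral_weight, source] at h1
  have hn : (0 : ℝ) < P.n + 1 := by positivity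
  rw [eq_div_iff hn.ne'] at h1
  linarith

theorem τ_pos {t : ℝ} (ht : 0 < t) : 0 < P.τ t := by
  have := inv_pos.mpr P.s₁_pos
  rw [τ, biSlope, max_eq_left ht.le, max_eq_right (by linarith), mul_zero, sub_zero]
  positivity

/-- At the origin y = τ (f - k y), which excludes y(0) = 0 when f(0) > 0. Afterwards r^(n+1) y(r) is
a primitive of a nonnegative function, so positivity persists. -/
theorem IsSol.pos {T : ℝ} {f y : ℝ → ℝ} (h : P.IsSol T f y) (hf : ContinuousOn f (Set.Icc 0 T))
    (hf0 : ∀ r ∈ Set.Icc 0 T, 0 ≤ f r) (hf1 : 0 < f 0) : ∀ r ∈ Set.Icc 0 T, 0 < y r := by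
  intro r hr
  have hT : 0 ≤ T := hr.1.trans hr.2
  have h0T : (0 : ℝ) ∈ Set.Icc 0 T := ⟨le_rfl, hT⟩
  have hnn := h.nonneg hf hf0
  have hy0 : 0 < y 0 := by
    refine lt_of_le_of_ne (hnn 0 h0T) fun h0 => ?_
    have h1 := h.eq_tau hT
    rw [← h0, mul_zero, sub_zero] at h1
    exact (τ_pos hf1).ne h1
  rcases eq_or_lt_of_le hr.1 with h0 | h0
  · rwa [← h0]
  have hev : ∀ᶠ s in 𝓝[>] (0 : ℝ), 0 < y s := by
    have h1 := (h.cont 0 h0T).eventually (lt_mem_nhds hy0)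
    refine h1.filter_mono ?_
    rw [← nhdsWithin_Ioc_eq_nhdsGT (h0.trans_le hr.2)]
    exact nhdsWithin_mono _ Set.Ioc_subset_Icc_self
  obtain ⟨s, hs1, hs2⟩ := (hev.and (Ioo_mem_nhdsGT h0)).exists
  have hsT : s ∈ Set.Icc 0 T := ⟨hs2.1.le, hs2.2.le.trans hr.2⟩
  have hi : ∀ t ∈ Set.Icc 0 T, ∀ t' ∈ Set.Icc 0 T, IntervalIntegrable
      (fun s => s ^ P.n * P.source (f s) (y s)) MeasureTheory.volume t t' := fun t ht t' ht' =>
    ((continuousOn_pow _).mul (P.continuous_source.comp_continuousOn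
      (hf.prodMk h.cont)) |>.mono (Set.uIcc_subset_Icc ht ht')).intervalIntegrable
  have key : s ^ (P.n + 1) * y s ≤ r ^ (P.n + 1) * y r := by
    rw [h.eq s hsT, h.eq r hr, pow_mul_mean, pow_mul_mean,
      ← intervalIntegral.integral_add_adjacent_intervals (hi 0 h0T s hsT) (hi s hsT r hr)]
    have : 0 ≤ ∫ t in s..r, t ^ P.n * P.source (f t) (y t) :=
      intervalIntegral.integral_nonneg hs2.2.le fun t ht => by
        have htT : t ∈ Set.Icc 0 T := ⟨hsT.1.trans ht.1, ht.2.trans hr.2⟩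
        have := P.source_mono (hf0 t htT) (hnn t htT)
        rw [source_zero] at this
        exact mul_nonneg (pow_nonneg htT.1 _) this
    linarith
  have h3 : 0 < s ^ (P.n + 1) * y s := mul_pos (pow_pos hs2.1 _) hs1
  exact pos_of_mul_pos_right (h3.trans_le key) (pow_nonneg hr.1 _)

theorem IsSystemSol.v_zero {T a b p q : ℝ} {u v yu yv : ℝ → ℝ}
    (h : P.IsSystemSol T a b p q u v yu yv) (hT : 0 ≤ T) : v 0 = b := by
  simpa using h.eq_v 0 ⟨le_rfl, hT⟩

theorem IsSystemSol.strictAntiOn_u {T a b p q : ℝ} {u v yu yv : ℝ → ℝ}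
    (h : P.IsSystemSol T a b p q u v yu yv) (hp : 0 < p) (hb : 0 < b) :
    StrictAntiOn u (Set.Icc 0 T) := by
  intro r hr s hs hrs
  have hT : 0 ≤ T := hr.1.trans hr.2
  rw [← sub_pos, h.u_sub hr hs]
  refine intervalIntegral.intervalIntegral_pos_of_pos_on (intervalIntegrable_id_mul h.sol_u.cont hr hs)
    (fun t ht => mul_pos (hr.1.trans_lt ht.1) ?_) hrs
  refine h.sol_u.pos (h.swap.continuousOn_u.posPow hp) (fun r _ => posPow_nonneg _ _) ?_ t
    ⟨hr.1.trans ht.1.le, ht.2.le.trans hs.2⟩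
  simp only [h.v_zero hT]
  rw [posPow_of_nonneg hb.le]
  positivity

theorem limU_lt_limU {a b p q r s : ℝ} (hp : 0 < p) (hq : 0 < q) (hb : 0 < b) (hr : 0 ≤ r)
    (hrs : r < s) : P.limU a b p q s < P.limU a b p q r :=
  (isSystemSol_limU_limU hp hq s).strictAntiOn_u hp hb ⟨hr, hrs.le⟩ ⟨hr.trans hrs.le, le_rfl⟩ hrs

theorem limU_zero {a b p q : ℝ} (hp : 0 < p) (hq : 0 < q) : P.limU a b p q 0 = a :=
  (isSystemSol_limU_limU hp hq 0).swap.v_zero le_rfl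

variable (P) in
/-- The shooting problem with exponents `p, q` and value `a` of the first component at the origin
has a solution whose components vanish simultaneously. -/
def Hits (a p q : ℝ) : Prop :=
  ∃ b > 0, ∃ ρ > 0, P.limU a b p q ρ = 0 ∧ P.limU b a q p ρ = 0

/-- The values b for which v becomes negative while u is positive, and those with the roles
exchanged, form disjoint open sets, each meeting [b₁, b₂]. Connectedness yields a b in neither. By
`hneg` and monotonicity in b its u has a zero ρ; v cannot be positive just after ρ nor negative just
before it, so it vanishes there. -/
theorem hits_of_between {a b₁ b₂ T p q : ℝ} (hp : 0 < p) (hq : 0 < q) (ha : 0 < a) (hb₁ : 0 < b₁)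
    (hb : b₁ ≤ b₂) (hT : 0 ≤ T) (hneg : P.limU a b₁ p q T < 0)
    (h₁ : ∃ r, P.limU b₁ a q p r < 0 ∧ 0 < P.limU a b₁ p q r)
    (h₂ : ∃ r, P.limU a b₂ p q r < 0 ∧ 0 < P.limU b₂ a q p r) : P.Hits a p q := by
  have hcu : ∀ r, Continuous fun b => P.limU a b p q r := fun r =>
    continuous_limU continuous_const continuous_id continuous_const continuous_const
      (fun _ => hp) (fun _ => hq) r
  have hcv : ∀ r, Continuous fun b => P.limU b a q p r := fun r =>
    continuous_limU continuous_id continuous_const continuous_const continuous_const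
      (fun _ => hq) (fun _ => hp) r
  set D : Set ℝ := {b | ∃ r, P.limU b a q p r < 0 ∧ 0 < P.limU a b p q r} with hD
  set E : Set ℝ := {b | ∃ r, P.limU a b p q r < 0 ∧ 0 < P.limU b a q p r} with hE
  have hDo : IsOpen D := by
    rw [hD, Set.ofPred_exists]
    exact isOpen_iUnion fun r => (isOpen_lt (hcv r) continuous_const).inter
      (isOpen_lt continuous_const (hcu r))
  have hEo : IsOpen E := by
    rw [hE, Set.ofPred_exists]
    exact isOpen_iUnion fun r => (isOpen_lt (hcu r) continuous_const).inter
      (isOpen_lt continuous_const (hcv r))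
  obtain ⟨b, hbI, hbDE⟩ : ∃ b ∈ Set.Icc b₁ b₂, b ∉ D ∪ E := by
    by_contra! hcon
    obtain ⟨b, -, ⟨r, hr1, hr2⟩, ⟨s, hs1, hs2⟩⟩ := isPreconnected_Icc D E hDo hEo hcon
      ⟨b₁, ⟨le_rfl, hb⟩, h₁⟩ ⟨b₂, ⟨hb, le_rfl⟩, h₂⟩
    rcases le_total r s with h | h
    · linarith [limU_antitone (P := P) (a := b) (b := a) hq hp h]
    · linarith [limU_antitone (P := P) (a := a) (b := b) hp hq h]
  have hb0 : 0 < b := hb₁.trans_le hbI.1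
  have hbT : P.limU a b p q T < 0 := (limU_le_limU hp hq hbI.1 T).trans_lt hneg
  have hc1 : Continuous (P.limU a b p q) := (limU_adm hp hq).cont
  have hc2 : Continuous (P.limU b a q p) := (limU_adm hq hp).cont
  obtain ⟨ρ, hρ, hρ0⟩ := intermediate_value_Icc' hT hc1.continuousOn
    (show (0 : ℝ) ∈ Set.Icc _ _ from ⟨hbT.le, by rw [limU_zero hp hq]; exact ha.le⟩)
  have hρpos : 0 < ρ := by
    refine lt_of_le_of_ne hρ.1 fun h => ?_
    rw [← h, limU_zero hp hq] at hρ0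
    exact ha.ne' hρ0
  refine ⟨b, hb0, ρ, hρpos, hρ0, le_antisymm ?_ ?_⟩
  · refine le_of_tendsto (hc2.continuousAt.tendsto.mono_left (nhdsWithin_le_nhds (s := Set.Ioi ρ)))
      ?_
    filter_upwards [self_mem_nhdsWithin] with r hr
    by_contra! hcon
    refine hbDE (Or.inr ⟨r, ?_, hcon⟩)
    rw [← hρ0]
    exact limU_lt_limU hp hq hb0 hρ.1 hr
  · refine ge_of_tendsto (hc2.continuousAt.tendsto.mono_left (nhdsWithin_le_nhds (s := Set.Iio ρ)))
      ?_
    filter_upwards [Ioo_mem_nhdsLT hρpos] with r hr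
    by_contra! hcon
    refine hbDE (Or.inl ⟨r, hcon, ?_⟩)
    rw [← hρ0]
    exact limU_lt_limU hp hq hb0 hr.1.le hr.2

/-- Below b₀, v is already negative at R, hence slightly before R, where u is positive. For b₀ + 1,
v is still positive slightly after R, where u is negative. These strict inequalities persist for
nearby exponents and feed `hits_of_between`. -/
theorem Hits.eventually {a p₀ q₀ : ℝ} (hp₀ : 0 < p₀) (hq₀ : 0 < q₀) (ha : 0 < a)
    (h : P.Hits a p₀ q₀) : ∀ᶠ z in 𝓝 (p₀, q₀), P.Hits a z.1 z.2 := by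
  obtain ⟨b₀, hb₀, R, hR, hu0, hv0⟩ := h
  have hcu : Continuous fun b => P.limU a b p₀ q₀ (R + 1) :=
    continuous_limU continuous_const continuous_id continuous_const continuous_const
      (fun _ => hp₀) (fun _ => hq₀) _
  have hneg0 : P.limU a b₀ p₀ q₀ (R + 1) < 0 := by
    rw [← hu0]
    exact limU_lt_limU hp₀ hq₀ hb₀ hR.le (by linarith)
  -- Taking b₁ close to b₀ keeps u negative at R + 1 although lowering b raises u.
  obtain ⟨b₁, hneg, hb₁⟩ := (((hcu.continuousAt.eventually (gt_mem_nhds hneg0)).filter_mono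
    (nhdsWithin_le_nhds (s := Set.Iio b₀))).and (Ioo_mem_nhdsLT hb₀)).exists
  have hb₂ : b₀ < b₀ + 1 := by linarith
  obtain ⟨r₁, hr₁u, hr₁v⟩ : ∃ r, 0 < P.limU a b₁ p₀ q₀ r ∧ P.limU b₁ a q₀ p₀ r < 0 := by
    have h1 : P.limU b₁ a q₀ p₀ R < 0 := by
      have := limU_add_le (P := P) (a := a) hp₀ hq₀ hb₁.2.le R
      rw [hv0] at this
      linarith [hb₁.2]
    have hc : Continuous (P.limU b₁ a q₀ p₀) := (limU_adm hq₀ hp₀).cont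
    obtain ⟨r, hr1, hr2⟩ := (((hc.continuousAt.eventually (gt_mem_nhds h1)).filter_mono
      (nhdsWithin_le_nhds (s := Set.Iio R))).and (Ioo_mem_nhdsLT hR)).exists
    refine ⟨r, ?_, hr1⟩
    refine lt_of_lt_of_le ?_ (limU_le_limU hp₀ hq₀ hb₁.2.le r)
    rw [← hu0]
    exact limU_lt_limU hp₀ hq₀ hb₀ hr2.1.le hr2.2
  obtain ⟨r₂, hr₂u, hr₂v⟩ : ∃ r, P.limU a (b₀ + 1) p₀ q₀ r < 0 ∧
      0 < P.limU (b₀ + 1) a q₀ p₀ r := by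
    have h1 : 0 < P.limU (b₀ + 1) a q₀ p₀ R := by
      have := limU_add_le (P := P) (a := a) hp₀ hq₀ hb₂.le R
      rw [hv0] at this
      linarith
    have hc : Continuous (P.limU (b₀ + 1) a q₀ p₀) := (limU_adm hq₀ hp₀).cont
    obtain ⟨r, hr1, hr2⟩ := (((hc.continuousAt.eventually (lt_mem_nhds h1)).filter_mono
      (nhdsWithin_le_nhds (s := Set.Ioi R))).and self_mem_nhdsWithin).exists
    refine ⟨r, ?_, hr1⟩
    refine lt_of_le_of_lt (limU_le_limU hp₀ hq₀ hb₂.le r) ?_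
    rw [← hu0]
    exact limU_lt_limU hp₀ hq₀ hb₀ hR.le hr2
  -- `continuous_limU` asks for positive exponents on its whole parameter space, hence the open
  -- subtype.
  let Y := {z : ℝ × ℝ // 0 < z.1 ∧ 0 < z.2}
  have hYo : IsOpen {z : ℝ × ℝ | 0 < z.1 ∧ 0 < z.2} :=
    (isOpen_lt continuous_const continuous_fst).inter (isOpen_lt continuous_const continuous_snd)
  have hcu' : ∀ b r, Continuous fun z : Y => P.limU a b z.1.1 z.1.2 r := fun b r =>
    continuous_limU continuous_const continuous_const (by fun_prop) (by fun_prop)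
      (fun z => z.2.1) (fun z => z.2.2) r
  have hcv' : ∀ b r, Continuous fun z : Y => P.limU b a z.1.2 z.1.1 r := fun b r =>
    continuous_limU continuous_const continuous_const (by fun_prop) (by fun_prop)
      (fun z => z.2.2) (fun z => z.2.1) r
  have hev : ∀ᶠ z : Y in 𝓝 ⟨(p₀, q₀), hp₀, hq₀⟩, P.Hits a z.1.1 z.1.2 := by
    filter_upwards [(hcu' b₁ (R + 1)).continuousAt.eventually (gt_mem_nhds hneg),
      (hcu' b₁ r₁).continuousAt.eventually (lt_mem_nhds hr₁u),
      (hcv' b₁ r₁).continuousAt.eventually (gt_mem_nhds hr₁v),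
      (hcu' (b₀ + 1) r₂).continuousAt.eventually (gt_mem_nhds hr₂u),
      (hcv' (b₀ + 1) r₂).continuousAt.eventually (lt_mem_nhds hr₂v)] with z h1 h2 h3 h4 h5
    exact hits_of_between z.2.1 z.2.2 ha hb₁.1 (hb₁.2.trans hb₂).le (by linarith) h1
      ⟨r₁, h3, h2⟩ ⟨r₂, h4, h5⟩
  rw [← map_nhds_subtype_coe_eq_nhds (p := fun z : ℝ × ℝ => 0 < z.1 ∧ 0 < z.2) ⟨hp₀, hq₀⟩
    (hYo.mem_nhds ⟨hp₀, hq₀⟩)]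
  exact hev

theorem IsSol.scale {T c t : ℝ} {f y : ℝ → ℝ} (h : P.IsSol T f y) (ht : 0 < t) (hc : 0 ≤ c) :
    P.IsSol (T / t) (fun r => c * f (t * r)) (fun r => c * y (t * r)) := by
  have hmaps : Set.MapsTo (fun r => t * r) (Set.Icc 0 (T / t)) (Set.Icc 0 T) := fun r hr =>
    ⟨mul_nonneg ht.le hr.1, by
      have := (le_div_iff₀ ht).mp hr.2
      linarith⟩
  refine ⟨continuousOn_const.mul (h.cont.comp (by fun_prop) hmaps), fun r hr => ?_⟩
  rw [h.eq _ (hmaps hr), mean, mean, ← intervalIntegral.integral_const_mul]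
  refine intervalIntegral.integral_congr fun σ _ => ?_
  simp only [source_smul _ hc, mul_assoc]
  ring

theorem IsSystemSol.scale {T a b p q t α β : ℝ} {u v yu yv : ℝ → ℝ}
    (h : P.IsSystemSol T a b p q u v yu yv) (ht : 0 < t) (hα : α + 2 = β * p)
    (hβ : β + 2 = α * q) :
    P.IsSystemSol (T / t) (t ^ α * a) (t ^ β * b) p q (fun r => t ^ α * u (t * r))
      (fun r => t ^ β * v (t * r)) (fun r => t ^ (α + 2) * yu (t * r))
      (fun r => t ^ (β + 2) * yv (t * r)) := by
  have hpow : ∀ γ δ e x : ℝ, δ = γ * e → t ^ δ * posPow e x = posPow e (t ^ γ * x) :=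
    fun γ δ e x hδ => by
      have h0 : 0 ≤ t ^ γ := (Real.rpow_pos_of_pos ht _).le
      have : max (t ^ γ * x) 0 = t ^ γ * max x 0 := by rw [mul_max_of_nonneg _ _ h0, mul_zero]
      rw [posPow, posPow, this, Real.mul_rpow h0 (le_max_right _ _), ← Real.rpow_mul ht.le, hδ]
  have hint : ∀ (γ c r : ℝ) (w y : ℝ → ℝ), w (t * r) = c - (∫ s in (0 : ℝ)..t * r, s * y s) →
      t ^ γ * w (t * r) =
        t ^ γ * c - ∫ s in (0 : ℝ)..r, s * (t ^ (γ + 2) * y (t * s)) := fun γ c r w y hw => by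
    have h1 := intervalIntegral.mul_integral_comp_mul_left (a := 0) (b := r) (c := t)
      (f := fun s => s * y s)
    rw [mul_zero] at h1
    rw [hw, ← h1, mul_sub, ← intervalIntegral.integral_const_mul,
      ← intervalIntegral.integral_const_mul]
    congr 1
    refine intervalIntegral.integral_congr fun s _ => ?_
    simp only [Real.rpow_add ht, Real.rpow_two]
    ring
  have hmaps : ∀ r ∈ Set.Icc 0 (T / t), t * r ∈ Set.Icc 0 T := fun r hr =>
    ⟨mul_nonneg ht.le hr.1, by
      have := (le_div_iff₀ ht).mp hr.2
      linarith⟩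
  refine ⟨?_, ?_, fun r hr => hint α a r u yu (h.eq_u _ (hmaps r hr)),
    fun r hr => hint β b r v yv (h.eq_v _ (hmaps r hr))⟩
  · simpa only [hpow β (α + 2) p _ hα] using
      h.sol_u.scale (c := t ^ (α + 2)) ht (Real.rpow_pos_of_pos ht _).le
  · simpa only [hpow α (β + 2) q _ hβ] using
      h.sol_v.scale (c := t ^ (β + 2)) ht (Real.rpow_pos_of_pos ht _).le

variable (P) in
/-- The radial system has a positive solution on `[0, R)` vanishing at `R`. -/
def RadiallySolvable (R p q : ℝ) : Prop :=
  ∃ (a b : ℝ) (u v yu yv : ℝ → ℝ), P.IsSystemSol R a b p q u v yu yv ∧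
    (∀ r ∈ Set.Ico 0 R, 0 < u r ∧ 0 < v r) ∧ u R = 0 ∧ v R = 0

/-- The dilation by ρ / R moves the common zero to R. The exponents solve α + 2 = β p and β + 2 = α
q, a linear system with determinant governed by p q - 1 ≠ 0. -/
theorem Hits.radiallySolvable {a p q R : ℝ} (hp : 0 < p) (hq : 0 < q) (hpq : 1 < p * q)
    (ha : 0 < a) (hR : 0 < R) (h : P.Hits a p q) : P.RadiallySolvable R p q := by
  obtain ⟨b, hb, ρ, hρ, hu, hv⟩ := h
  have hpq' : p * q - 1 ≠ 0 := by linarith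
  have ht : 0 < ρ / R := div_pos hρ hR
  have h1 := (isSystemSol_limU_limU (P := P) (a := a) (b := b) hp hq ρ).scale ht
    (α := 2 * (p + 1) / (p * q - 1)) (β := 2 * (q + 1) / (p * q - 1))
    (by rw [div_add' _ _ _ hpq', div_mul_eq_mul_div]; congr 1; ring)
    (by rw [div_add' _ _ _ hpq', div_mul_eq_mul_div]; congr 1; ring)
  have hR' : ρ / (ρ / R) = R := by field_simp
  have hR'' : ρ / R * R = ρ := by field_simp
  rw [hR'] at h1
  refine ⟨_, _, _, _, _, _, h1, fun r hr => ?_, ?_, ?_⟩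
  · have h2 : ρ / R * r < ρ := by
      rw [div_mul_eq_mul_div, div_lt_iff₀ hR]
      exact mul_lt_mul_of_pos_left hr.2 hρ
    have h3 : 0 ≤ ρ / R * r := mul_nonneg ht.le hr.1
    refine ⟨mul_pos (Real.rpow_pos_of_pos ht _) ?_, mul_pos (Real.rpow_pos_of_pos ht _) ?_⟩
    · rw [← hu]
      exact limU_lt_limU hp hq hb h3 h2
    · rw [← hv]
      exact limU_lt_limU hq hp ha h3 h2
  · simp only [hR'', hu, mul_zero]
  · simp only [hR'', hv, mul_zero]

end RadialParams

/-! ### Regularity and Hessians of radial functions -/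

section
variable {N : ℕ}

theorem hasFDerivAt_norm_of_ne_zero {x : EuclideanSpace ℝ (Fin N)} (hx : x ≠ 0) :
    HasFDerivAt (fun y : EuclideanSpace ℝ (Fin N) => ‖y‖) (‖x‖⁻¹ • innerSL ℝ x) x := by
  have h0 : ‖x‖ ≠ 0 := norm_ne_zero_iff.mpr hx
  have h := ((hasStrictFDerivAt_norm_sq x).hasFDerivAt).sqrt (pow_ne_zero 2 h0)
  simp only [Real.sqrt_sq (norm_nonneg _)] at h
  refine h.congr_fderiv ?_
  ext z
  simp
  field_simp

theorem hasFDerivAt_comp_norm {U : ℝ → ℝ} {c : ℝ} {x : EuclideanSpace ℝ (Fin N)} (hx : x ≠ 0)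
    (h : HasDerivAt U (‖x‖ * c) ‖x‖) :
    HasFDerivAt (fun y : EuclideanSpace ℝ (Fin N) => U ‖y‖) (innerSL ℝ (c • x)) x := by
  have h0 : ‖x‖ ≠ 0 := norm_ne_zero_iff.mpr hx
  refine (h.comp_hasFDerivAt x (hasFDerivAt_norm_of_ne_zero hx)).congr_fderiv ?_
  ext z
  simp
  field_simp

theorem hasFDerivAt_comp_norm_zero {U : ℝ → ℝ} (h : HasDerivWithinAt U 0 (Set.Ici 0) 0) :
    HasFDerivAt (fun y : EuclideanSpace ℝ (Fin N) => U ‖y‖)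
      (0 : EuclideanSpace ℝ (Fin N) →L[ℝ] ℝ) 0 := by
  have h1 := hasDerivWithinAt_iff_isLittleO.mp h
  have h2 : Tendsto (fun y : EuclideanSpace ℝ (Fin N) => ‖y‖) (𝓝 0) (𝓝[Set.Ici 0] 0) :=
    tendsto_nhdsWithin_iff.mpr ⟨by simpa using continuous_norm.tendsto (0 : EuclideanSpace ℝ (Fin N)),
      Eventually.of_forall fun y => norm_nonneg y⟩
  have h3 := h1.comp_tendsto h2
  rw [hasFDerivAt_iff_isLittleO]
  refine Asymptotics.IsLittleO.of_norm_right ?_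
  simpa [Function.comp_def] using h3

theorem hasFDerivAt_norm_smul {g : ℝ → ℝ} {d : ℝ} {x : EuclideanSpace ℝ (Fin N)} (hx : x ≠ 0)
    (h : HasDerivAt g d ‖x‖) :
    HasFDerivAt (fun y : EuclideanSpace ℝ (Fin N) => g ‖y‖ • y)
      (g ‖x‖ • ContinuousLinearMap.id ℝ _ + (d / ‖x‖) • (innerSL ℝ x).smulRight x) x := by
  refine ((h.comp_hasFDerivAt x (hasFDerivAt_norm_of_ne_zero hx)).smul
    (hasFDerivAt_id x)).congr_fderiv ?_
  ext1 z
  simp [smul_smul, div_eq_mul_inv, mul_assoc]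

theorem hasFDerivAt_norm_smul_zero {g : ℝ → ℝ} (h : ContinuousWithinAt g (Set.Ici 0) 0) :
    HasFDerivAt (fun y : EuclideanSpace ℝ (Fin N) => g ‖y‖ • y)
      (g 0 • ContinuousLinearMap.id ℝ _) 0 := by
  have h2 : Tendsto (fun y : EuclideanSpace ℝ (Fin N) => ‖y‖) (𝓝 0) (𝓝[Set.Ici 0] 0) :=
    tendsto_nhdsWithin_iff.mpr ⟨by simpa using continuous_norm.tendsto (0 : EuclideanSpace ℝ (Fin N)),
      Eventually.of_forall fun y => norm_nonneg y⟩
  have h3 : (fun y : EuclideanSpace ℝ (Fin N) => g ‖y‖ - g 0) =o[𝓝 0] fun _ => (1 : ℝ) := by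
    rw [Asymptotics.isLittleO_one_iff, tendsto_sub_nhds_zero_iff]
    exact h.tendsto.comp h2
  have h4 := h3.smul_isBigO (Asymptotics.isBigO_refl (fun y : EuclideanSpace ℝ (Fin N) => y) (𝓝 0))
  rw [hasFDerivAt_iff_isLittleO]
  simpa [sub_smul] using h4

theorem matrix_of_smul_id_add (c d : ℝ) (x : EuclideanSpace ℝ (Fin N)) :
    (Matrix.of fun i j => (c • ContinuousLinearMap.id ℝ (EuclideanSpace ℝ (Fin N)) +
      d • (innerSL ℝ x).smulRight x) (EuclideanSpace.single i 1) j) =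
      c • (1 : Matrix (Fin N) (Fin N) ℝ) + d • vecMulVec x x := by
  ext i j
  simp [vecMulVec, EuclideanSpace.inner_single_right, Matrix.one_apply, eq_comm (a := i)]

theorem IsPucciType.apply_add_smul {lam Lam s₁ s₂ : ℝ} {F : Matrix (Fin N) (Fin N) ℝ → ℝ}
    (hF : IsPucciType lam Lam s₁ s₂ F) (hN : 1 ≤ N) (m c : ℝ) (x : EuclideanSpace ℝ (Fin N)) :
    F (m • (1 : Matrix (Fin N) (Fin N) ℝ) + c • vecMulVec x x) =
      biSlope s₁ s₂ (m + c * ‖x‖ ^ 2) + (N - 1) * biSlope s₁ s₂ m := by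
  rcases eq_or_ne x 0 with rfl | hx
  · have h1 := hF.radial (Pi.single (⟨0, hN⟩ : Fin N) 1) m m (by simp)
    simp only [sub_self, zero_smul, add_zero] at h1
    have h2 : vecMulVec ((0 : EuclideanSpace ℝ (Fin N)) : Fin N → ℝ)
        (0 : EuclideanSpace ℝ (Fin N)) = 0 := by
      ext i j
      simp [vecMulVec]
    simpa [h2] using h1
  · have h0 : ‖x‖ ≠ 0 := norm_ne_zero_iff.mpr hx
    have h1 := hF.radial (‖x‖⁻¹ • x : EuclideanSpace ℝ (Fin N)) (m + c * ‖x‖ ^ 2) m (by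
      rw [EuclideanSpace.dotProduct_self, norm_smul]
      simp [h0])
    rw [← h1]
    congr 2
    ext i j
    simp [vecMulVec]
    field_simp

theorem contDiffOn_succ_of_hasFDerivAt {E F : Type*} [NormedAddCommGroup E] [NormedSpace ℝ E]
    [NormedAddCommGroup F] [NormedSpace ℝ F] {f : E → F} {f' : E → E →L[ℝ] F} {s : Set E} {n : ℕ}
    (hs : IsOpen s) (h : ∀ x ∈ s, HasFDerivAt f (f' x) x) (hc : ContDiffOn ℝ n f' s) :
    ContDiffOn ℝ (n + 1) f s :=
  (contDiffOn_succ_iff_fderiv_of_isOpen hs).mpr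
    ⟨fun x hx => (h x hx).differentiableAt.differentiableWithinAt, by simp,
      hc.congr fun x hx => (h x hx).fderiv⟩

/-- With g = U' / r the gradient is g(|x|) x, which avoids differentiating the norm at the origin.
Its derivative contains z(|x|) x xᵀ / |x|², where z = r g', and this term is continuous at 0 because
z(0) = 0. -/
theorem contDiffOn_comp_norm {U g z : ℝ → ℝ} {R : ℝ} (hR : 0 < R)
    (hg : ContinuousOn g (Set.Ico 0 R)) (hz : ContinuousOn z (Set.Ico 0 R)) (hz0 : z 0 = 0)
    (hU0 : HasDerivWithinAt U 0 (Set.Ici 0) 0)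
    (hU : ∀ r ∈ Set.Ioo 0 R, HasDerivAt U (r * g r) r)
    (hg' : ∀ r ∈ Set.Ioo 0 R, HasDerivAt g (z r / r) r) :
    ContDiffOn ℝ 2 (fun x : EuclideanSpace ℝ (Fin N) => U ‖x‖) (Metric.ball 0 R) ∧
      ∀ x ∈ Metric.ball (0 : EuclideanSpace ℝ (Fin N)) R,
        hessianMatrix (fun x => U ‖x‖) x =
          g ‖x‖ • (1 : Matrix (Fin N) (Fin N) ℝ) + (z ‖x‖ / ‖x‖ ^ 2) • vecMulVec x x := by
  have hio : Set.Ico 0 R ∈ 𝓝[Set.Ici 0] (0 : ℝ) := by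
    rw [← Set.Ici_inter_Iio]
    exact inter_mem_nhdsWithin _ (Iio_mem_nhds hR)
  have hmaps : Set.MapsTo (fun x : EuclideanSpace ℝ (Fin N) => ‖x‖) (Metric.ball 0 R)
      (Set.Ico 0 R) := fun x hx => ⟨norm_nonneg x, by simpa using hx⟩
  have hioo : ∀ x ∈ Metric.ball (0 : EuclideanSpace ℝ (Fin N)) R, x ≠ 0 → ‖x‖ ∈ Set.Ioo 0 R :=
    fun x hx hx0 => ⟨norm_pos_iff.mpr hx0, by simpa using hx⟩
  have h1 : ∀ x ∈ Metric.ball (0 : EuclideanSpace ℝ (Fin N)) R,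
      HasFDerivAt (fun x => U ‖x‖) (innerSL ℝ (g ‖x‖ • x)) x := fun x hx => by
    rcases eq_or_ne x 0 with rfl | hx0
    · simpa using hasFDerivAt_comp_norm_zero hU0
    · exact hasFDerivAt_comp_norm hx0 (hU _ (hioo x hx hx0))
  have h2 : ∀ x ∈ Metric.ball (0 : EuclideanSpace ℝ (Fin N)) R,
      HasFDerivAt (fun x => g ‖x‖ • x) (g ‖x‖ • ContinuousLinearMap.id ℝ _ +
        (z ‖x‖ / ‖x‖ ^ 2) • (innerSL ℝ x).smulRight x) x := fun x hx => by
    rcases eq_or_ne x 0 with rfl | hx0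
    · simpa using hasFDerivAt_norm_smul_zero ((hg 0 ⟨le_rfl, hR⟩).mono_of_mem_nhdsWithin hio)
    · rw [sq, ← div_div]
      exact hasFDerivAt_norm_smul hx0 (hg' _ (hioo x hx hx0))
  have hzc : ContinuousOn (fun x : EuclideanSpace ℝ (Fin N) => z ‖x‖) (Metric.ball 0 R) :=
    hz.comp continuous_norm.continuousOn hmaps
  have h3 : ContinuousOn (fun x : EuclideanSpace ℝ (Fin N) =>
      (z ‖x‖ / ‖x‖ ^ 2) • (innerSL ℝ x).smulRight x) (Metric.ball 0 R) := by
    have hs : Continuous fun x : EuclideanSpace ℝ (Fin N) => (innerSL ℝ x).smulRight x :=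
      (ContinuousLinearMap.smulRightL ℝ (EuclideanSpace ℝ (Fin N))
        (EuclideanSpace ℝ (Fin N))).continuous₂.comp
          ((innerSL ℝ).continuous.prodMk continuous_id)
    intro x hx
    rcases eq_or_ne x 0 with rfl | hx0
    · have h4 := (hzc 0 hx).norm
      refine (squeeze_zero_norm (fun y => ?_) (by simpa [ContinuousWithinAt, hz0] using h4)).trans ?_
      · rw [norm_smul, ContinuousLinearMap.norm_smulRight_apply, innerSL_apply_norm]
        rcases eq_or_ne y 0 with rfl | hy0
        · simp
        · have h0 : ‖y‖ ≠ 0 := norm_ne_zero_iff.mpr hy0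
          rw [norm_div, norm_pow, norm_norm]
          field_simp
          exact le_rfl
      · simp
    · exact ((hzc x hx).div (continuous_norm.pow 2).continuousWithinAt
        (pow_ne_zero 2 (norm_ne_zero_iff.mpr hx0))).smul hs.continuousWithinAt
  have hgc : ContinuousOn (fun x : EuclideanSpace ℝ (Fin N) => g ‖x‖) (Metric.ball 0 R) :=
    hg.comp continuous_norm.continuousOn hmaps
  constructor
  · have h5 := contDiffOn_succ_of_hasFDerivAt (n := 0) Metric.isOpen_ball h2
      (contDiffOn_zero.mpr ((hgc.smul continuousOn_const).add h3))
    have h6 := contDiffOn_succ_of_hasFDerivAt (n := 1) Metric.isOpen_ball h1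
      ((innerSL ℝ).contDiff.comp_contDiffOn (by simpa using h5))
    simpa [one_add_one_eq_two] using h6
  · intro x hx
    rw [hessianMatrix_of_gradient (G := fun x => g ‖x‖ • x) ?_ (h2 x hx), matrix_of_smul_id_add]
    filter_upwards [Metric.isOpen_ball.mem_nhds hx] with y hy using h1 y hy

end

/-! ### From radial profiles to classical solutions -/

namespace RadialParams
variable {P : RadialParams}

theorem IsSol.hasDerivAt {T r : ℝ} {f y : ℝ → ℝ} (h : P.IsSol T f y)
    (hf : ContinuousOn f (Set.Icc 0 T)) (hr : r ∈ Set.Ioo 0 T) :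
    HasDerivAt y ((P.τ (f r - P.k * y r) - y r) / r) r := by
  have hrI : Set.Icc 0 T ∈ 𝓝 r := Icc_mem_nhds hr.1 hr.2
  have hsrc : ContinuousOn (fun s => s ^ P.n * P.source (f s) (y s)) (Set.Icc 0 T) :=
    (continuousOn_pow _).mul (P.continuous_source.comp_continuousOn (hf.prodMk h.cont))
  have h1 : HasDerivAt (fun r => ∫ s in (0 : ℝ)..r, s ^ P.n * P.source (f s) (y s))
      (r ^ P.n * P.source (f r) (y r)) r := by
    refine intervalIntegral.integral_hasDerivAt_right ?_ ?_ (hsrc.continuousAt hrI)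
    · refine (hsrc.mono ?_).intervalIntegrable
      rw [Set.uIcc_of_le hr.1.le]
      exact Set.Icc_subset_Icc_right hr.2.le
    · exact (hsrc.mono Set.Ioo_subset_Icc_self).stronglyMeasurableAtFilter isOpen_Ioo r hr
  have h2 := h1.div (hasDerivAt_pow (P.n + 1) r) (pow_ne_zero _ hr.1.ne')
  have h3 : y =ᶠ[𝓝 r]
      fun r => (∫ s in (0 : ℝ)..r, s ^ P.n * P.source (f s) (y s)) / r ^ (P.n + 1) := by
    filter_upwards [Ioo_mem_nhds hr.1 hr.2] with t ht
    rw [eq_div_iff (pow_ne_zero _ ht.1.ne'), mul_comm, ← pow_mul_mean,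
      ← h.eq t (Set.Ioo_subset_Icc_self ht)]
  refine (h2.congr_of_eventuallyEq h3).congr_deriv ?_
  have hr0 : r ≠ 0 := hr.1.ne'
  rw [← pow_mul_mean, ← h.eq r (Set.Ioo_subset_Icc_self hr), source]
  push_cast
  field_simp
  ring

theorem IsSystemSol.hasDerivAt_u {T a b p q r : ℝ} {u v yu yv : ℝ → ℝ}
    (h : P.IsSystemSol T a b p q u v yu yv) (hr : r ∈ Set.Ioo 0 T) :
    HasDerivAt u (r * -yu r) r := by
  have hc : ContinuousOn (fun s => s * yu s) (Set.Icc 0 T) := continuousOn_id.mul h.sol_u.cont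
  have h1 : HasDerivAt (fun r => ∫ s in (0 : ℝ)..r, s * yu s) (r * yu r) r := by
    refine intervalIntegral.integral_hasDerivAt_right ?_ ?_ (hc.continuousAt (Icc_mem_nhds hr.1 hr.2))
    · exact intervalIntegrable_id_mul h.sol_u.cont ⟨le_rfl, (hr.1.trans hr.2).le⟩
        (Set.Ioo_subset_Icc_self hr)
    · exact (hc.mono Set.Ioo_subset_Icc_self).stronglyMeasurableAtFilter isOpen_Ioo r hr
  refine ((h1.const_sub a).congr_of_eventuallyEq ?_).congr_deriv (by ring)
  filter_upwards [Icc_mem_nhds hr.1 hr.2] with t ht using h.eq_u t ht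

theorem IsSystemSol.hasDerivWithinAt_u_zero {T a b p q : ℝ} {u v yu yv : ℝ → ℝ}
    (h : P.IsSystemSol T a b p q u v yu yv) (hT : 0 < T) :
    HasDerivWithinAt u 0 (Set.Ici 0) 0 := by
  have h0 : Set.Icc 0 T ∈ 𝓝[Set.Ici 0] (0 : ℝ) := by
    rw [← Set.Ici_inter_Iic]
    exact inter_mem_nhdsWithin _ (Iic_mem_nhds hT)
  have hc : ContinuousOn (fun s => s * yu s) (Set.Icc 0 T) := continuousOn_id.mul h.sol_u.cont
  have h1 : HasDerivWithinAt (fun r => ∫ s in (0 : ℝ)..r, s * yu s) (0 * yu 0) (Set.Ici 0) 0 := by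
    refine intervalIntegral.integral_hasDerivWithinAt_right (t := Set.Ioi 0) (by simp) ?_ ?_
    · refine ⟨Set.Ioc 0 T, Ioc_mem_nhdsGT hT, ?_⟩
      exact (hc.mono Set.Ioc_subset_Icc_self).aestronglyMeasurable measurableSet_Ioc
    · refine (hc 0 ⟨le_rfl, hT.le⟩).mono_of_mem_nhdsWithin ?_
      exact nhdsWithin_mono _ Set.Ioi_subset_Ici_self h0
  refine ((h1.const_sub a).congr_of_eventuallyEq ?_ ?_).congr_deriv (by ring)
  · filter_upwards [h0] with t ht using h.eq_u t ht
  · exact h.eq_u 0 ⟨le_rfl, hT.le⟩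

end RadialParams

open RadialParams

section
variable {N : ℕ} {P : RadialParams} {lam Lam : ℝ} {F : Matrix (Fin N) (Fin N) ℝ → ℝ}

/-- The Hessian has tangential eigenvalue -yu and radial eigenvalue -τ (v ^ p - k yu). As yu ≥ 0,
the tangential part contributes -(N - 1) s₁ yu = -k yu, and `biSlope_neg_inv` turns the radial part
into -(v ^ p - k yu). -/
theorem RadialParams.IsSystemSol.comp_norm (hF : IsPucciType lam Lam P.s₁ P.s₂ F) (hN : 1 ≤ N)
    (hk : P.k = (N - 1) * P.s₁) {R a b p q : ℝ} {u v yu yv : ℝ → ℝ} (hR : 0 < R)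
    (h : P.IsSystemSol R a b p q u v yu yv) (hp : 0 < p) (hv : ∀ r ∈ Set.Ico 0 R, 0 < v r) :
    ContDiffOn ℝ 2 (fun x : EuclideanSpace ℝ (Fin N) => u ‖x‖) (Metric.ball 0 R) ∧
      ∀ x ∈ Metric.ball (0 : EuclideanSpace ℝ (Fin N)) R,
        F (hessianMatrix (fun x => u ‖x‖) x) + v ‖x‖ ^ p = 0 := by
  have hf := h.swap.continuousOn_u.posPow hp
  have hz0 : -(P.τ (posPow p (v 0) - P.k * yu 0) - yu 0) = 0 := by
    rw [← h.sol_u.eq_tau hR.le, sub_self, neg_zero]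
  have hz : ContinuousOn (fun r => -(P.τ (posPow p (v r) - P.k * yu r) - yu r)) (Set.Icc 0 R) :=
    ((P.continuous_τ.comp_continuousOn (hf.sub (continuousOn_const.mul h.sol_u.cont))).sub
      h.sol_u.cont).neg
  obtain ⟨h1, h2⟩ := contDiffOn_comp_norm (N := N) hR
    (h.sol_u.cont.neg.mono Set.Ico_subset_Icc_self)
    (hz.mono Set.Ico_subset_Icc_self) hz0 (h.hasDerivWithinAt_u_zero hR)
    (fun r hr => h.hasDerivAt_u hr)
    (fun r hr => (h.sol_u.hasDerivAt hf hr).neg.congr_deriv (by ring))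
  refine ⟨h1, fun x hx => ?_⟩
  have hxI : ‖x‖ ∈ Set.Ico 0 R := ⟨norm_nonneg x, by simpa using hx⟩
  have hz' : -(P.τ (posPow p (v ‖x‖) - P.k * yu ‖x‖) - yu ‖x‖) / ‖x‖ ^ 2 * ‖x‖ ^ 2 =
      -(P.τ (posPow p (v ‖x‖) - P.k * yu ‖x‖) - yu ‖x‖) := by
    rcases eq_or_ne ‖x‖ 0 with h0 | h0
    · rw [h0, hz0]
      simp
    · field_simp
  have hy := h.yu_nonneg hp ‖x‖ (Set.Ico_subset_Icc_self hxI)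
  have hb : biSlope P.s₁ P.s₂ (-yu ‖x‖) = -(P.s₁ * yu ‖x‖) := by
    rw [biSlope, neg_neg, max_eq_left hy, max_eq_right (by linarith)]
    ring
  rw [h2 x hx, hF.apply_add_smul hN, hz', Pi.neg_apply, hb, ← posPow_of_nonneg (hv _ hxI).le,
    show -yu ‖x‖ + -(P.τ (posPow p (v ‖x‖) - P.k * yu ‖x‖) - yu ‖x‖) =
      -P.τ (posPow p (v ‖x‖) - P.k * yu ‖x‖) by ring, τ, biSlope_neg_inv P.s₁_pos P.s₂_pos, hk]
  ring

theorem RadialParams.RadiallySolvable.exists_solution (hF : IsPucciType lam Lam P.s₁ P.s₂ F)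
    (hN : 1 ≤ N) (hk : P.k = (N - 1) * P.s₁) {R p q : ℝ} (hR : 0 < R) (hp : 0 < p) (hq : 0 < q)
    (h : P.RadiallySolvable R p q) :
    ∃ u v : EuclideanSpace ℝ (Fin N) → ℝ, IsBallDirichletSolution F p q R u v := by
  obtain ⟨a, b, u, v, yu, yv, h, hpos, hu, hv⟩ := h
  have hI : ∀ x ∈ Metric.ball (0 : EuclideanSpace ℝ (Fin N)) R, ‖x‖ ∈ Set.Ico 0 R := fun x hx =>
    ⟨norm_nonneg x, by simpa using hx⟩
  have hmaps : Set.MapsTo (fun x : EuclideanSpace ℝ (Fin N) => ‖x‖) (Metric.closedBall 0 R)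
      (Set.Icc 0 R) := fun x hx => ⟨norm_nonneg x, by simpa using hx⟩
  have hu' := h.comp_norm hF hN hk hR hp fun r hr => (hpos r hr).2
  have hv' := h.swap.comp_norm hF hN hk hR hq fun r hr => (hpos r hr).1
  exact ⟨fun x => u ‖x‖, fun x => v ‖x‖,
    { contDiffOn_u := hu'.1
      contDiffOn_v := hv'.1
      continuousOn_u := h.continuousOn_u.comp continuous_norm.continuousOn hmaps
      continuousOn_v := h.swap.continuousOn_u.comp continuous_norm.continuousOn hmaps
      pos_u := fun x hx => (hpos _ (hI x hx)).1
      pos_v := fun x hx => (hpos _ (hI x hx)).2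
      eq_u := hu'.2
      eq_v := hv'.2
      boundary_u := fun x hx => by
        have : ‖x‖ = R := by simpa using hx
        rw [this, hu]
      boundary_v := fun x hx => by
        have : ‖x‖ = R := by simpa using hx
        rw [this, hv] }⟩

end

/-! ### From classical solutions to the shooting problem -/

section
variable {N : ℕ} {P : RadialParams} {lam Lam : ℝ} {F : Matrix (Fin N) (Fin N) ℝ → ℝ}

theorem neg_tau_eq (P : RadialParams) {s t : ℝ} (h : biSlope P.s₁ P.s₂ t = -s) : t = -P.τ s := by
  have := biSlope_neg_inv (inv_pos.mpr P.s₂_pos) (inv_pos.mpr P.s₁_pos) t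
  rw [inv_inv, inv_inv, h, neg_neg] at this
  rw [RadialParams.τ, this, neg_neg]

namespace RadialParams

/-- If `y = -D / r` and `D' = -τ (f - k y)`, then `y` solves the integral equation. -/
theorem isSol_neg_dslope {R T : ℝ} {f D D' : ℝ → ℝ} (hT : T < R) (hR : 0 < R)
    (hf : ContinuousOn f (Set.Ioo (-R) R))
    (hD : ∀ r ∈ Set.Ioo (-R) R, HasDerivAt D (D' r) r) (hD' : ContinuousOn D' (Set.Ioo (-R) R))
    (hD0 : D 0 = 0)
    (heq : ∀ r ∈ Set.Ioo 0 R, D' r = -P.τ (f r - P.k * -dslope D 0 r)) :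
    P.IsSol T f fun r => -dslope D 0 r := by
  have hsub : Set.Icc 0 T ⊆ Set.Ioo (-R) R := fun r hr => ⟨by linarith [hr.1], hr.2.trans_lt hT⟩
  have h0 : (0 : ℝ) ∈ Set.Ioo (-R) R := ⟨by linarith, hR⟩
  have hcont : ContinuousOn (fun r => -dslope D 0 r) (Set.Ioo (-R) R) :=
    ((continuousOn_dslope (isOpen_Ioo.mem_nhds h0)).mpr
      ⟨fun r hr => (hD r hr).continuousAt.continuousWithinAt, (hD 0 h0).differentiableAt⟩).neg
  refine ⟨hcont.mono hsub, fun r hr => ?_⟩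
  have hmul : ∀ s, s * -dslope D 0 s = -D s := fun s => by
    have := sub_smul_dslope D 0 s
    rw [hD0, sub_zero, sub_zero, smul_eq_mul] at this
    linarith
  rcases eq_or_lt_of_le hr.1 with rfl | hr0
  -- At r = 0 the integral equation is pointwise; it follows by letting r decrease to 0 in `heq`,
  -- since D'(0) is the value of the slope quotient there.
  · have hy0 : -dslope D 0 0 = P.τ (f 0 - P.k * -dslope D 0 0) := by
      have t1 : Tendsto D' (𝓝[>] 0) (𝓝 (D' 0)) :=
        (hD'.continuousAt (isOpen_Ioo.mem_nhds h0)).tendsto.mono_left nhdsWithin_le_nhds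
      have t2 : Tendsto (fun r => -P.τ (f r - P.k * -dslope D 0 r)) (𝓝[>] 0)
          (𝓝 (-P.τ (f 0 - P.k * -dslope D 0 0))) :=
        (((P.continuous_τ.comp_continuousOn (hf.sub (continuousOn_const.mul hcont))).neg
          ).continuousAt (isOpen_Ioo.mem_nhds h0)).tendsto.mono_left nhdsWithin_le_nhds
      have t3 := tendsto_nhds_unique t1 (t2.congr' (by
        filter_upwards [Ioo_mem_nhdsGT hR] with r hr using (heq r hr).symm))
      rw [dslope_same, (hD 0 h0).deriv] at t3 ⊢
      linarith
    simp only [mean, zero_mul, integral_weight, source]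
    rw [← hy0]
    have hn : (0 : ℝ) < P.n + 1 := by positivity
    rw [eq_div_iff hn.ne']
    ring
  -- With y = -D / s, the derivative of -sⁿ D = s^(n+1) y is exactly sⁿ times the source.
  · have h1 := intervalIntegral.integral_eq_sub_of_hasDerivAt_of_le hr0.le
      (f := fun s => -(s ^ P.n * D s)) (f' := fun s => s ^ P.n * P.source (f s) (-dslope D 0 s))
      (((continuousOn_pow _).mul fun s hs =>
        (hD s (hsub ⟨hs.1, hs.2.trans hr.2⟩)).continuousAt.continuousWithinAt).neg)
      (fun s hs => by
        have hsI : s ∈ Set.Ioo 0 R := ⟨hs.1, (hs.2.le.trans hr.2).trans_lt hT⟩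
        refine ((hasDerivAt_pow P.n s).mul (hD s ⟨by linarith [hs.1], hsI.2⟩)).neg.congr_deriv
          ?_
        have hD1 : D s = -(s * -dslope D 0 s) := by rw [hmul, neg_neg]
        rw [heq s hsI, source]
        nth_rewrite 1 [hD1]
        rcases Nat.eq_zero_or_pos P.n with h | h
        · simp [h]
        · obtain ⟨m, hm⟩ := Nat.exists_eq_succ_of_ne_zero h.ne'
          rw [hm]
          push_cast
          simp only [Nat.succ_eq_add_one]
          ring)
      (((continuousOn_pow _).mul (P.continuous_source.comp_continuousOn
        (hf.prodMk hcont))).mono (by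
          rw [Set.uIcc_of_le hr0.le]
          exact (Set.Icc_subset_Icc_right hr.2).trans hsub)).intervalIntegrable
    rw [← pow_mul_mean, hD0, mul_zero, neg_zero, sub_zero, ← mul_neg, ← hmul r, ← mul_assoc,
      ← pow_succ] at h1
    exact (mul_left_cancel₀ (pow_ne_zero _ hr0.ne') h1).symm

end RadialParams

/-- The restriction of a function to the ray spanned by a vector. -/
def rayProfile (e : EuclideanSpace ℝ (Fin N)) (u : EuclideanSpace ℝ (Fin N) → ℝ) (r : ℝ) : ℝ :=
  u (r • e)

variable {p q R : ℝ} {u v : EuclideanSpace ℝ (Fin N) → ℝ} {e : EuclideanSpace ℝ (Fin N)}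

theorem smul_mem_ball_of_norm_eq_one (he : ‖e‖ = 1) {r : ℝ} :
    r • e ∈ Metric.ball (0 : EuclideanSpace ℝ (Fin N)) R ↔ r ∈ Set.Ioo (-R) R := by
  simp [norm_smul, he, abs_lt]

theorem IsBallDirichletSolution.contDiffOn_rayProfile (h : IsBallDirichletSolution F p q R u v)
    (he : ‖e‖ = 1) : ContDiffOn ℝ 2 (rayProfile e u) (Set.Ioo (-R) R) :=
  h.contDiffOn_u.comp (contDiff_id.smul contDiff_const).contDiffOn
    fun _ hr => (smul_mem_ball_of_norm_eq_one he).mpr hr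

theorem IsBallDirichletSolution.antitoneOn_rayProfile {s₁ s₂ : ℝ}
    (h : IsBallDirichletSolution F p q R u v)
    (hF : IsPucciType lam Lam s₁ s₂ F) (hN : 1 ≤ N) (hR : 0 < R) (hp : 0 < p) (hq : 0 < q)
    (he : ‖e‖ = 1) : AntitoneOn (rayProfile e u) (Set.Ioo 0 R) := by
  intro r hr s hs hrs
  rcases eq_or_lt_of_le hrs with rfl | hrs
  · exact le_rfl
  have hin : inner ℝ (s • e) e = s := by
    rw [real_inner_smul_left, real_inner_self_eq_norm_sq, he]
    ring
  -- The plane halfway between r e and s e exchanges these two points.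
  have h1 := (h.reflectedLE hF hN hR hp hq he ((r + s) / 2) (by linarith [hr.1, hs.1])
    (by linarith [hr.2, hs.2])).1 (s • e)
    ((smul_mem_ball_of_norm_eq_one he).mpr ⟨by linarith [hs.1, hs.2], hs.2⟩)
    (by rw [hin]; linarith)
  rwa [planeRefl, hin, ← sub_smul, show s - 2 * (s - (r + s) / 2) = r by ring] at h1

theorem IsBallDirichletSolution.eq_rayProfile {s₁ s₂ : ℝ} (h : IsBallDirichletSolution F p q R u v)
    (hF : IsPucciType lam Lam s₁ s₂ F) (hN : 1 ≤ N) (hR : 0 < R) (hp : 0 < p) (hq : 0 < q)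
    (he : ‖e‖ = 1) {x : EuclideanSpace ℝ (Fin N)} (hx : x ∈ Metric.ball 0 R) :
    u x = rayProfile e u ‖x‖ :=
  h.radial hF hN hR hp hq hx (by simp [norm_smul, he])

theorem IsBallDirichletSolution.deriv_rayProfile_zero {s₁ s₂ : ℝ}
    (h : IsBallDirichletSolution F p q R u v)
    (hF : IsPucciType lam Lam s₁ s₂ F) (hN : 1 ≤ N) (hR : 0 < R) (hp : 0 < p) (hq : 0 < q)
    (he : ‖e‖ = 1) : deriv (rayProfile e u) 0 = 0 := by
  have h0 : Set.Ioo (-R) R ∈ 𝓝 (0 : ℝ) := Ioo_mem_nhds (by linarith) hR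
  have h1 : HasDerivAt (rayProfile e u) (deriv (rayProfile e u) 0) (-0) := by
    rw [neg_zero]
    exact (((h.contDiffOn_rayProfile he).contDiffAt h0).differentiableAt (by norm_num)).hasDerivAt
  have h2 := h1.comp (0 : ℝ) (hasDerivAt_neg (0 : ℝ))
  have h3 : rayProfile e u =ᶠ[𝓝 0] rayProfile e u ∘ Neg.neg := by
    filter_upwards [h0] with r hr
    exact h.radial hF hN hR hp hq ((smul_mem_ball_of_norm_eq_one he).mpr hr) (by simp)
  have h4 := (h2.congr_of_eventuallyEq h3).deriv
  linarith

/-- The ordinary differential equation satisfied by the profile of a solution. -/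
theorem IsBallDirichletSolution.deriv_deriv_rayProfile (h : IsBallDirichletSolution F p q R u v)
    (hF : IsPucciType lam Lam P.s₁ P.s₂ F) (hN : 1 ≤ N) (hk : P.k = (N - 1) * P.s₁)
    (hR : 0 < R) (hp : 0 < p) (hq : 0 < q) (he : ‖e‖ = 1) {r : ℝ} (hr : r ∈ Set.Ioo 0 R) :
    deriv (deriv (rayProfile e u)) r = -P.τ (posPow p (rayProfile e v r) -
      P.k * -dslope (deriv (rayProfile e u)) 0 r) := by
  set U := rayProfile e u with hU
  set D := deriv U with hD
  have hD0 : D 0 = 0 := h.deriv_rayProfile_zero hF hN hR hp hq he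
  have hcd := h.contDiffOn_rayProfile he
  have hcd' : ContDiffOn ℝ 1 D (Set.Ioo (-R) R) := by
    have := (contDiffOn_succ_iff_deriv_of_isOpen (n := 1) isOpen_Ioo).mp (by
      simpa [one_add_one_eq_two] using hcd)
    exact this.2.2
  have hrR : ∀ s ∈ Set.Ioo 0 R, s ∈ Set.Ioo (-R) R := fun s hs => ⟨by linarith [hs.1], hs.2⟩
  have hdU : ∀ s ∈ Set.Ioo 0 R, HasDerivAt U (D s) s := fun s hs =>
    ((hcd.contDiffAt (isOpen_Ioo.mem_nhds (hrR s hs))).differentiableAt (by norm_num)).hasDerivAt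
  have hdD : HasDerivAt D (deriv D r) r :=
    ((hcd'.contDiffAt (isOpen_Ioo.mem_nhds (hrR r hr))).differentiableAt (by norm_num)).hasDerivAt
  -- The sign from moving planes selects the slope s₁ for the tangential eigenvalue, so that it
  -- enters the equation linearly.
  have hD_nonpos : D r ≤ 0 := by
    refine HasDerivWithinAt.nonpos_of_antitoneOn ?_ (hdU r hr).hasDerivWithinAt
      (h.antitoneOn_rayProfile hF hN hR hp hq he)
    simpa using (PerfectSpace.univ_preperfect (α := ℝ)).open_inter isOpen_Ioo r ⟨hr, trivial⟩
  have hn : ‖r • e‖ = r := by rw [norm_smul, he, mul_one, Real.norm_of_nonneg hr.1.le]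
  have hball : r • e ∈ Metric.ball (0 : EuclideanSpace ℝ (Fin N)) R :=
    (smul_mem_ball_of_norm_eq_one he).mpr (hrR r hr)
  have hne : r • e ≠ 0 := by
    rw [← norm_ne_zero_iff, hn]
    exact hr.1.ne'
  have hg : HasDerivAt (fun s => D s / s) ((deriv D r - D r / r) / r) ‖r • e‖ := by
    rw [hn]
    refine (hdD.div (hasDerivAt_id r) hr.1.ne').congr_deriv ?_
    have := hr.1.ne'
    simp only [id]
    field_simp
  have hess := hessianMatrix_of_gradient (u := u) (x := r • e) (G := fun y => (D ‖y‖ / ‖y‖) • y)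
    (by
      have hev : ∀ᶠ y in 𝓝 (r • e), y ∈ Metric.ball (0 : EuclideanSpace ℝ (Fin N)) R ∧ y ≠ 0 :=
        Filter.Eventually.and (Metric.isOpen_ball.mem_nhds hball) (isOpen_ne.mem_nhds hne)
      filter_upwards [hev] with y hy
      have hy0 : 0 < ‖y‖ := norm_pos_iff.mpr hy.2
      refine (hasFDerivAt_comp_norm (U := U) hy.2 ?_).congr_of_eventuallyEq ?_
      · rw [mul_div_cancel₀ _ hy0.ne']
        exact hdU _ ⟨hy0, by simpa using hy.1⟩
      · filter_upwards [Metric.isOpen_ball.mem_nhds hy.1] with z hz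
        exact h.eq_rayProfile hF hN hR hp hq he hz)
    (hasFDerivAt_norm_smul hne hg)
  have heq := h.eq_u (r • e) hball
  rw [hess, matrix_of_smul_id_add, hF.apply_add_smul hN, hn] at heq
  have hr0 : r ≠ 0 := hr.1.ne'
  have hm : D r / r ≤ 0 := div_nonpos_of_nonpos_of_nonneg hD_nonpos hr.1.le
  rw [show D r / r + (deriv D r - D r / r) / r / r * r ^ 2 = deriv D r by field_simp; ring,
    show biSlope P.s₁ P.s₂ (D r / r) = P.s₁ * (D r / r) by
      rw [biSlope, max_eq_right hm, max_eq_left (by linarith)]; ring] at heq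
  refine neg_tau_eq P ?_
  rw [dslope_of_ne _ hr0, slope_def_field, hD0, sub_zero, sub_zero,
    rayProfile, posPow_of_nonneg (h.pos_v _ hball).le, hk]
  linarith

theorem IsBallDirichletSolution.isSystemSol_rayProfile (h : IsBallDirichletSolution F p q R u v)
    (hF : IsPucciType lam Lam P.s₁ P.s₂ F) (hN : 1 ≤ N) (hk : P.k = (N - 1) * P.s₁)
    (hR : 0 < R) (hp : 0 < p) (hq : 0 < q) (he : ‖e‖ = 1) {T : ℝ} (hT : T < R) :
    P.IsSystemSol T (u 0) (v 0) p q (rayProfile e u) (rayProfile e v)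
      (fun r => -dslope (deriv (rayProfile e u)) 0 r)
      (fun r => -dslope (deriv (rayProfile e v)) 0 r) := by
  have key : ∀ {p q : ℝ} {u v : EuclideanSpace ℝ (Fin N) → ℝ},
      IsBallDirichletSolution F p q R u v → 0 < p → 0 < q →
      P.IsSol T (fun r => posPow p (rayProfile e v r))
        (fun r => -dslope (deriv (rayProfile e u)) 0 r) ∧
      ∀ r ∈ Set.Icc 0 T, rayProfile e u r =
        u 0 - ∫ s in (0 : ℝ)..r, s * -dslope (deriv (rayProfile e u)) 0 s := by
    intro p q u v h hp hq
    have hsub : Set.Icc 0 T ⊆ Set.Ioo (-R) R := fun r hr => ⟨by linarith [hr.1], hr.2.trans_lt hT⟩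
    have hD0 := h.deriv_rayProfile_zero hF hN hR hp hq he
    have hcd := h.contDiffOn_rayProfile he
    have hcd' : ContDiffOn ℝ 1 (deriv (rayProfile e u)) (Set.Ioo (-R) R) := by
      have := (contDiffOn_succ_iff_deriv_of_isOpen (n := 1) isOpen_Ioo).mp (by
        simpa [one_add_one_eq_two] using hcd)
      exact this.2.2
    refine ⟨RadialParams.isSol_neg_dslope hT hR
      ((h.swap.contDiffOn_rayProfile he).continuousOn.posPow hp)
      (fun r hr => ((hcd'.contDiffAt (isOpen_Ioo.mem_nhds hr)).differentiableAt
        (by norm_num)).hasDerivAt)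
      (hcd'.continuousOn_deriv_of_isOpen isOpen_Ioo le_rfl) hD0
      (fun r hr => h.deriv_deriv_rayProfile hF hN hk hR hp hq he hr), ?_⟩
    intro r hr
    have hmul : ∀ s, s * -dslope (deriv (rayProfile e u)) 0 s = -deriv (rayProfile e u) s :=
      fun s => by
        have := sub_smul_dslope (deriv (rayProfile e u)) 0 s
        rw [hD0, sub_zero, sub_zero, smul_eq_mul] at this
        linarith
    simp only [hmul]
    have hr' : Set.uIcc 0 r ⊆ Set.Ioo (-R) R := by
      rw [Set.uIcc_of_le hr.1]
      exact (Set.Icc_subset_Icc_right hr.2).trans hsub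
    rw [intervalIntegral.integral_neg, intervalIntegral.integral_eq_sub_of_hasDerivAt
      (fun s hs => ((hcd.contDiffAt (isOpen_Ioo.mem_nhds (hr' hs))).differentiableAt
        (by norm_num)).hasDerivAt) (hcd'.continuousOn.mono hr').intervalIntegrable]
    simp [rayProfile]
  exact ⟨(key h hp hq).1, (key h.swap hq hp).1, (key h hp hq).2, (key h.swap hq hp).2⟩

/-- Uniqueness identifies the profiles with the shooting solution started at (u 0, v 0) on [0, r]
for every r < R. The second derivatives are controlled only inside the ball, so the vanishing at R
is obtained from continuity as r tends to R. -/
theorem IsBallDirichletSolution.hits (h : IsBallDirichletSolution F p q R u v)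
    (hF : IsPucciType lam Lam P.s₁ P.s₂ F) (hN : 1 ≤ N) (hk : P.k = (N - 1) * P.s₁)
    (hR : 0 < R) (hp : 0 < p) (hq : 0 < q) : P.Hits (u 0) p q := by
  have he : ‖(EuclideanSpace.single (⟨0, hN⟩ : Fin N) (1 : ℝ))‖ = 1 := by simp
  set e := EuclideanSpace.single (⟨0, hN⟩ : Fin N) (1 : ℝ) with hedef
  have h0 : (0 : EuclideanSpace ℝ (Fin N)) ∈ Metric.ball 0 R := by simpa using hR
  have key : ∀ {p q : ℝ} {u v : EuclideanSpace ℝ (Fin N) → ℝ},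
      IsBallDirichletSolution F p q R u v → 0 < p → 0 < q →
      P.limU (u 0) (v 0) p q R = 0 := by
    intro p q u v h hp hq
    have hR' : u (R • e) = 0 := h.boundary_u _ (by simp [norm_smul, he, abs_of_pos hR])
    have hc : Tendsto (rayProfile e u) (𝓝[<] R) (𝓝 0) := by
      rw [← hR']
      have h1 : ContinuousOn (rayProfile e u) (Set.Icc 0 R) :=
        h.continuousOn_u.comp (continuous_id.smul continuous_const).continuousOn fun r hr => by
          simpa [norm_smul, he, abs_of_nonneg hr.1] using hr.2
      refine (h1 R ⟨hR.le, le_rfl⟩).tendsto.mono_left ?_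
      rw [← nhdsWithin_Ioo_eq_nhdsLT hR]
      exact nhdsWithin_mono _ Set.Ioo_subset_Icc_self
    have hl : Tendsto (P.limU (u 0) (v 0) p q) (𝓝[<] R) (𝓝 (P.limU (u 0) (v 0) p q R)) :=
      (RadialParams.limU_adm hp hq).cont.continuousAt.tendsto.mono_left nhdsWithin_le_nhds
    refine tendsto_nhds_unique hl (hc.congr' ?_)
    filter_upwards [Ioo_mem_nhdsLT hR] with r hr
    exact ((h.isSystemSol_rayProfile hF hN hk hR hp hq he hr.2).unique
      (RadialParams.isSystemSol_limU_limU hp hq r) hp hq r ⟨hr.1.le, le_rfl⟩).1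
  exact ⟨v 0, h.pos_v 0 h0, R, hR, key h hp hq, key h.swap hq hp⟩

/-- The set of exponents of a solvable Dirichlet problem is open. -/
theorem IsPucciType.isOpen_ballSolvableExponents {s₁ s₂ : ℝ} (hF : IsPucciType lam Lam s₁ s₂ F)
    (hN : 1 ≤ N) (hR : 0 < R) : IsOpen (ballSolvableExponents F R) := by
  have hs₁ : 0 < s₁ := hF.lam_pos.trans_le hF.lam_le₁
  have hs₂ : 0 < s₂ := hF.lam_pos.trans_le hF.lam_le₂
  have hN' : (0 : ℝ) ≤ N - 1 := by
    have : (1 : ℝ) ≤ N := by exact_mod_cast hN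
    linarith
  let P : RadialParams :=
    { s₁ := s₁
      s₂ := s₂
      k := (N - 1) * s₁
      n := ⌈(N - 1) * s₁ * (s₂⁻¹ + s₁⁻¹) + 1⌉₊
      s₁_pos := hs₁
      s₂_pos := hs₂
      k_nonneg := mul_nonneg hN' hs₁.le
      le_n := Nat.le_ceil _ }
  rw [isOpen_iff_mem_nhds]
  rintro ⟨p, q⟩ ⟨hp, hq, hpq, u, v, h⟩
  have hpos : 0 < u 0 := h.pos_u 0 (by simpa using hR)
  -- The value a = u 0 is kept fixed for all nearby exponents; the other initial value and the
  -- radius are free to move.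
  have hH : P.Hits (u 0) p q := h.hits (P := P) hF hN rfl hR hp hq
  have h1 : ∀ᶠ z : ℝ × ℝ in 𝓝 (p, q), 0 < z.1 := continuous_fst.continuousAt.eventually (lt_mem_nhds hp)
  have h2 : ∀ᶠ z : ℝ × ℝ in 𝓝 (p, q), 0 < z.2 := continuous_snd.continuousAt.eventually (lt_mem_nhds hq)
  have h3 : ∀ᶠ z : ℝ × ℝ in 𝓝 (p, q), 1 < z.1 * z.2 :=
    (continuous_fst.mul continuous_snd).continuousAt.eventually (lt_mem_nhds hpq)
  filter_upwards [hH.eventually hp hq hpos, h1, h2, h3] with z hz h1 h2 h3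
  exact ⟨h1, h2, h3, (hz.radiallySolvable h1 h2 h3 hpos hR).exists_solution hF hN rfl hR h1 h2⟩

end

theorem mainTheorem9 (N : ℕ) (hN : 3 ≤ N) (lam Lam : ℝ) (hlam : 0 < lam) (hLam : lam ≤ Lam)
    (R : ℝ) (hR : 0 < R) :
    IsOpen (ballSolvableExponents (N := N) (pucciSup lam Lam) R) ∧
      IsOpen (ballSolvableExponents (N := N) (pucciInf lam Lam) R) :=
  ⟨(isPucciType_pucciSup hlam hLam (by omega)).isOpen_ballSolvableExponents (by omega) hR,
    (isPucciType_pucciInf hlam hLam (by omega)).isOpen_ballSolvableExponents (by omega) hR⟩
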